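/- **Setting.** Let $\Sigma$ be a finite set of function symbols and $\Sigma_A\subseteq\Sigma$ the set of associative symbols; symbols in $\Sigma_A$ are variadic with arities $2,3,4,\dots$, and every other symbol has a fixed arity $\ge 1$. Let $C_0$ be a finite set of constants with a total precedence whose minimal element is $1\in C_0$, and let $W=\{c_0,c_1,\dots\}$ be an infinite set of further constants. For $C_0\subseteq C\subseteq C_0\cup W$ let $T(\Sigma,C)$ be the set of ground terms. Let $A$ be the set of axioms $g(\vec x,g(\vec y),\vec z)\approx g(\vec x,\vec y,\vec z)$, $g\in\Sigma_A$; fix $f\in\Sigma_A$ and let $M=A\cup\{f(x,1)\approx x,\ f(1,x)\approx x\}$, $R(M)=\{f(x,1)\to x,\ f(1,x)\to x\}$, and let $gr(R(M))$ be the set of ground instances of $R(M)$ over $T(\Sigma,C)$. Equations are unordered pairs. For a ground rewrite system $R$, $u\to_{R/A}v$ means $u\approx_A s\to_R t\approx_A v$ for some $s,t$. Let $E$ be a finite set of equations between terms of $T(\Sigma,C_0)$. $CC^M(E)$ is the smallest congruence on $T(\Sigma,C_0)$ containing $E$ and all instances of $M$ over $T(\Sigma,C_0)$, and $s\approx_E^M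 t$ means that $s=t$ holds in all models of $E\cup M$. **Flattening.** Replace all terms in $E$ by their associatively flat forms, then by their (flat) $R(M)/A$-normal forms, and drop trivial equations. Then repeatedly choose an equation that is not $A$-flat and an occurrence in it of a subterm $g(d_1,\dots,d_n)$ with constants $d_i$, and replace it either by a constant $c\in W$ not used so far, adding $g(d_1,\dots,d_n)\approx c$, or by a constant $c$ for which another equation $g(d_1,\dots,d_n)\approx c$ is already present. Stop, after finitely many steps, when every equation is a constant equation $c\approx d$, a $D$-flat equation $g(d_1,\dots,d_n)\approx c$, or an $A$-flat equation $g(c_1,\dots,c_m)\approx g(d_1,\dots,d_n)$ with $g\in\Sigma_A$. Let $E'$ be any set obtained in this way, $C_1\subset W$ the set of new constants used, $C=C_0\cup C_1$, and $S(E)=E'\cup U(C)$ with $U(C)=\{f(c,1)\approx c,\ f(1,c)\approx c\mid c\in C\}$. **Completion.** Let $\succ$ be the following order on flat terms: on constants, the precedence on $C_0$, $c\succ c'$ for $c\in C_1,c'\in C_0$, and $c_i\succ c_j$ for $i<j$; every non-constant term is greater than every constant; and $g(u)\succ g(v)$ for $g\in\Sigma_A$ if the string $u$ is length-lexicographically greater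 than $v$. With $\bar g(u)=g(u)$ if $|u|\ge2$ and $\bar g(u)=u$ if $|u|=1$ (arguments headed by $g$ being flattened), the inference rules on sets of flat ground equations are: * DEDUCE: from $g(u_1u_2)\approx s$ and $g(u_2u_3)\approx t$ add $g(u_1t)\approx g(su_3)$, if $g\in\Sigma_A$, $g(u_1u_2)\succ s$, $g(u_2u_3)\succ t$ and $u_1,u_2,u_3$ are nonempty. * SIMPLIFY: in the presence of $g(u_2)\approx t$ replace $g(u_1u_2u_3)\approx s$ by $\bar g(u_1tu_3)\approx s$, if $g\in\Sigma_A$, $g(u_2)\succ t$, and $s\succ t$ in case $u_1u_3$ is empty. * COLLAPSE: in the presence of $u\approx d$ replace $s[u]\approx t$ by $s[d]\approx t$, if $s[u]\succ t$, $u\succ d$, $d\in C$, $u$ is not headed by a symbol of $\Sigma_A$, and $t\succ d$ in case $s[u]=u$. * COMPOSE: in the presence of $c\approx d$ replace $t\approx c$ by $t\approx d$, if $t\succ c\succ d$ and $c,d\in C$. * DELETE: remove $s\approx s$. A derivation $S_0\vdash S_1\vdash\cdots$ (finite or infinite) is fair if every inference that is continuously enabled from some point on is applied at some point of the period during which it is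 continuously enabled. Let $S_\infty(E)=\bigcup_i\bigcap_{j\ge i}S_j$ for any fair derivation with $S_0=S(E)$, and let $S_\infty^\succ(E)$ be the rewrite system of all rules $l\to r$ with $l\approx r\in S_\infty(E)$ and $l\succ r$. (A finite derivation is continued by repeating its last state.) **Statement.** Let $R=S_\infty^\succ(E)\cup gr(R(M))$. 1. Every $s_0\in T(\Sigma,C_0)$ has an $R/A$-normal form, unique up to $\approx_A$; and for all $s_0,t_0\in T(\Sigma,C_0)$, $s_0\approx t_0\in CC^M(E)$ if and only if $s_0$ and $t_0$ have the same $R/A$-normal form (up to $\approx_A$). 2. If $S_\infty(E)$ is finite, then the word problem $\{(s_0,t_0)\in T(\Sigma,C_0)^2\mid s_0\approx_E^M t_0\}$ is decidable. -/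

import Mathlib

universe u

namespace CCM

/-- Raw variadic terms over function symbols `F` and constant symbols `K` (no variables). -/
inductive Term (F K : Type u) : Type u
  | const : K → Term F K
  | app : F → List (Term F K) → Term F K

/-- A signature: associative symbols are variadic with arities `2, 3, 4, …`, every other symbol `g`
has the fixed arity `arity g ≥ 1` (the value of `arity` at associative symbols is not used). -/
structure Signature (F : Type u) where
  assoc : Set F
  arity : F → ℕ
  arity_pos : ∀ g, 1 ≤ arity g

def Signature.ValidArity {F : Type u} (sig : Signature F) (g : F) (n : ℕ) : Prop :=
  (g ∈ sig.assoc ∧ 2 ≤ n) ∨ (g ∉ sig.assoc ∧ n = sig.arity g)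

section General

variable {F K : Type u}

/-- `Ground sig C t` says that `t` belongs to the set `T(Σ, C)` of ground terms. -/
inductive Ground (sig : Signature F) (C : Set K) : Term F K → Prop
  | const (c : K) : c ∈ C → Ground sig C (.const c)
  | app (g : F) (ts : List (Term F K)) :
      sig.ValidArity g ts.length → (∀ t ∈ ts, Ground sig C t) → Ground sig C (.app g ts)

/-- The smallest congruence on `T(Σ, C)` that contains `R`
(to be used for `R` between elements of `T(Σ, C)`). -/
inductive CongClosure (sig : Signature F) (C : Set K) (R : Term F K → Term F K → Prop) :
    Term F K → Term F K → Prop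
  | base {s t} : R s t → CongClosure sig C R s t
  | refl {s} : Ground sig C s → CongClosure sig C R s s
  | symm {s t} : CongClosure sig C R s t → CongClosure sig C R t s
  | trans {s t r} : CongClosure sig C R s t → CongClosure sig C R t r → CongClosure sig C R s r
  | congr (g : F) (ss ts : List (Term F K)) (hlen : ss.length = ts.length) :
      sig.ValidArity g ss.length →
      (∀ (i : ℕ) (h : i < ss.length), CongClosure sig C R ss[i] (ts[i]'(hlen ▸ h))) →
      CongClosure sig C R (.app g ss) (.app g ts)

/-- Ground instances over `T(Σ, C)` of the variadic associativity axioms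
`g(x⃗, g(y⃗), z⃗) ≈ g(x⃗, y⃗, z⃗)`, for all associative symbols `g`. -/
inductive AInst (sig : Signature F) (C : Set K) : Term F K → Term F K → Prop
  | mk (g : F) (xs ys zs : List (Term F K)) : g ∈ sig.assoc →
      Ground sig C (.app g (xs ++ .app g ys :: zs)) →
      AInst sig C (.app g (xs ++ .app g ys :: zs)) (.app g (xs ++ ys ++ zs))

/-- Ground instances over `T(Σ, C)` of the unit axioms `f(x, 1) ≈ x` and `f(1, x) ≈ x`;
read from left to right these are the rules of `gr(R(M))`. -/
inductive UInst (sig : Signature F) (f : F) (one : K) (C : Set K) : Term F K → Term F K → Prop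
  | right (t : Term F K) : Ground sig C t → UInst sig f one C (.app f [t, .const one]) t
  | left (t : Term F K) : Ground sig C t → UInst sig f one C (.app f [.const one, t]) t

/-- Equality modulo associativity on `T(Σ, C)`. -/
def AEq (sig : Signature F) (C : Set K) : Term F K → Term F K → Prop :=
  CongClosure sig C (AInst sig C)

/-- Equations are unordered pairs of terms. -/
abbrev Eqn (F K : Type u) := Sym2 (Term F K)

/-- Congruence closure of `E` w.r.t. the monoid axioms, on `T(Σ, C)`. -/
def CCMonoid (sig : Signature F) (f : F) (one : K) (C : Set K) (E : Set (Eqn F K)) :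
    Term F K → Term F K → Prop :=
  CongClosure sig C fun s t => s(s, t) ∈ E ∨ AInst sig C s t ∨ UInst sig f one C s t

/-! ### Models -/

/-- Algebras. The value of `op g` matters only at argument lists of a length allowed for `g`. -/
structure Alg (F K : Type u) where
  carrier : Type u
  cst : K → carrier
  op : F → List carrier → carrier

def Alg.eval (𝒜 : Alg F K) : Term F K → 𝒜.carrier
  | .const c => 𝒜.cst c
  | .app g ts => 𝒜.op g (ts.map fun t => 𝒜.eval t)

/-- `𝒜` is a model of the monoid axioms: all associativity axioms and the unit axioms for `f`. -/
def Alg.ModelsMonoid (𝒜 : Alg F K) (sig : Signature F) (f : F) (one : K) : Prop :=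
  (∀ g ∈ sig.assoc, ∀ xs ys zs : List 𝒜.carrier, 2 ≤ ys.length → 1 ≤ xs.length + zs.length →
    𝒜.op g (xs ++ 𝒜.op g ys :: zs) = 𝒜.op g (xs ++ ys ++ zs)) ∧
  (∀ a, 𝒜.op f [a, 𝒜.cst one] = a) ∧ (∀ a, 𝒜.op f [𝒜.cst one, a] = a)

def Alg.ModelsEqns (𝒜 : Alg F K) (E : Set (Eqn F K)) : Prop :=
  ∀ s t, s(s, t) ∈ E → 𝒜.eval s = 𝒜.eval t

/-- `s ≈ t` holds in all models of `E` and the monoid axioms. -/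
def EntailsMonoid (sig : Signature F) (f : F) (one : K) (E : Set (Eqn F K))
    (s t : Term F K) : Prop :=
  ∀ 𝒜 : Alg F K, 𝒜.ModelsEqns E → 𝒜.ModelsMonoid sig f one → 𝒜.eval s = 𝒜.eval t

/-! ### Rewriting modulo associativity -/

/-- `ReplaceOne l r s t`: for some context, `s = s[l]` and `t = s[r]`
(one occurrence of `l` is replaced by `r`). -/
inductive ReplaceOne (l r : Term F K) : Term F K → Term F K → Prop
  | root : ReplaceOne l r l r
  | arg (g : F) (xs zs : List (Term F K)) {s t : Term F K} :
      ReplaceOne l r s t → ReplaceOne l r (.app g (xs ++ s :: zs)) (.app g (xs ++ t :: zs))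

/-- The rewrite relation `R/A` on `T(Σ, C)`, for a ground rewrite system `R`. -/
def RewriteModA (sig : Signature F) (C : Set K) (R : Term F K → Term F K → Prop)
    (u v : Term F K) : Prop :=
  ∃ s t l r, AEq sig C u s ∧ R l r ∧ ReplaceOne l r s t ∧ AEq sig C t v

/-- `u` is a normal form of `s` w.r.t. `R/A`. -/
def IsNormalFormOf (sig : Signature F) (C : Set K) (R : Term F K → Term F K → Prop)
    (s u : Term F K) : Prop :=
  Relation.ReflTransGen (RewriteModA sig C R) s u ∧ ∀ v, ¬ RewriteModA sig C R u v

/-- `s` and `t` have the same normal form w.r.t. `R/A` (terms are identified modulo `A`). -/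
def SameNormalForm (sig : Signature F) (C : Set K) (R : Term F K → Term F K → Prop)
    (s t : Term F K) : Prop :=
  ∃ u v, IsNormalFormOf sig C R s u ∧ IsNormalFormOf sig C R t v ∧ AEq sig C u v

/-- Associatively flat terms. -/
inductive AssocFlat (sig : Signature F) : Term F K → Prop
  | const (c : K) : AssocFlat sig (.const c)
  | app (g : F) (ts : List (Term F K)) : (∀ t ∈ ts, AssocFlat sig t) →
      (g ∈ sig.assoc → ∀ t ∈ ts, ∀ ss, t ≠ .app g ss) → AssocFlat sig (.app g ts)

/-! ### Flat equations -/

/-- The term `g(c₁, …, cₙ)` for the string `c₁ ⋯ cₙ` of constants. -/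
def str (g : F) (cs : List K) : Term F K := .app g (cs.map .const)

/-- The term `ḡ(u)` for a nonempty string `u`: `u` itself if it has length one, else `g(u)`. -/
def bar (g : F) : List K → Term F K
  | [c] => .const c
  | cs => str g cs

def IsConstEqn (e : Eqn F K) : Prop := ∃ c d : K, e = s(.const c, .const d)

def IsDFlat (sig : Signature F) (e : Eqn F K) : Prop :=
  ∃ (g : F) (cs : List K) (c : K), sig.ValidArity g cs.length ∧ e = s(str g cs, .const c)

def IsAFlat (sig : Signature F) (e : Eqn F K) : Prop :=
  ∃ g ∈ sig.assoc, ∃ cs ds : List K, 2 ≤ cs.length ∧ 2 ≤ ds.length ∧ e = s(str g cs, str g ds)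

def IsFlatEqn (sig : Signature F) (e : Eqn F K) : Prop :=
  IsConstEqn e ∨ IsDFlat sig e ∨ IsAFlat sig e

end General

section Completion

variable {F C₀ : Type u}

/-- Constants: the original ones, and the infinite supply `W = {c₀, c₁, …}` of new ones. -/
abbrev Cst (C₀ : Type u) := C₀ ⊕ ULift.{u} ℕ

def new (i : ℕ) : Cst C₀ := Sum.inr ⟨i⟩

/-- The constants `C₀`. -/
def baseConsts (C₀ : Type u) : Set (Cst C₀) := Set.range Sum.inl

/-- The constants `C = C₀ ∪ C₁`, where `C₁` consists of the new constants with index in `D`. -/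
def allConsts (C₀ : Type u) (D : Set ℕ) : Set (Cst C₀) := baseConsts C₀ ∪ new '' D

/-! ### Phase I -/

/-- Phase I, step 1: all terms are replaced by their associatively flat forms. -/
def phaseI₁ (sig : Signature F) (E : Set (Eqn F (Cst C₀))) : Set (Eqn F (Cst C₀)) :=
  {e | ∃ s t s' t', s(s, t) ∈ E ∧ AEq sig (baseConsts C₀) s s' ∧ AssocFlat sig s' ∧
    AEq sig (baseConsts C₀) t t' ∧ AssocFlat sig t' ∧ e = s(s', t')}

/-- Phase I, step 2: all terms are replaced by their (associatively flat) normal forms w.r.t.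
`R(M)/A`, and trivial equations are removed. -/
def phaseI₂ (sig : Signature F) (f : F) (one : C₀) (E : Set (Eqn F (Cst C₀))) :
    Set (Eqn F (Cst C₀)) :=
  {e | ∃ s t s' t', s(s, t) ∈ E ∧
    IsNormalFormOf sig (baseConsts C₀) (UInst sig f (.inl one) (baseConsts C₀)) s s' ∧
    AssocFlat sig s' ∧
    IsNormalFormOf sig (baseConsts C₀) (UInst sig f (.inl one) (baseConsts C₀)) t t' ∧
    AssocFlat sig t' ∧ s' ≠ t' ∧ e = s(s', t')}

/-- One flattening step of Phase I, step 3. A state consists of the current equations and of the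
indices of the new constants already used. An occurrence of a subterm `g(c₁, …, cₙ)` in an equation
that is not an A-flat equation is replaced by a constant: either by a fresh one, whose defining
equation is added, or by a constant `c` such that `g(c₁, …, cₙ) ≈ c` is already present. -/
inductive FlattenStep (sig : Signature F) :
    Set (Eqn F (Cst C₀)) × Set ℕ → Set (Eqn F (Cst C₀)) × Set ℕ → Prop
  | fresh (S : Set (Eqn F (Cst C₀))) (D : Set ℕ) (p p' q : Term F (Cst C₀)) (g : F)
      (cs : List (Cst C₀)) (i : ℕ) :
      s(p, q) ∈ S → ¬ IsAFlat sig s(p, q) → i ∉ D →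
      ReplaceOne (str g cs) (.const (new i)) p p' →
      FlattenStep sig (S, D)
        ((S \ {s(p, q)}) ∪ {s(p', q), s(str g cs, .const (new i))}, insert i D)
  | reuse (S : Set (Eqn F (Cst C₀))) (D : Set ℕ) (p p' q : Term F (Cst C₀)) (g : F)
      (cs : List (Cst C₀)) (c : Cst C₀) :
      s(p, q) ∈ S → ¬ IsAFlat sig s(p, q) →
      s(str g cs, .const c) ∈ S → s(str g cs, .const c) ≠ s(p, q) →
      ReplaceOne (str g cs) (.const c) p p' →
      FlattenStep sig (S, D) ((S \ {s(p, q)}) ∪ {s(p', q)}, D)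

/-- `E'` is an output of Phase I on input `E`, with new constants those with index in `D`. -/
def PhaseI (sig : Signature F) (f : F) (one : C₀) (E E' : Set (Eqn F (Cst C₀))) (D : Set ℕ) :
    Prop :=
  Relation.ReflTransGen (FlattenStep sig) (phaseI₂ sig f one (phaseI₁ sig E), ∅) (E', D) ∧
    ∀ e ∈ E', IsFlatEqn sig e

/-! ### Phase II -/

/-- `U(C) = {f(c, 1) ≈ c | c ∈ C} ∪ {f(1, c) ≈ c | c ∈ C}`. -/
def unitEqns (f : F) (one : C₀) (C : Set (Cst C₀)) : Set (Eqn F (Cst C₀)) :=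
  {e | ∃ c ∈ C, e = s(str f [c, .inl one], .const c) ∨ e = s(str f [.inl one, c], .const c)}

/-! ### The ordering -/

/-- The precedence on constants: `CstGt c d` means `c ≻ d`. New constants are greater than original
ones, `cᵢ ≻ cⱼ` for `i < j`, and on `C₀` the given total precedence is used. -/
def CstGt [LinearOrder C₀] : Cst C₀ → Cst C₀ → Prop
  | .inl a, .inl b => b < a
  | .inl _, .inr _ => False
  | .inr _, .inl _ => True
  | .inr i, .inr j => i.down < j.down

/-- Length-lexicographic ordering on strings of constants: `LenLexGt u v` means `u ≻_L v`. -/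
def LenLexGt [LinearOrder C₀] (u v : List (Cst C₀)) : Prop :=
  List.Shortlex (fun a b => CstGt b a) v u

/-- The ordering `≻` on flat terms. -/
inductive Gt [LinearOrder C₀] (sig : Signature F) : Term F (Cst C₀) → Term F (Cst C₀) → Prop
  | const {c d : Cst C₀} : CstGt c d → Gt sig (.const c) (.const d)
  | app_const (g : F) (ts : List (Term F (Cst C₀))) (c : Cst C₀) : Gt sig (.app g ts) (.const c)
  | assoc {g : F} {us vs : List (Cst C₀)} : g ∈ sig.assoc → 2 ≤ us.length → 2 ≤ vs.length →
      LenLexGt us vs → Gt sig (str g us) (str g vs)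

/-! ### Phase III -/

/-- An instance of an inference rule: the premises have to be present, the equations in `del` are
deleted, and those in `add` are added. -/
structure Inference (F C₀ : Type u) where
  prem : Set (Eqn F (Cst C₀))
  del : Set (Eqn F (Cst C₀))
  add : Set (Eqn F (Cst C₀))

/-- The inference rules. A side `ḡ(v)` with `v` nonempty is a constant or a term headed by `g`, and
arguments headed by `g` are flattened in the conclusions. -/
inductive IsInference [LinearOrder C₀] (sig : Signature F) : Inference F C₀ → Prop
  | deduce (g : F) (u₁ u₂ u₃ v w : List (Cst C₀)) : g ∈ sig.assoc →
      u₁ ≠ [] → u₂ ≠ [] → u₃ ≠ [] → v ≠ [] → w ≠ [] →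
      Gt sig (str g (u₁ ++ u₂)) (bar g v) → Gt sig (str g (u₂ ++ u₃)) (bar g w) →
      IsInference sig
        { prem := {s(str g (u₁ ++ u₂), bar g v), s(str g (u₂ ++ u₃), bar g w)}
          del := ∅
          add := {s(str g (u₁ ++ w), str g (v ++ u₃))} }
  | simplify (g : F) (u₁ u₂ u₃ w : List (Cst C₀)) (s : Term F (Cst C₀)) : g ∈ sig.assoc →
      2 ≤ u₂.length → w ≠ [] →
      Gt sig (str g u₂) (bar g w) → (u₁ ++ u₃ = [] → Gt sig s (bar g w)) →
      IsInference sig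
        { prem := {s(str g (u₁ ++ u₂ ++ u₃), s), s(str g u₂, bar g w)}
          del := {s(str g (u₁ ++ u₂ ++ u₃), s)}
          add := {s(bar g (u₁ ++ w ++ u₃), s)} }
  /-- The premises are `s[u] ≈ t` and `u ≈ d`. If `s[u]` is `u` itself, then `t ≻ d` is required. -/
  | collapse (s s' t u : Term F (Cst C₀)) (d : Cst C₀) : ReplaceOne u (.const d) s s' →
      Gt sig s t → Gt sig u (.const d) → (∀ g ∈ sig.assoc, ∀ ts, u ≠ .app g ts) →
      (s = u → Gt sig t (.const d)) →
      IsInference sig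
        { prem := {s(s, t), s(u, .const d)}
          del := {s(s, t)}
          add := {s(s', t)} }
  | compose (t : Term F (Cst C₀)) (c d : Cst C₀) :
      Gt sig t (.const c) → CstGt c d →
      IsInference sig
        { prem := {s(t, .const c), s(.const c, .const d)}
          del := {s(t, .const c)}
          add := {s(t, .const d)} }
  | delete (s : Term F (Cst C₀)) :
      IsInference sig { prem := {s(s, s)}, del := {s(s, s)}, add := ∅ }

def Inference.Enabled (τ : Inference F C₀) (S : Set (Eqn F (Cst C₀))) : Prop := τ.prem ⊆ S

/-- `S'` is obtained from `S` by applying `τ`. -/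
def Inference.Applied (τ : Inference F C₀) (S S' : Set (Eqn F (Cst C₀))) : Prop :=
  τ.Enabled S ∧ S' = (S \ τ.del) ∪ τ.add

/-- Derivations `S 0 ⊢ S 1 ⊢ ⋯`. Idle steps are allowed, so that a finite derivation is
represented by repeating its last state forever. -/
def IsDerivation [LinearOrder C₀] (sig : Signature F) (S : ℕ → Set (Eqn F (Cst C₀))) : Prop :=
  ∀ i, S (i + 1) = S i ∨ ∃ τ, IsInference sig τ ∧ τ.Applied (S i) (S (i + 1))

/-- Fairness: every inference that is enabled continuously from some point on is applied at some
point of the period during which it is continuously enabled. -/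
def IsFair [LinearOrder C₀] (sig : Signature F) (S : ℕ → Set (Eqn F (Cst C₀))) : Prop :=
  ∀ τ, IsInference sig τ → (∃ n, ∀ j ≥ n, τ.Enabled (S j)) →
    ∃ i, (∀ j ≥ i, τ.Enabled (S j)) ∧ τ.Applied (S i) (S (i + 1))

/-- The persisting equations `S∞ = ⋃ᵢ ⋂_{j ≥ i} Sⱼ`. -/
def persisting (S : ℕ → Set (Eqn F (Cst C₀))) : Set (Eqn F (Cst C₀)) :=
  ⋃ i, ⋂ j ≥ i, S j

/-- The ground rewrite system `S∞^≻ ∪ gr(R(M))` over `T(Σ, C)`, where `Sinf` stands for `S∞`. -/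
def completedRules [LinearOrder C₀] (sig : Signature F) (f : F) (one : C₀) (C : Set (Cst C₀))
    (Sinf : Set (Eqn F (Cst C₀))) (l r : Term F (Cst C₀)) : Prop :=
  (s(l, r) ∈ Sinf ∧ Gt sig l r) ∨ UInst sig f (.inl one) C l r

/-! ### Decidability -/

/-- The word for a term in prefix notation, where `φ` and `κ` number the function symbols and the
original constants: a constant is one letter, and `g(t₁, …, tₙ)` is the letter for `g` and `n`,
followed by the words for `t₁, …, tₙ`. Only used for terms in `T(Σ, C₀)`. -/
def code (φ : F → ℕ) (κ : C₀ → ℕ) : Term F (Cst C₀) → List (ℕ ⊕ ℕ × ℕ)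
  | .const c => [.inl (Sum.elim κ ULift.down c)]
  | .app g ts => .inr (φ g, ts.length) :: (ts.map fun t => code φ κ t).flatten

/-- The relation `P` on `T(Σ, C₀)` is decidable: the set of pairs of words denoting related terms is
computable, for every numbering of the (finitely many) symbols. -/
def DecidableOnTerms (sig : Signature F) (P : Term F (Cst C₀) → Term F (Cst C₀) → Prop) : Prop :=
  ∀ (φ : F → ℕ) (κ : C₀ → ℕ), Function.Injective φ → Function.Injective κ →
    ComputablePred fun w : List (ℕ ⊕ ℕ × ℕ) × List (ℕ ⊕ ℕ × ℕ) =>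
      ∃ s t, Ground sig (baseConsts C₀) s ∧ Ground sig (baseConsts C₀) t ∧
        code φ κ s = w.1 ∧ code φ κ t = w.2 ∧ P s t

end Completion

end CCM

open CCM

/-! The limit of the derivation is studied through one concrete model. A value is a flat term that
is irreducible for the persisting equations and for deletion of `1` under `f`. Values form an
algebra (`valueAlg`): an associative symbol concatenates the argument words of its arguments and
takes the normal form of the resulting word; any other symbol applies a persisting D-flat rule if
one matches and otherwise just builds the term. The proof rests on three facts. This algebra is a
model of the monoid axioms and of every equation that ever occurs in the derivation
(`valueAlg_modelsMonoid`, `valueAlg_modelsEqns`). Every ground term rewrites by R/A, up to A, to its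
value (`reduces_value`). And R/A terminates (`termMeasure_rewrite`). Rewriting preserves values
because the rules hold in the model, so a normal form of `s` has the value of `s`; being
irreducible, it can only be A-equal to that value. Hence normal forms exist, are unique modulo A,
and agree exactly when the values agree.

The link with `E` is semantic. Phase I is conservative (`PhaseInvariant`): models of its output
satisfy `E`, and a model of `E` becomes a model of the output once the new constants are
reinterpreted. So provable equality implies equal values, because the algebra of values satisfies
`E`. Conversely, the inference rules are sound, so in each model of `E`, suitably reinterpreted, a
term and its value are equal; equal values then force equality in all models, which is congruence
closure by Birkhoff's theorem (`entailsMonoid_iff`).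

The core is confluence of rewriting on argument words of a fixed associative symbol
(`Completion.confl`). The letters are arbitrary terms; the rules are the persisting equations
between words of constants and, for `f`, deletion of a letter `1`. Words are measured by their value
as numerals with positive digits, which refines the length-lexicographic order. By fairness,
persisting rules contain no left-hand side inside another, and each proper overlap has its DEDUCE
conclusion somewhere in the derivation. That conclusion need not persist, but an equation disappears
only when it is trivial or is replaced by consequences of smaller equations. By induction it can
therefore be joined below any bound under which confluence is already known (`join_of_mem`).
Overlaps of a rule with deletion of `1` are handled by the unit equations, which are present at the
start though perhaps not in the limit (`join_of_mem_of_ruleStep`).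

For decidability, finitely many persisting equations give finite tables. Normal forms of words are
reached within a number of steps bounded by a power of a fixed base, so a stack machine reading
terms in prefix notation computes values primitive recursively. The word problem becomes equality of
two outputs. -/

namespace CCM

/-! ### Words, flat terms and groundness -/

section Basics

variable {F K : Type u} {sig : Signature F} {C : Set K}

theorem map_const_injective : Function.Injective (List.map (Term.const (F := F) (K := K))) :=
  List.map_injective_iff.mpr fun _ _ h => Term.const.inj h

theorem str_inj {g h : F} {v w : List K} : str g v = str h w ↔ g = h ∧ v = w := by
  simp only [str, Term.app.injEq]
  exact and_congr_right fun _ => map_const_injective.eq_iff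

@[simp] theorem bar_singleton (g : F) (c : K) : bar g [c] = .const c := rfl

theorem bar_of_two_le {g : F} {v : List K} (h : 2 ≤ v.length) : bar g v = str g v := by
  match v, h with
  | _ :: _ :: _, _ => rfl

theorem exists_singleton_or_two_le {α : Type*} {v : List α} (h : v ≠ []) :
    (∃ c, v = [c]) ∨ 2 ≤ v.length := by
  match v, h with
  | [c], _ => exact .inl ⟨c, rfl⟩
  | _ :: _ :: _, _ => exact .inr (by simp)

theorem bar_inj {g : F} {v w : List K} (hv : v ≠ []) (hw : w ≠ []) :
    bar g v = bar g w ↔ v = w := by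
  refine ⟨fun h => ?_, fun h => h ▸ rfl⟩
  rcases exists_singleton_or_two_le hv with ⟨c, rfl⟩ | hv <;>
  rcases exists_singleton_or_two_le hw with ⟨d, rfl⟩ | hw
  · simpa using h
  · rw [bar_of_two_le hw] at h; simp [str] at h
  · rw [bar_of_two_le hv] at h; simp [str] at h
  · rw [bar_of_two_le hv, bar_of_two_le hw, str_inj] at h; exact h.2

theorem bar_eq_const {g : F} {v : List K} (hv : v ≠ []) {c : K} :
    bar g v = .const c ↔ v = [c] := by
  rw [← bar_singleton g c, bar_inj hv (by simp)]

theorem bar_eq_str {g h : F} {v w : List K} (hv : v ≠ []) :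
    bar g v = str h w ↔ g = h ∧ v = w ∧ 2 ≤ v.length := by
  rcases exists_singleton_or_two_le hv with ⟨c, rfl⟩ | hv
  · simp [str]
  · rw [bar_of_two_le hv, str_inj]; simp [hv]

theorem Ground.const_iff {c : K} : Ground sig C (.const c : Term F K) ↔ c ∈ C :=
  ⟨fun h => by cases h; assumption, .const c⟩

theorem Ground.app_iff {g : F} {ts : List (Term F K)} :
    Ground sig C (.app g ts) ↔ sig.ValidArity g ts.length ∧ ∀ t ∈ ts, Ground sig C t :=
  ⟨fun h => by cases h; constructor <;> assumption, fun h => .app g ts h.1 h.2⟩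

theorem Ground.mono {C' : Set K} (hC : C ⊆ C') {t : Term F K} (h : Ground sig C t) :
    Ground sig C' t := by
  induction h with
  | const c hc => exact .const c (hC hc)
  | app g ts hv _ ih => exact .app g ts hv ih

theorem Signature.validArity_assoc {g : F} (hg : g ∈ sig.assoc) {n : ℕ} :
    sig.ValidArity g n ↔ 2 ≤ n := by simp [Signature.ValidArity, hg]

theorem Signature.validArity_nonassoc {g : F} (hg : g ∉ sig.assoc) {n : ℕ} :
    sig.ValidArity g n ↔ n = sig.arity g := by simp [Signature.ValidArity, hg]

theorem ground_bar {g : F} (hg : g ∈ sig.assoc) {v : List K} (hv : v ≠ []) :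
    Ground sig C (bar g v) ↔ ∀ c ∈ v, c ∈ C := by
  rcases exists_singleton_or_two_le hv with ⟨c, rfl⟩ | h2
  · simp [Ground.const_iff]
  · rw [bar_of_two_le h2, str, Ground.app_iff, sig.validArity_assoc hg]
    simp [Ground.const_iff, h2]

theorem AInst.ground {s t : Term F K} (h : AInst sig C s t) : Ground sig C s ∧ Ground sig C t := by
  obtain ⟨g, xs, ys, zs, hg, h⟩ := h
  refine ⟨h, ?_⟩
  simp only [Ground.app_iff, sig.validArity_assoc hg, List.mem_append, List.mem_cons,
    List.length_append, List.length_cons] at h ⊢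
  have h2 := h.2 (.app g ys) (by simp)
  rw [Ground.app_iff, sig.validArity_assoc hg] at h2
  refine ⟨by omega, ?_⟩
  rintro t ((ht | ht) | ht)
  · exact h.2 t (by simp [ht])
  · exact h2.2 t ht
  · exact h.2 t (by simp [ht])

theorem CongClosure.ground {R : Term F K → Term F K → Prop}
    (hR : ∀ s t, R s t → Ground sig C s ∧ Ground sig C t) {s t : Term F K}
    (h : CongClosure sig C R s t) : Ground sig C s ∧ Ground sig C t := by
  induction h with
  | base h => exact hR _ _ h
  | refl h => exact ⟨h, h⟩
  | symm _ ih => exact ih.symm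
  | trans _ _ ih₁ ih₂ => exact ⟨ih₁.1, ih₂.2⟩
  | congr g ss ts hlen hv _ ih =>
    refine ⟨.app _ _ hv fun t ht => ?_, .app _ _ (hlen ▸ hv) fun t ht => ?_⟩
    · obtain ⟨i, hi, rfl⟩ := List.getElem_of_mem ht
      exact (ih i hi).1
    · obtain ⟨i, hi, rfl⟩ := List.getElem_of_mem ht
      exact (ih i (hlen ▸ hi)).2

theorem AEq.ground {s t : Term F K} (h : AEq sig C s t) : Ground sig C s ∧ Ground sig C t :=
  CongClosure.ground (fun _ _ => AInst.ground) h

theorem CongClosure.congr_forall₂ {R : Term F K → Term F K → Prop} {g : F}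
    {ss ts : List (Term F K)} (hv : sig.ValidArity g ss.length)
    (h : List.Forall₂ (CongClosure sig C R) ss ts) :
    CongClosure sig C R (.app g ss) (.app g ts) :=
  .congr g ss ts h.length_eq hv fun i hi => (List.forall₂_iff_get.mp h).2 i hi (h.length_eq ▸ hi)

theorem CongClosure.congr_arg {R : Term F K → Term F K → Prop} {g : F}
    {xs zs : List (Term F K)} {s t : Term F K} (h : CongClosure sig C R s t)
    (hs : Ground sig C (.app g (xs ++ s :: zs))) :
    CongClosure sig C R (.app g (xs ++ s :: zs)) (.app g (xs ++ t :: zs)) := by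
  rw [Ground.app_iff] at hs
  refine CongClosure.congr_forall₂ hs.1 ?_
  refine List.rel_append (List.forall₂_same.mpr fun x hx => .refl (hs.2 x (by simp [hx]))) ?_
  exact .cons h (List.forall₂_same.mpr fun x hx => .refl (hs.2 x (by simp [hx])))

theorem Ground.arg {g : F} {xs zs : List (Term F K)} {s : Term F K}
    (hs : Ground sig C (.app g (xs ++ s :: zs))) : Ground sig C s :=
  (Ground.app_iff.mp hs).2 s (by simp)

theorem Ground.replace_arg {g : F} {xs zs : List (Term F K)} {s t : Term F K}
    (hs : Ground sig C (.app g (xs ++ s :: zs))) (ht : Ground sig C t) :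
    Ground sig C (.app g (xs ++ t :: zs)) := by
  rw [Ground.app_iff] at hs ⊢
  refine ⟨by simpa using hs.1, fun x hx => ?_⟩
  simp only [List.mem_append, List.mem_cons] at hx
  rcases hx with hx | rfl | hx
  · exact hs.2 x (by simp [hx])
  · exact ht
  · exact hs.2 x (by simp [hx])

theorem ReplaceOne.ground_source {l r s t : Term F K} (h : ReplaceOne l r s t)
    (hs : Ground sig C s) : Ground sig C l := by
  induction h with
  | root => exact hs
  | arg g xs zs _ ih => exact ih hs.arg

theorem ReplaceOne.ground {l r s t : Term F K} (h : ReplaceOne l r s t) (hs : Ground sig C s)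
    (hr : Ground sig C r) : Ground sig C t := by
  induction h with
  | root => exact hr
  | arg g xs zs _ ih => exact hs.replace_arg (ih hs.arg)

end Basics

/-! ### Evaluation in models of the monoid axioms -/

section Models

variable {F K : Type u} {sig : Signature F} {C : Set K} {f : F} {one : K} (𝒜 : Alg F K)

@[simp] theorem Alg.eval_const (c : K) : 𝒜.eval (.const c) = 𝒜.cst c := by simp [Alg.eval]

theorem Alg.eval_app (g : F) (ts : List (Term F K)) :
    𝒜.eval (.app g ts) = 𝒜.op g (ts.map 𝒜.eval) := by
  simp [Alg.eval]

variable {𝒜}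

theorem Alg.eval_eq_of_congClosure {R : Term F K → Term F K → Prop}
    (hR : ∀ s t, R s t → 𝒜.eval s = 𝒜.eval t) {s t : Term F K}
    (h : CongClosure sig C R s t) : 𝒜.eval s = 𝒜.eval t := by
  induction h with
  | base h => exact hR _ _ h
  | refl _ => rfl
  | symm _ ih => exact ih.symm
  | trans _ _ ih₁ ih₂ => exact ih₁.trans ih₂
  | congr g ss ts hlen hv _ ih =>
    rw [Alg.eval_app, Alg.eval_app]
    congr 1
    refine List.ext_getElem (by simpa using hlen) fun i h₁ h₂ => ?_
    simpa using ih i (by simpa using h₁)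

theorem Alg.eval_eq_of_replaceOne {l r s t : Term F K} (h : ReplaceOne l r s t)
    (hlr : 𝒜.eval l = 𝒜.eval r) : 𝒜.eval s = 𝒜.eval t := by
  induction h with
  | root => exact hlr
  | arg g xs zs _ ih => simp [Alg.eval_app, ih]

theorem Alg.eval_eq_of_aInst (h𝒜 : 𝒜.ModelsMonoid sig f one) {s t : Term F K}
    (h : AInst sig C s t) : 𝒜.eval s = 𝒜.eval t := by
  obtain ⟨g, xs, ys, zs, hg, h⟩ := h
  have h2 := h.arg
  rw [Ground.app_iff, sig.validArity_assoc hg] at h h2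
  have := h𝒜.1 g hg (xs.map 𝒜.eval) (ys.map 𝒜.eval) (zs.map 𝒜.eval) (by simpa using h2.1)
    (by have := h.1; simp at this ⊢; omega)
  simpa [Alg.eval_app] using this

theorem Alg.eval_eq_of_uInst (h𝒜 : 𝒜.ModelsMonoid sig f one) {s t : Term F K}
    (h : UInst sig f one C s t) : 𝒜.eval s = 𝒜.eval t := by
  rcases h with ⟨_, h⟩ | ⟨_, h⟩
  · simpa [Alg.eval_app] using h𝒜.2.1 _
  · simpa [Alg.eval_app] using h𝒜.2.2 _

theorem Alg.eval_eq_of_aEq (h𝒜 : 𝒜.ModelsMonoid sig f one) {s t : Term F K}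
    (h : AEq sig C s t) : 𝒜.eval s = 𝒜.eval t :=
  Alg.eval_eq_of_congClosure (fun _ _ => Alg.eval_eq_of_aInst h𝒜) h

theorem Alg.eval_eq_of_rewriteModA (h𝒜 : 𝒜.ModelsMonoid sig f one)
    {R : Term F K → Term F K → Prop} (hR : ∀ l r, R l r → 𝒜.eval l = 𝒜.eval r)
    {s t : Term F K} (h : RewriteModA sig C R s t) : 𝒜.eval s = 𝒜.eval t := by
  obtain ⟨_, _, l, r, h₁, hlr, h₂, h₃⟩ := h
  rw [Alg.eval_eq_of_aEq h𝒜 h₁, Alg.eval_eq_of_replaceOne h₂ (hR _ _ hlr),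
    Alg.eval_eq_of_aEq h𝒜 h₃]

theorem Alg.eval_eq_of_reflTransGen (h𝒜 : 𝒜.ModelsMonoid sig f one)
    {R : Term F K → Term F K → Prop} (hR : ∀ l r, R l r → 𝒜.eval l = 𝒜.eval r)
    {s t : Term F K} (h : Relation.ReflTransGen (RewriteModA sig C R) s t) :
    𝒜.eval s = 𝒜.eval t := by
  induction h with
  | refl => rfl
  | tail _ h ih => exact ih.trans (Alg.eval_eq_of_rewriteModA h𝒜 hR h)

theorem CCMonoid.entails {E : Set (Eqn F K)} {s t : Term F K}
    (h : CCMonoid sig f one C E s t) : EntailsMonoid sig f one E s t := by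
  intro 𝒜 hE h𝒜
  refine Alg.eval_eq_of_congClosure ?_ h
  rintro s t (h | h | h)
  · exact hE _ _ h
  · exact Alg.eval_eq_of_aInst h𝒜 h
  · exact Alg.eval_eq_of_uInst h𝒜 h

/-- The value of the word `v` in a model: the operation `g` is applied unless `v` is a letter. -/
def Alg.bop (𝒜 : Alg F K) (g : F) : List 𝒜.carrier → 𝒜.carrier
  | [a] => a
  | as => 𝒜.op g as

@[simp] theorem Alg.bop_singleton (g : F) (a : 𝒜.carrier) : 𝒜.bop g [a] = a := rfl

theorem Alg.bop_of_two_le {g : F} {as : List 𝒜.carrier} (h : 2 ≤ as.length) :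
    𝒜.bop g as = 𝒜.op g as := by
  match as, h with
  | _ :: _ :: _, _ => rfl

theorem Alg.eval_bar (g : F) (v : List K) : 𝒜.eval (bar g v) = 𝒜.bop g (v.map 𝒜.cst) := by
  match v with
  | [] => simp [bar, str, Alg.eval_app, Alg.bop]
  | [c] => simp
  | _ :: _ :: _ =>
    simp [bar, str, Alg.eval_app, Alg.bop, Function.comp_def]

theorem Alg.eval_str (g : F) (v : List K) : 𝒜.eval (str g v) = 𝒜.op g (v.map 𝒜.cst) := by
  simp [str, Alg.eval_app, Function.comp_def]

/-- The axioms give flattening only for an inner list of length at least two in a nonempty context.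
With `bop`, in which a single letter stands for itself, the remaining cases hold trivially, so words
can be treated uniformly. -/
theorem Alg.bop_append (h𝒜 : 𝒜.ModelsMonoid sig f one) {g : F} (hg : g ∈ sig.assoc)
    (xs zs : List 𝒜.carrier) {ys : List 𝒜.carrier} (hy : ys ≠ []) :
    𝒜.bop g (xs ++ 𝒜.bop g ys :: zs) = 𝒜.bop g (xs ++ ys ++ zs) := by
  rcases exists_singleton_or_two_le hy with ⟨c, rfl⟩ | h2
  · simp
  · by_cases h : xs = [] ∧ zs = []
    · simp [h.1, h.2]
    · have : 1 ≤ xs.length + zs.length := by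
        by_contra hc
        exact h ⟨List.length_eq_zero_iff.mp (by omega), List.length_eq_zero_iff.mp (by omega)⟩
      rw [Alg.bop_of_two_le (by simp; omega), Alg.bop_of_two_le (as := xs ++ ys ++ zs)
        (by simp; omega), Alg.bop_of_two_le h2]
      exact h𝒜.1 g hg xs ys zs h2 this

theorem Alg.bop_congr (h𝒜 : 𝒜.ModelsMonoid sig f one) {g : F} (hg : g ∈ sig.assoc)
    (xs zs : List 𝒜.carrier) {ys ys' : List 𝒜.carrier} (hy : ys ≠ []) (hy' : ys' ≠ [])
    (h : 𝒜.bop g ys = 𝒜.bop g ys') :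
    𝒜.bop g (xs ++ ys ++ zs) = 𝒜.bop g (xs ++ ys' ++ zs) := by
  rw [← Alg.bop_append h𝒜 hg xs zs hy, h, Alg.bop_append h𝒜 hg xs zs hy']

end Models

/-! ### The term model and completeness of congruence closure -/

section TermModel

variable {F K : Type u} (sig : Signature F) (C : Set K) (f : F) (one : K) (E : Set (Eqn F K))

/-- Congruence closure as a setoid on ground terms. -/
def ccSetoid : Setoid {t : Term F K // Ground sig C t} where
  r s t := CCMonoid sig f one C E s.1 t.1
  iseqv := ⟨fun s => .refl s.2, fun h => h.symm, fun h₁ h₂ => h₁.trans h₂⟩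

open Classical in
/-- The quotient of the ground term algebra by congruence closure. -/
noncomputable def termModel (hone : one ∈ C) : Alg F K where
  carrier := Quotient (ccSetoid sig C f one E)
  cst c := if h : c ∈ C then Quotient.mk _ ⟨.const c, .const c h⟩
    else Quotient.mk _ ⟨.const one, .const one hone⟩
  op g as := if h : sig.ValidArity g as.length then
      Quotient.mk _ ⟨.app g (as.map fun a => a.out.1), .app _ _ (by simpa using h) (by
        simp only [List.mem_map]
        rintro _ ⟨a, _, rfl⟩
        exact a.out.2)⟩
    -- An arbitrary default: lists of illegal length occur neither in ground terms nor in the axioms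
    -- to be verified.
    else Quotient.mk _ ⟨.const one, .const one hone⟩

variable {sig C f one E}

/-- The operations are defined through chosen representatives; the congruence rule makes the choice
irrelevant. -/
theorem termModel_op_mk (hone : one ∈ C) {g : F} {ts : List {t : Term F K // Ground sig C t}}
    (h : sig.ValidArity g ts.length) :
    (termModel sig C f one E hone).op g (ts.map (Quotient.mk (ccSetoid sig C f one E))) =
      Quotient.mk (ccSetoid sig C f one E) ⟨.app g (ts.map (·.1)), .app _ _ (by simpa using h) (by
        simp only [List.mem_map]
        rintro _ ⟨a, _, rfl⟩
        exact a.2)⟩ := by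
  simp only [termModel]
  rw [dif_pos (by simpa using h)]
  apply Quotient.sound (s := ccSetoid sig C f one E)
  refine CongClosure.congr_forall₂ (by simpa using h) ?_
  rw [List.map_map, List.forall₂_map_left_iff, List.forall₂_map_right_iff, List.forall₂_same]
  intro t _
  exact Quotient.exact (s := ccSetoid sig C f one E) (Quotient.out_eq _)

/-- The class of a ground term in the term model. -/
noncomputable def toTermModel (hone : one ∈ C) (t : {t : Term F K // Ground sig C t}) :
    (termModel sig C f one E hone).carrier :=
  Quotient.mk (ccSetoid sig C f one E) t

theorem toTermModel_surjective (hone : one ∈ C) :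
    Function.Surjective (toTermModel (sig := sig) (f := f) (E := E) hone) :=
  Quotient.exists_rep

theorem toTermModel_eq_iff (hone : one ∈ C) {s t : {t : Term F K // Ground sig C t}} :
    toTermModel (f := f) (E := E) hone s = toTermModel hone t ↔
      CCMonoid sig f one C E s.1 t.1 :=
  Quotient.eq (r := ccSetoid sig C f one E)

theorem termModel_op (hone : one ∈ C) {g : F} {ts : List {t : Term F K // Ground sig C t}}
    (h : sig.ValidArity g ts.length) :
    (termModel sig C f one E hone).op g (ts.map (toTermModel hone)) =
      toTermModel hone ⟨.app g (ts.map (·.1)), .app _ _ (by simpa using h) (by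
        simp only [List.mem_map]
        rintro _ ⟨a, _, rfl⟩
        exact a.2)⟩ :=
  termModel_op_mk hone h

theorem termModel_cst (hone : one ∈ C) {c : K} (hc : c ∈ C) :
    (termModel sig C f one E hone).cst c = toTermModel hone ⟨.const c, .const c hc⟩ := by
  simp [termModel, hc, toTermModel]

theorem termModel_eval (hone : one ∈ C) {t : Term F K} (h : Ground sig C t) :
    (termModel sig C f one E hone).eval t = toTermModel hone ⟨t, h⟩ := by
  induction h with
  | const c hc => simp [termModel_cst hone hc]
  | app g ts hv hts ih =>
    rw [Alg.eval_app]
    have := termModel_op (f := f) (E := E) hone (g := g)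
      (ts := ts.attach.map fun t => ⟨t.1, hts t.1 t.2⟩) (by simpa using hv)
    simp only [List.map_map, Function.comp_def, List.attach_map_subtype_val] at this
    rw [← this]
    congr 1
    conv_lhs => rw [← List.attach_map_subtype_val ts, List.map_map]
    apply List.map_congr_left
    intro t _
    exact ih t.1 t.2

theorem termModel_modelsEqns (hone : one ∈ C) (hE : ∀ e ∈ E, ∀ t ∈ e, Ground sig C t) :
    (termModel sig C f one E hone).ModelsEqns E := by
  intro s t h
  rw [termModel_eval hone (hE _ h s (by simp)), termModel_eval hone (hE _ h t (by simp)),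
    toTermModel_eq_iff]
  exact .base (.inl h)

theorem termModel_modelsMonoid (hf : f ∈ sig.assoc) (hone : one ∈ C) :
    (termModel sig C f one E hone).ModelsMonoid sig f one := by
  have hsurj := (toTermModel_surjective (sig := sig) (f := f) (E := E) hone)
  refine ⟨fun g hg xs ys zs hy hxz => ?_, fun a => ?_, fun a => ?_⟩
  · obtain ⟨xs, rfl⟩ := List.map_surjective_iff.mpr hsurj xs
    obtain ⟨ys, rfl⟩ := List.map_surjective_iff.mpr hsurj ys
    obtain ⟨zs, rfl⟩ := List.map_surjective_iff.mpr hsurj zs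
    simp only [List.length_map] at hy hxz
    rw [termModel_op hone (by rw [sig.validArity_assoc hg]; exact hy), ← List.map_cons,
      ← List.map_append, ← List.map_append, ← List.map_append,
      termModel_op hone (by rw [sig.validArity_assoc hg]; simp; omega),
      termModel_op hone (by rw [sig.validArity_assoc hg]; simp; omega), toTermModel_eq_iff]
    refine .base (.inr (.inl ?_))
    simp only [List.map_append, List.map_cons]
    refine .mk g _ _ _ hg (.app _ _ ?_ ?_)
    · rw [sig.validArity_assoc hg]; simp; omega
    · simp only [List.mem_append, List.mem_map, List.mem_cons]
      rintro t (⟨a, _, rfl⟩ | rfl | ⟨a, _, rfl⟩)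
      · exact a.2
      · refine .app _ _ (by rw [sig.validArity_assoc hg]; simpa using hy) ?_
        simp only [List.mem_map]
        rintro _ ⟨a, _, rfl⟩
        exact a.2
      · exact a.2
  · obtain ⟨t, rfl⟩ := hsurj a
    rw [termModel_cst hone hone]
    refine (termModel_op hone (ts := [t, ⟨.const one, .const one hone⟩])
      (by rw [sig.validArity_assoc hf]; simp)).trans ?_
    rw [toTermModel_eq_iff]
    exact .base (.inr (.inr (.right t.1 t.2)))
  · obtain ⟨t, rfl⟩ := hsurj a
    rw [termModel_cst hone hone]
    refine (termModel_op hone (ts := [⟨.const one, .const one hone⟩, t])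
      (by rw [sig.validArity_assoc hf]; simp)).trans ?_
    rw [toTermModel_eq_iff]
    exact .base (.inr (.inr (.left t.1 t.2)))

/-- Birkhoff's theorem for ground equations and the monoid axioms. -/
theorem entailsMonoid_iff (hf : f ∈ sig.assoc) (hone : one ∈ C)
    (hE : ∀ e ∈ E, ∀ t ∈ e, Ground sig C t) {s t : Term F K} (hs : Ground sig C s)
    (ht : Ground sig C t) :
    EntailsMonoid sig f one E s t ↔ CCMonoid sig f one C E s t := by
  refine ⟨fun h => ?_, CCMonoid.entails⟩
  have := h _ (termModel_modelsEqns hone hE) (termModel_modelsMonoid hf hone)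
  rwa [termModel_eval hone hs, termModel_eval hone ht, toTermModel_eq_iff] at this

end TermModel

end CCM

namespace CCM

/-! ### A numerical measure refining the length-lexicographic order -/

section WordVal

variable {L : Type*} (δ : L → ℕ) (B : ℕ)

/-- The value of a word as a number in base `B` with digits given by `δ`. -/
def wordVal : List L → ℕ
  | [] => 0
  | a :: l => δ a * B ^ l.length + wordVal l

variable {δ B}

theorem wordVal_append (x y : List L) :
    wordVal δ B (x ++ y) = wordVal δ B x * B ^ y.length + wordVal δ B y := by
  induction x with
  | nil => simp [wordVal]
  | cons a x ih => simp only [List.cons_append, wordVal, ih, List.length_append, pow_add]; ring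

variable (hlt : ∀ a, δ a < B) (hpos : ∀ a, 1 ≤ δ a)

include hlt in
theorem wordVal_lt (x : List L) : wordVal δ B x < B ^ x.length := by
  induction x with
  | nil => simp [wordVal]
  | cons a x ih =>
    have := Nat.mul_le_mul_right (B ^ x.length) (hlt a)
    simp only [wordVal, List.length_cons, pow_succ]
    rw [Nat.succ_mul] at this
    rw [mul_comm (B ^ _)]
    omega

include hlt hpos in
-- Digits are positive, so the leading digit of the longer word alone contributes a power of `B`
-- that exceeds every shorter word.
theorem wordVal_lt_of_length_lt {x y : List L} (h : x.length < y.length) :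
    wordVal δ B x < wordVal δ B y := by
  match y, h with
  | a :: y, h =>
    have h1 := wordVal_lt hlt x
    have h2 : B ^ x.length ≤ B ^ y.length :=
      Nat.pow_le_pow_right (by have := hlt a; omega) (by simpa [Nat.lt_succ_iff] using h)
    have h3 := Nat.mul_le_mul_right (B ^ y.length) (hpos a)
    simp only [wordVal]
    omega

include hlt hpos in
-- A word of smaller value cannot be longer, since longer words have larger values. So a prefix is
-- shifted by no higher a power of `B`, and a common suffix preserves the strict inequality.
theorem wordVal_context {x y : List L} (h : wordVal δ B x < wordVal δ B y) (a b : List L) :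
    wordVal δ B (a ++ x ++ b) < wordVal δ B (a ++ y ++ b) := by
  have hl : x.length ≤ y.length := by
    by_contra hc
    exact absurd (wordVal_lt_of_length_lt hlt hpos (not_le.mp hc)) (by omega)
  by_cases hn : a = [] ∧ b = []
  · simpa [hn.1, hn.2] using h
  have hB : 0 < B := by
    rcases a with _ | ⟨c, _⟩
    · rcases b with _ | ⟨c, _⟩
      · simp at hn
      · have := hlt c; omega
    · have := hlt c; omega
  simp only [wordVal_append]
  have h1 : wordVal δ B a * B ^ x.length ≤ wordVal δ B a * B ^ y.length :=
    Nat.mul_le_mul_left _ (Nat.pow_le_pow_right hB hl)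
  have h2 : 0 < B ^ b.length := Nat.pow_pos hB
  have h3 : wordVal δ B a * B ^ x.length + wordVal δ B x <
    wordVal δ B a * B ^ y.length + wordVal δ B y := by omega
  have := Nat.mul_lt_mul_of_pos_right h3 h2
  omega

include hlt in
theorem wordVal_lt_of_lex {R : L → L → Prop} {x y : List L}
    (hR : ∀ a ∈ x, ∀ b ∈ y, R a b → δ a < δ b)
    (hlen : x.length = y.length) (h : List.Lex R x y) : wordVal δ B x < wordVal δ B y := by
  induction h with
  | nil => simp at hlen
  | cons h ih =>
    have := ih (fun a ha b hb => hR a (by simp [ha]) b (by simp [hb])) (by simpa using hlen)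
    simp only [List.length_cons, Nat.add_right_cancel_iff] at hlen
    simp only [wordVal, hlen]
    omega
  | @rel a x b y h =>
    have h0 := hR a (by simp) b (by simp) h
    have h1 := wordVal_lt hlt x
    simp only [List.length_cons, Nat.add_right_cancel_iff] at hlen
    have := Nat.mul_le_mul_right (B ^ y.length) h0
    simp only [wordVal, hlen] at h1 ⊢
    rw [Nat.succ_mul] at this
    omega

include hlt hpos in
theorem wordVal_lt_of_shortlex {R : L → L → Prop} {x y : List L}
    (hR : ∀ a ∈ x, ∀ b ∈ y, R a b → δ a < δ b)
    (h : List.Shortlex R x y) : wordVal δ B x < wordVal δ B y := by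
  rw [List.shortlex_def] at h
  rcases h with h | ⟨h1, h2⟩
  · exact wordVal_lt_of_length_lt hlt hpos h
  · exact wordVal_lt_of_lex hlt hR h1 h2

theorem wordVal_map {L' : Type*} (φ : L' → L) (x : List L') :
    wordVal δ B (x.map φ) = wordVal (δ ∘ φ) B x := by
  induction x with
  | nil => rfl
  | cons a x ih => simp [wordVal, ih]

end WordVal

/-! ### Abstract rewriting: joinability, Newman's lemma, normal forms -/

section Newman

open Relation

variable {α : Type*} {r : α → α → Prop}

/-- Any two descendants of `x` have a common descendant. -/
def Confl (r : α → α → Prop) (x : α) : Prop :=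
  ∀ y z, ReflTransGen r x y → ReflTransGen r x z → Join (ReflTransGen r) y z

theorem join_refl (x : α) : Join (ReflTransGen r) x x := ⟨x, .refl, .refl⟩

theorem join_symm {x y : α} (h : Join (ReflTransGen r) x y) : Join (ReflTransGen r) y x :=
  let ⟨z, h₁, h₂⟩ := h; ⟨z, h₂, h₁⟩

theorem join_of_step {x y : α} (h : r x y) : Join (ReflTransGen r) x y :=
  ⟨y, .single h, .refl⟩

/-- Joinability is not transitive in general, but it is through a confluent middle element. This is
how joins are chained through elements below the current bound. -/
theorem Confl.join_trans {x y z : α} (hy : Confl r y) (h₁ : Join (ReflTransGen r) x y)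
    (h₂ : Join (ReflTransGen r) y z) : Join (ReflTransGen r) x z := by
  obtain ⟨u, hxu, hyu⟩ := h₁
  obtain ⟨v, hyv, hzv⟩ := h₂
  obtain ⟨w, huw, hvw⟩ := hy u v hyu hyv
  exact ⟨w, hxu.trans huw, hzv.trans hvw⟩

/-- Newman's lemma, where peaks at `x` may be joined using confluence below `x`. -/
theorem confl_of_local (μ : α → ℕ) (hμ : ∀ x y, r x y → μ y < μ x)
    (hloc : ∀ x, (∀ x', μ x' < μ x → Confl r x') → ∀ y z, r x y → r x z →
      Join (ReflTransGen r) y z) (x : α) : Confl r x := by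
  induction hn : μ x using Nat.strong_induction_on generalizing x with
  | _ n ih =>
    subst hn
    have ih' : ∀ x', μ x' < μ x → Confl r x' := fun x' h => ih _ h x' rfl
    intro y z hy hz
    rcases hy.cases_head with rfl | ⟨y', hxy, hy⟩
    · exact ⟨z, hz, .refl⟩
    rcases hz.cases_head with rfl | ⟨z', hxz, hz⟩
    · exact ⟨y, .refl, hy.head hxy⟩
    have h₁ := ih' y' (hμ _ _ hxy)
    have h₂ := ih' z' (hμ _ _ hxz)
    exact h₂.join_trans (h₁.join_trans ⟨y, .refl, hy⟩ (hloc x ih' y' z' hxy hxz)) ⟨z, hz, .refl⟩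

theorem exists_irreducible {β : Type*} [Preorder β] [WellFoundedLT β] (μ : α → β)
    (hμ : ∀ x y, r x y → μ y < μ x) (x : α) :
    ∃ y, ReflTransGen r x y ∧ ∀ z, ¬ r y z := by
  induction hn : μ x using WellFoundedLT.induction generalizing x with
  | _ n ih =>
    by_cases h : ∃ z, r x z
    · obtain ⟨z, hz⟩ := h
      obtain ⟨y, hy, hirr⟩ := ih _ (hn ▸ hμ _ _ hz) z rfl
      exact ⟨y, hy.head hz, hirr⟩
    · exact ⟨x, .refl, fun z hz => h ⟨z, hz⟩⟩

theorem reflTransGen_irreducible {x y : α} (hx : ∀ z, ¬ r x z) (h : ReflTransGen r x y) :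
    y = x := by
  rcases h.cases_head with rfl | ⟨z, hz, _⟩
  · rfl
  · exact absurd hz (hx z)

end Newman

/-! ### Relative positions of two factors of a word -/

section Blocks

variable {L : Type*}

/-- Relative position of two blocks `v₁`, `v₂` of a word, the first one starting not later than the
second one: they are disjoint, they overlap properly, or one contains the other. -/
theorem block_cases_of_le {a₁ v₁ b₁ a₂ v₂ b₂ : List L} (h : a₁ ++ v₁ ++ b₁ = a₂ ++ v₂ ++ b₂)
    (hle : a₁.length ≤ a₂.length) :
    (∃ k, a₂ = a₁ ++ v₁ ++ k ∧ b₁ = k ++ v₂ ++ b₂) ∨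
    (∃ p k q, p ≠ [] ∧ k ≠ [] ∧ q ≠ [] ∧ v₁ = p ++ k ∧ v₂ = k ++ q ∧ a₂ = a₁ ++ p ∧
      b₁ = q ++ b₂) ∨
    (∃ p q, v₁ = p ++ v₂ ++ q ∧ a₂ = a₁ ++ p ∧ b₂ = q ++ b₁) ∨
    (∃ q, v₂ = v₁ ++ q ∧ a₁ = a₂ ∧ b₁ = q ++ b₂) := by
  rw [List.append_assoc, List.append_assoc] at h
  obtain ⟨p, rfl, h'⟩ : ∃ p, a₂ = a₁ ++ p ∧ v₁ ++ b₁ = p ++ (v₂ ++ b₂) := by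
    rcases List.append_eq_append_iff.mp h with ⟨p, h₁, h₂⟩ | ⟨p, h₁, h₂⟩
    · exact ⟨p, h₁, h₂⟩
    · have : p = [] := by
        have := congrArg List.length h₁
        simp at this
        exact List.length_eq_zero_iff.mp (by omega)
      subst this
      exact ⟨[], by simpa using h₁.symm, by simpa using h₂.symm⟩
  rcases List.append_eq_append_iff.mp h' with ⟨k, h₁, h₂⟩ | ⟨k, h₁, h₂⟩
  · exact .inl ⟨k, by simp [h₁], by simp [h₂]⟩
  rcases List.append_eq_append_iff.mp h₂ with ⟨q, h₃, h₄⟩ | ⟨q, h₃, h₄⟩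
  · exact .inr (.inr (.inl ⟨p, q, by simp [h₁, h₃], rfl, h₄⟩))
  · by_cases hp : p = []
    · subst hp
      exact .inr (.inr (.inr ⟨q, by simp [h₁, h₃], by simp, by simp [h₄]⟩))
    by_cases hq : q = []
    · subst hq
      exact .inr (.inr (.inl ⟨p, [], by simpa [h₁] using h₃.symm, rfl, by simpa using h₄.symm⟩))
    by_cases hk : k = []
    · subst hk
      exact .inl ⟨[], by simp [h₁], by simp at h₃; simp [h₄, h₃]⟩
    exact .inr (.inl ⟨p, k, q, hp, hk, hq, h₁, h₃, rfl, by simpa using h₄⟩)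

end Blocks

/-! ### The precedence on constants and its numbering on a finite set -/

section Index

variable {C₀ : Type u} [LinearOrder C₀]

theorem CstGt.irrefl (c : Cst C₀) : ¬ CstGt c c := by
  rcases c with c | c <;> simp [CstGt]

theorem CstGt.trans {c d e : Cst C₀} (h₁ : CstGt c d) (h₂ : CstGt d e) : CstGt c e := by
  rcases c with c | c <;> rcases d with d | d <;> rcases e with e | e <;>
  simp only [CstGt] at * <;> first | exact h₂.trans h₁ | exact h₁.trans h₂

theorem CstGt.total (c d : Cst C₀) : CstGt c d ∨ c = d ∨ CstGt d c := by
  rcases c with c | ⟨c⟩ <;> rcases d with d | ⟨d⟩ <;> simp only [CstGt]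
  · rcases lt_trichotomy c d with h | h | h <;> simp [h]
  · simp
  · simp
  · rcases lt_trichotomy c d with h | h | h <;> simp [h]

instance : Std.Trichotomous (fun a b : Cst C₀ => CstGt b a) :=
  ⟨fun a b h₁ h₂ => by rcases CstGt.total a b with h | h | h <;> tauto⟩

instance : Std.Asymm (fun a b : Cst C₀ => CstGt b a) :=
  ⟨fun _ _ h₁ h₂ => CstGt.irrefl _ (h₁.trans h₂)⟩

theorem LenLexGt.total (v w : List (Cst C₀)) : LenLexGt v w ∨ v = w ∨ LenLexGt w v := by
  by_cases h₁ : LenLexGt v w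
  · exact .inl h₁
  by_cases h₂ : LenLexGt w v
  · exact .inr (.inr h₂)
  · exact .inr (.inl (Std.Trichotomous.trichotomous
      (r := List.Shortlex (fun a b : Cst C₀ => CstGt b a)) _ _ h₂ h₁))

theorem LenLexGt.asymm {v w : List (Cst C₀)} (h₁ : LenLexGt v w) (h₂ : LenLexGt w v) : False :=
  Std.Asymm.asymm (r := List.Shortlex (fun a b : Cst C₀ => CstGt b a)) _ _ h₁ h₂

theorem LenLexGt.irrefl {v : List (Cst C₀)} (h : LenLexGt v v) : False := h.asymm h

@[simp] theorem lenLexGt_singleton {c d : Cst C₀} : LenLexGt [c] [d] ↔ CstGt c d :=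
  List.shortlex_singleton_iff _ _

theorem LenLexGt.length_le {v w : List (Cst C₀)} (h : LenLexGt v w) : w.length ≤ v.length := by
  rw [LenLexGt, List.shortlex_def] at h
  omega

/-- On a finite set of constants, the precedence is reflected by a numbering. -/
theorem exists_index {C : Set (Cst C₀)} (hC : C.Finite) :
    ∃ (δ : Cst C₀ → ℕ) (B : ℕ), (∀ c, 1 ≤ δ c) ∧ (∀ c, δ c < B) ∧
      ∀ c ∈ C, ∀ d ∈ C, CstGt c d → δ d < δ c := by
  -- A constant is numbered by how many elements of `C` lie below it, plus one to keep digits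
  -- positive. Finiteness of `C` matters: on all of W the precedence is not well-founded, as c₀ ≻ c₁
  -- ≻ ⋯.
  refine ⟨fun c => {d ∈ C | CstGt c d}.ncard + 1, C.ncard + 2, by simp, fun c => ?_, ?_⟩
  · exact Nat.lt_succ_of_le
      (Nat.succ_le_succ (Set.ncard_le_ncard (Set.sep_subset C (CstGt c)) hC))
  · intro c _ d hd h
    have : {e ∈ C | CstGt d e}.ncard < {e ∈ C | CstGt c e}.ncard := by
      refine Set.ncard_lt_ncard ?_ (hC.subset (Set.sep_subset _ _))
      refine ⟨fun e he => ⟨he.1, h.trans he.2⟩, fun hsub => ?_⟩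
      exact CstGt.irrefl d (hsub ⟨hd, h⟩).2
    dsimp only
    omega

end Index

end CCM

namespace CCM

/-! ### Flat equations and inferences as statements about words -/

section FlatEquations

variable {F C₀ : Type u} {sig : Signature F} {C : Set (Cst C₀)}

/-- Flat equations over `C`: equations between words for an associative symbol (this includes
the equations between constants), and D-flat equations for other symbols. -/
inductive Flat (sig : Signature F) (C : Set (Cst C₀)) : Eqn F (Cst C₀) → Prop
  | word (g : F) (v w : List (Cst C₀)) : g ∈ sig.assoc → v ≠ [] → w ≠ [] → (∀ c ∈ v, c ∈ C) →
      (∀ c ∈ w, c ∈ C) → Flat sig C s(bar g v, bar g w)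
  | dflat (h : F) (cs : List (Cst C₀)) (c : Cst C₀) : h ∉ sig.assoc →
      cs.length = sig.arity h → (∀ c ∈ cs, c ∈ C) → c ∈ C → Flat sig C s(str h cs, .const c)

theorem Flat.ground {e : Eqn F (Cst C₀)} (he : Flat sig C e) : ∀ t ∈ e, Ground sig C t := by
  rcases he with ⟨g, v, w, hg, hv, hw, hvC, hwC⟩ | ⟨h, cs, c, hh, hlen, hcs, hc⟩
  · intro t ht
    rw [Sym2.mem_iff] at ht
    rcases ht with rfl | rfl
    · exact (ground_bar hg hv).mpr hvC
    · exact (ground_bar hg hw).mpr hwC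
  · intro t ht
    rw [Sym2.mem_iff] at ht
    rcases ht with rfl | rfl
    · refine .app _ _ ((sig.validArity_nonassoc hh).mpr (by simpa using hlen)) ?_
      simp only [List.mem_map]
      rintro _ ⟨c, hc, rfl⟩
      exact .const _ (hcs c hc)
    · exact .const _ hc

theorem flat_word_iff {g : F} (hg : g ∈ sig.assoc) {v w : List (Cst C₀)} (hv : v ≠ [])
    (hw : w ≠ []) :
    Flat sig C s(bar g v, bar g w) ↔ (∀ c ∈ v, c ∈ C) ∧ ∀ c ∈ w, c ∈ C :=
  ⟨fun h => ⟨(ground_bar hg hv).mp (h.ground _ (by simp)),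
    (ground_bar hg hw).mp (h.ground _ (by simp))⟩, fun h => .word g v w hg hv hw h.1 h.2⟩

theorem flat_const_iff {f : F} (hf : f ∈ sig.assoc) {c d : Cst C₀} :
    Flat sig C s(.const c, .const d) ↔ c ∈ C ∧ d ∈ C := by
  simpa using flat_word_iff (C := C) hf (v := [c]) (w := [d]) (by simp) (by simp)

theorem flat_dflat_iff {h : F} (hh : h ∉ sig.assoc) {cs : List (Cst C₀)} {c : Cst C₀} :
    Flat sig C s(str h cs, .const c) ↔
      cs.length = sig.arity h ∧ (∀ c ∈ cs, c ∈ C) ∧ c ∈ C := by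
  refine ⟨fun he => ?_, fun he => .dflat h cs c hh he.1 he.2.1 he.2.2⟩
  have h1 := he.ground (str h cs) (by simp)
  have h2 := he.ground (.const c) (by simp)
  rw [str, Ground.app_iff, sig.validArity_nonassoc hh] at h1
  simp only [List.length_map, List.mem_map, forall_exists_index, and_imp,
    forall_apply_eq_imp_iff₂, Ground.const_iff] at h1 h2
  exact ⟨h1.1, h1.2, h2⟩

theorem Flat.of_str_left {g : F} (hg : g ∈ sig.assoc) {v : List (Cst C₀)}
    {s : Term F (Cst C₀)} (h : Flat sig C s(str g v, s)) : ∃ w, w ≠ [] ∧ s = bar g w := by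
  generalize he : s(str g v, s) = e at h
  rcases h with ⟨g', v', w', hg', hv, hw, -, -⟩ | ⟨h, cs, c, hh, -, -, -⟩
  · rw [Sym2.eq_iff] at he
    rcases he with ⟨h1, rfl⟩ | ⟨h1, rfl⟩
    · obtain ⟨rfl, _⟩ := (bar_eq_str hv).mp h1.symm
      exact ⟨w', hw, rfl⟩
    · obtain ⟨rfl, _⟩ := (bar_eq_str hw).mp h1.symm
      exact ⟨v', hv, rfl⟩
  · rw [Sym2.eq_iff] at he
    rcases he with ⟨h1, rfl⟩ | ⟨h1, rfl⟩
    · rw [str_inj] at h1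
      exact absurd (h1.1 ▸ hg) hh
    · simp [str] at h1

theorem Flat.cases {s t : Term F (Cst C₀)} (h : Flat sig C s(s, t)) :
    (∃ g ∈ sig.assoc, ∃ v w, v ≠ [] ∧ w ≠ [] ∧ s = bar g v ∧ t = bar g w) ∨
    (∃ h ∉ sig.assoc, ∃ cs c, s = str h cs ∧ t = .const c) ∨
    (∃ h ∉ sig.assoc, ∃ cs c, t = str h cs ∧ s = .const c) := by
  generalize he : s(s, t) = e at h
  rcases h with ⟨g', v', w', hg', hv, hw, -, -⟩ | ⟨h, cs, c, hh, -, -, -⟩ <;>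
  rw [Sym2.eq_iff] at he <;> rcases he with ⟨rfl, rfl⟩ | ⟨rfl, rfl⟩
  · exact .inl ⟨_, hg', _, _, hv, hw, rfl, rfl⟩
  · exact .inl ⟨_, hg', _, _, hw, hv, rfl, rfl⟩
  · exact .inr (.inl ⟨_, hh, _, _, rfl, rfl⟩)
  · exact .inr (.inr ⟨_, hh, _, _, rfl, rfl⟩)

theorem bar_ne_str_nonassoc {g h : F} (hg : g ∈ sig.assoc) (hh : h ∉ sig.assoc)
    {v cs : List (Cst C₀)} (hv : v ≠ []) : bar g v ≠ str h cs := fun he =>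
  hh (((bar_eq_str hv).mp he).1 ▸ hg)

theorem replaceOne_const {c : Cst C₀} {u r s' : Term F (Cst C₀)}
    (h : ReplaceOne u r (.const c) s') : u = .const c ∧ s' = r := by
  cases h; exact ⟨rfl, rfl⟩

theorem replaceOne_str {g : F} {v : List (Cst C₀)} {d : Cst C₀} {u s' : Term F (Cst C₀)}
    (h : ReplaceOne u (.const d) (str g v) s') :
    (u = str g v ∧ s' = .const d) ∨
    ∃ a c b, v = a ++ [c] ++ b ∧ u = .const c ∧ s' = str g (a ++ [d] ++ b) := by
  generalize hs : str g v = s at h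
  cases h with
  | root => exact .inl ⟨rfl, rfl⟩
  | @arg g' xs zs s t h =>
    simp only [str, Term.app.injEq, List.map_eq_append_iff, List.map_eq_cons_iff] at hs
    obtain ⟨rfl, a, _, rfl, rfl, c, b, rfl, rfl, rfl⟩ := hs
    obtain ⟨rfl, rfl⟩ := replaceOne_const h
    exact .inr ⟨a, c, b, by simp, rfl, by simp [str]⟩

variable [LinearOrder C₀]

/-- Treating a constant as a word of length one turns all cases of `≻` on words for one associative
symbol into the length-lexicographic order. -/
theorem gt_bar_iff {g : F} (hg : g ∈ sig.assoc) {v w : List (Cst C₀)} (hv : v ≠ [])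
    (hw : w ≠ []) : Gt sig (bar g v) (bar g w) ↔ LenLexGt v w := by
  constructor
  · intro h
    rcases exists_singleton_or_two_le hv with ⟨c, rfl⟩ | hv <;>
    rcases exists_singleton_or_two_le hw with ⟨d, rfl⟩ | hw
    · rw [bar_singleton, bar_singleton] at h
      cases h
      simpa
    · rw [bar_of_two_le hw] at h
      cases h
    · exact .of_length_lt (by simp; omega)
    · rw [bar_of_two_le hv, bar_of_two_le hw] at h
      generalize hs : str g v = s at h
      generalize ht : str g w = t at h
      cases h with
      | const h => simp [str] at hs
      | app_const => simp [str] at ht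
      | assoc hg hu hv h =>
        rw [str_inj] at hs ht
        rwa [hs.2, ht.2]
  · intro h
    rcases exists_singleton_or_two_le hv with ⟨c, rfl⟩ | hv' <;>
    rcases exists_singleton_or_two_le hw with ⟨d, rfl⟩ | hw'
    · exact .const (by simpa using h)
    · have := h.length_le
      simp at this
      omega
    · rw [bar_of_two_le hv']
      exact .app_const ..
    · rw [bar_of_two_le hv', bar_of_two_le hw']
      exact .assoc hg hv' hw' h

theorem gt_const_iff {c d : Cst C₀} :
    Gt sig (.const c : Term F (Cst C₀)) (.const d) ↔ CstGt c d :=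
  ⟨fun h => by cases h; assumption, .const⟩

theorem not_gt_const_str {c : Cst C₀} {h : F} {cs : List (Cst C₀)} :
    ¬ Gt sig (.const c) (str h cs) := fun h => by cases h

/-- The inferences between flat equations, in terms of words. -/
inductive FlatInference (sig : Signature F) : Inference F C₀ → Prop
  | deduce (g : F) (u₁ u₂ u₃ v w : List (Cst C₀)) : g ∈ sig.assoc →
      u₁ ≠ [] → u₂ ≠ [] → u₃ ≠ [] → v ≠ [] → w ≠ [] →
      FlatInference sig
        { prem := {s(bar g (u₁ ++ u₂), bar g v), s(bar g (u₂ ++ u₃), bar g w)}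
          del := ∅
          add := {s(bar g (u₁ ++ w), bar g (v ++ u₃))} }
  | word (g : F) (a p q b w : List (Cst C₀)) : g ∈ sig.assoc → p ≠ [] → q ≠ [] → w ≠ [] →
      LenLexGt p q → (a ++ b = [] → LenLexGt w q) →
      FlatInference sig
        { prem := {s(bar g (a ++ p ++ b), bar g w), s(bar g p, bar g q)}
          del := {s(bar g (a ++ p ++ b), bar g w)}
          add := {s(bar g (a ++ q ++ b), bar g w)} }
  | root (h : F) (cs : List (Cst C₀)) (c d : Cst C₀) : h ∉ sig.assoc → CstGt c d →
      FlatInference sig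
        { prem := {s(str h cs, .const c), s(str h cs, .const d)}
          del := {s(str h cs, .const c)}
          add := {s(.const d, .const c)} }
  | arg (h : F) (a b : List (Cst C₀)) (c d e : Cst C₀) : h ∉ sig.assoc → CstGt c d →
      FlatInference sig
        { prem := {s(str h (a ++ [c] ++ b), .const e), s(.const c, .const d)}
          del := {s(str h (a ++ [c] ++ b), .const e)}
          add := {s(str h (a ++ [d] ++ b), .const e)} }
  | compose (h : F) (cs : List (Cst C₀)) (c d : Cst C₀) : h ∉ sig.assoc → CstGt c d →
      FlatInference sig
        { prem := {s(str h cs, .const c), s(.const c, .const d)}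
          del := {s(str h cs, .const c)}
          add := {s(str h cs, .const d)} }
  | delete (s : Term F (Cst C₀)) :
      FlatInference sig { prem := {s(s, s)}, del := {s(s, s)}, add := ∅ }

/-- Once constants count as words, SIMPLIFY, and COLLAPSE and COMPOSE on word equations, are all the
same operation: replacing a factor `p` by a smaller `q` on one side. Only D-flat equations for
non-associative symbols keep separate cases. -/
theorem IsInference.flat {τ : Inference F C₀}
    (hτ : IsInference sig τ) (hprem : ∀ e ∈ τ.prem, Flat sig C e) : FlatInference sig τ := by
  cases hτ with
  | deduce g u₁ u₂ u₃ v w hg h₁ h₂ h₃ hv hw _ _ =>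
    have len {x y : List (Cst C₀)} (hx : x ≠ []) (hy : y ≠ []) : 2 ≤ (x ++ y).length := by
      have := List.length_pos_iff.mpr hx
      have := List.length_pos_iff.mpr hy
      simp; omega
    rw [← bar_of_two_le (len h₁ h₂), ← bar_of_two_le (len h₂ h₃), ← bar_of_two_le (len h₁ hw),
      ← bar_of_two_le (len hv h₃)]
    exact .deduce g u₁ u₂ u₃ v w hg h₁ h₂ h₃ hv hw
  | simplify g u₁ u₂ u₃ w s hg h₂ hw hgt hs =>
    obtain ⟨w', hw', rfl⟩ := (hprem _ (Set.mem_insert _ _)).of_str_left hg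
    have hne : u₂ ≠ [] := by rintro rfl; simp at h₂
    rw [← bar_of_two_le (g := g) h₂, gt_bar_iff hg hne hw] at hgt
    rw [gt_bar_iff hg hw' hw] at hs
    rw [← bar_of_two_le (v := u₁ ++ u₂ ++ u₃) (by simp; omega), ← bar_of_two_le h₂]
    exact .word g u₁ u₂ w u₃ w' hg hne hw hw' hgt hs
  | collapse s s' t u d hrep hst hud hu hsu =>
    rcases (hprem _ (Set.mem_insert _ _)).cases with
      ⟨g, hg, v, w, hv, hw, rfl, rfl⟩ | ⟨h, hh, cs, e, rfl, rfl⟩ | ⟨h, hh, cs, e, rfl, rfl⟩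
    · obtain ⟨a, c, b, rfl, rfl, rfl⟩ : ∃ a c b, v = a ++ [c] ++ b ∧ u = .const c ∧
          s' = bar g (a ++ [d] ++ b) := by
        rcases exists_singleton_or_two_le hv with ⟨c, rfl⟩ | hv'
        · obtain ⟨rfl, rfl⟩ := replaceOne_const hrep
          exact ⟨[], c, [], by simp, rfl, by simp⟩
        · rw [bar_of_two_le hv'] at hrep
          rcases replaceOne_str hrep with ⟨rfl, _⟩ | ⟨a, c, b, rfl, rfl, rfl⟩
          · exact absurd rfl (hu g hg _)
          · exact ⟨a, c, b, rfl, rfl, (bar_of_two_le (by simpa using hv')).symm⟩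
      rw [← bar_singleton g c, ← bar_singleton g d]
      refine .word g a [c] [d] b w hg (by simp) (by simp) hw ?_ fun hab => ?_
      · simpa using gt_const_iff.mp hud
      · simp only [List.append_eq_nil_iff] at hab
        rw [← gt_bar_iff hg hw (by simp)]
        exact hsu (by simp [hab.1, hab.2])
    · rcases replaceOne_str hrep with ⟨rfl, rfl⟩ | ⟨a, c, b, rfl, rfl, rfl⟩
      · exact .root h cs e d hh (gt_const_iff.mp (hsu rfl))
      · exact .arg h a b c d e hh (gt_const_iff.mp hud)
    · exact absurd hst not_gt_const_str
  | compose t c d htc hcd =>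
    rcases (hprem _ (Set.mem_insert _ _)).cases with
      ⟨g, hg, v, w, hv, hw, rfl, hw'⟩ | ⟨h, hh, cs, e, rfl, he⟩ | ⟨h, hh, cs, e, he, rfl⟩
    · rw [← bar_singleton g c] at htc ⊢
      rw [gt_bar_iff hg hv (by simp)] at htc
      -- COMPOSE rewrites the smaller side. After swapping the sides it is a `word` inference with
      -- empty context, and its side condition `v ≻ d` follows from `v ≻ c ≻ d`.
      rw [← bar_singleton g d, Sym2.eq_swap, Sym2.eq_swap (a := bar g v) (b := bar g [d])]
      refine .word g [] [c] [d] [] v hg (by simp) (by simp) hv (by simpa using hcd) fun _ => ?_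
      rcases exists_singleton_or_two_le hv with ⟨e, rfl⟩ | hv'
      · rw [lenLexGt_singleton] at htc ⊢
        exact htc.trans hcd
      · exact .of_length_lt (by simp; omega)
    · exact .compose h cs c d hh hcd
    · simp [str] at he
  | delete s => exact .delete s

end FlatEquations

end CCM

namespace CCM

open Relation

/-! ### Fair derivations and the persisting rules -/

section Derivation

variable {F C₀ : Type u} [LinearOrder C₀]

/-- A fair derivation from a set of flat equations over `C` which contains `U(C)`. -/
structure Completion (sig : Signature F) (f : F) (one : C₀) (C : Set (Cst C₀))
    (S : ℕ → Set (Eqn F (Cst C₀))) : Prop where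
  assoc : f ∈ sig.assoc
  minimal : ∀ c : C₀, one ≤ c
  finite : C.Finite
  flat_zero : ∀ e ∈ S 0, Flat sig C e
  units : unitEqns f one C ⊆ S 0
  derivation : IsDerivation sig S
  fair : IsFair sig S

variable {sig : Signature F} {f : F} {one : C₀} {C : Set (Cst C₀)}
  {S : ℕ → Set (Eqn F (Cst C₀))}

theorem FlatInference.flat_add (hf : f ∈ sig.assoc) {τ : Inference F C₀}
    (hτ : FlatInference sig τ) (hprem : ∀ e ∈ τ.prem, Flat sig C e) :
    ∀ e ∈ τ.add, Flat sig C e := by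
  cases hτ with
  | deduce g u₁ u₂ u₃ v w hg h₁ h₂ h₃ hv hw =>
    have p₁ := hprem _ (Set.mem_insert _ _)
    have p₂ := hprem _ (Set.mem_insert_of_mem _ rfl)
    rw [flat_word_iff hg (by simp [h₁]) hv] at p₁
    rw [flat_word_iff hg (by simp [h₂]) hw] at p₂
    rintro e rfl
    rw [flat_word_iff hg (by simp [h₁]) (by simp [h₃])]
    simp only [List.mem_append] at *
    grind
  | word g a p q b w hg hp hq hw hpq hab =>
    have p₁ := hprem _ (Set.mem_insert _ _)
    have p₂ := hprem _ (Set.mem_insert_of_mem _ rfl)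
    rw [flat_word_iff hg (by simp [hp]) hw] at p₁
    rw [flat_word_iff hg hp hq] at p₂
    rintro e rfl
    rw [flat_word_iff hg (by simp [hq]) hw]
    simp only [List.mem_append] at *
    grind
  | root h cs c d hh hcd =>
    have p₁ := hprem _ (Set.mem_insert _ _)
    have p₂ := hprem _ (Set.mem_insert_of_mem _ rfl)
    rw [flat_dflat_iff hh] at p₁ p₂
    rintro e rfl
    rw [flat_const_iff hf]
    exact ⟨p₂.2.2, p₁.2.2⟩
  | arg h a b c d e hh hcd =>
    have p₁ := hprem _ (Set.mem_insert _ _)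
    have p₂ := hprem _ (Set.mem_insert_of_mem _ rfl)
    rw [flat_dflat_iff hh] at p₁
    rw [flat_const_iff hf] at p₂
    rintro e rfl
    rw [flat_dflat_iff hh]
    simp only [List.mem_append, List.length_append, List.length_singleton] at *
    grind
  | compose h cs c d hh hcd =>
    have p₁ := hprem _ (Set.mem_insert _ _)
    have p₂ := hprem _ (Set.mem_insert_of_mem _ rfl)
    rw [flat_dflat_iff hh] at p₁
    rw [flat_const_iff hf] at p₂
    rintro e rfl
    rw [flat_dflat_iff hh]
    exact ⟨p₁.1, p₁.2.1, p₂.2⟩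
  | delete s => simp

namespace Completion

variable (H : Completion sig f one C S)
include H

theorem flat (i : ℕ) : ∀ e ∈ S i, Flat sig C e := by
  induction i with
  | zero => exact H.flat_zero
  | succ i ih =>
    intro e he
    rcases H.derivation i with h | ⟨τ, hτ, hen, h⟩
    · exact ih e (h ▸ he)
    · rw [h] at he
      have hprem : ∀ e ∈ τ.prem, Flat sig C e := fun e he => ih e (hen he)
      rcases he with he | he
      · exact ih e he.1
      · exact (hτ.flat hprem).flat_add H.assoc hprem e he

theorem exists_of_step (i : ℕ) : S (i + 1) = S i ∨ ∃ τ, FlatInference sig τ ∧ τ.prem ⊆ S i ∧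
    S (i + 1) = (S i \ τ.del) ∪ τ.add := by
  rcases H.derivation i with h | ⟨τ, hτ, hen, h⟩
  · exact .inl h
  · exact .inr ⟨τ, hτ.flat fun e he => H.flat i e (hen he), hen, h⟩

omit [LinearOrder C₀] H in
theorem exists_of_persisting {e : Eqn F (Cst C₀)} (he : e ∈ persisting S) : ∃ i, e ∈ S i := by
  simp only [persisting, Set.mem_iUnion, Set.mem_iInter] at he
  obtain ⟨i, hi⟩ := he
  exact ⟨i, hi i le_rfl⟩

theorem flat_of_persisting {e : Eqn F (Cst C₀)} (he : e ∈ persisting S) : Flat sig C e :=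
  let ⟨i, hi⟩ := exists_of_persisting he
  H.flat i e hi

/-- If the equation does not remain forever, some later step loses it, and a step can only lose what
its inference deletes. -/
theorem persisting_or_deleted {i : ℕ} {e : Eqn F (Cst C₀)} (he : e ∈ S i) :
    e ∈ persisting S ∨ ∃ j τ, FlatInference sig τ ∧ τ.prem ⊆ S j ∧ τ.add ⊆ S (j + 1) ∧
      e ∈ τ.del := by
  by_cases h : ∀ j ≥ i, e ∈ S j → e ∈ S (j + 1)
  · refine .inl ?_
    simp only [persisting, Set.mem_iUnion, Set.mem_iInter]
    refine ⟨i, fun j hj => ?_⟩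
    induction j, hj using Nat.le_induction with
    | base => exact he
    | succ j hj ih => exact h j hj ih
  · push Not at h
    obtain ⟨j, -, hj, hj'⟩ := h
    rcases H.exists_of_step j with h | ⟨τ, hτ, hen, h⟩
    · exact absurd (h ▸ hj) hj'
    · refine .inr ⟨j, τ, hτ, hen, h ▸ Set.subset_union_right, ?_⟩
      by_contra hd
      exact hj' (h ▸ .inl ⟨hj, hd⟩)

/-- By fairness, inferences between persisting equations have been applied. -/
theorem applied_of_persisting {τ : Inference F C₀} (hτ : IsInference sig τ)
    (hfin : τ.prem.Finite) (h : τ.prem ⊆ persisting S) :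
    (∃ i, τ.add ⊆ S i) ∧ ∀ e ∈ τ.prem, e ∈ τ.del → e ∈ τ.add := by
  have : ∃ n, ∀ e ∈ τ.prem, ∀ j ≥ n, e ∈ S j := by
    have h1 : ∀ e : τ.prem, ∃ n, ∀ j ≥ n, e.1 ∈ S j := fun e => by
      simpa [persisting] using h e.2
    choose n hn using h1
    have := hfin.to_subtype
    obtain ⟨N, hN⟩ := (Set.finite_range n).bddAbove
    exact ⟨N, fun e he j hj => hn ⟨e, he⟩ j (le_trans (hN ⟨⟨e, he⟩, rfl⟩) hj)⟩
  obtain ⟨n, hn⟩ := this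
  obtain ⟨i, hi, _, happ⟩ := H.fair τ hτ ⟨n, fun j hj e he => hn e he j hj⟩
  refine ⟨⟨i + 1, happ ▸ Set.subset_union_right⟩, fun e he hd => ?_⟩
  -- The inference is applied while it stays enabled, so its premises are still present right
  -- afterwards. A deleted premise must therefore have been added back by the same step.
  have := hi (i + 1) (by omega) he
  rw [happ] at this
  rcases this with h | h
  · exact absurd hd h.2
  · exact h

end Completion

/-- The persisting rules between words of constants. -/
def WordRule (S : ℕ → Set (Eqn F (Cst C₀))) (g : F) (v w : List (Cst C₀)) : Prop :=
  v ≠ [] ∧ w ≠ [] ∧ LenLexGt v w ∧ s(bar g v, bar g w) ∈ persisting S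

omit [LinearOrder C₀] in
-- A constant is a word for every associative symbol, so the symbol can be recovered only from words
-- with at least two letters.
theorem bar_eq_bar {g g' : F} {v w : List (Cst C₀)} (hv : v ≠ []) (hw : w ≠ [])
    (h : bar g v = bar g' w) : v = w ∧ (g = g' ∨ ∃ c, v = [c]) := by
  rcases exists_singleton_or_two_le hw with ⟨c, rfl⟩ | hw'
  · rw [bar_singleton, bar_eq_const hv] at h
    exact ⟨h, .inr ⟨c, h⟩⟩
  · rw [bar_of_two_le hw', bar_eq_str hv] at h
    exact ⟨h.2.1, .inl h.1⟩

theorem LenLexGt.eq_singleton {c : Cst C₀} {w : List (Cst C₀)} (h : LenLexGt [c] w)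
    (hw : w ≠ []) : ∃ d, w = [d] ∧ CstGt c d := by
  rcases exists_singleton_or_two_le hw with ⟨d, rfl⟩ | hw'
  · exact ⟨d, rfl, by simpa using h⟩
  · have := h.length_le
    simp at this
    omega

namespace Completion

variable (H : Completion sig f one C S)
include H

omit [LinearOrder C₀] H in
theorem singleton_of_append {a p b : List (Cst C₀)} {c : Cst C₀} (hp : p ≠ [])
    (h : a ++ p ++ b = [c]) : a = [] ∧ p = [c] ∧ b = [] := by
  have := List.length_pos_iff.mpr hp
  have hl := congrArg List.length h
  simp at hl
  obtain rfl : a = [] := List.length_eq_zero_iff.mp (by omega)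
  obtain rfl : b = [] := List.length_eq_zero_iff.mp (by omega)
  simpa using h

/-- An equation between words persists, or is trivial, or is simplified at some point. -/
theorem word_cases {i : ℕ} {g : F} (hg : g ∈ sig.assoc) {v w : List (Cst C₀)} (hv : v ≠ [])
    (hw : w ≠ []) (h : s(bar g v, bar g w) ∈ S i) :
    s(bar g v, bar g w) ∈ persisting S ∨ v = w ∨
    ∃ j a p q b u, ((v = a ++ p ++ b ∧ w = u) ∨ (v = u ∧ w = a ++ p ++ b)) ∧ p ≠ [] ∧ q ≠ [] ∧
      LenLexGt p q ∧ (a ++ b = [] → LenLexGt u q) ∧ s(bar g p, bar g q) ∈ S j ∧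
      s(bar g (a ++ q ++ b), bar g u) ∈ S (j + 1) := by
  rcases H.persisting_or_deleted h with h | ⟨j, τ, hτ, hprem, hadd, hdel⟩
  · exact .inl h
  refine .inr ?_
  cases hτ with
  | deduce => exact absurd hdel (Set.notMem_empty _)
  | word g' a p q b u hg' hp hq hu hpq hab =>
    refine .inr ⟨j, a, p, q, b, u, ?_⟩
    have h₁ : s(bar g' p, bar g' q) ∈ S j := hprem (Set.mem_insert_of_mem _ rfl)
    have h₂ : s(bar g' (a ++ q ++ b), bar g' u) ∈ S (j + 1) := hadd rfl
    -- The recorded inference may be phrased with another symbol `g'`. This happens only for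
    -- equations between constants, and then everything involved is a constant and can be read with
    -- `g`.
    have key : (∃ c d, a ++ p ++ b = [c] ∧ u = [d]) ∨ g = g' →
        s(bar g p, bar g q) ∈ S j ∧ s(bar g (a ++ q ++ b), bar g u) ∈ S (j + 1) := by
      rintro (⟨c, d, h, rfl⟩ | rfl)
      · obtain ⟨rfl, rfl, rfl⟩ := singleton_of_append hp h
        obtain ⟨e, rfl, _⟩ := hpq.eq_singleton hq
        simp only [List.nil_append, List.append_nil, bar_singleton] at h₁ h₂ ⊢
        exact ⟨h₁, h₂⟩
      · exact ⟨h₁, h₂⟩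
    have hne : a ++ p ++ b ≠ [] := by simp [hp]
    simp only [Set.mem_singleton_iff, Sym2.eq_iff] at hdel
    rcases hdel with ⟨e₁, e₂⟩ | ⟨e₁, e₂⟩
    · have b₁ := bar_eq_bar hv hne e₁
      have b₂ := bar_eq_bar hw hu e₂
      refine ⟨.inl ⟨b₁.1, b₂.1⟩, hp, hq, hpq, hab, key ?_⟩
      rcases b₁.2 with h | ⟨c, hc⟩
      · exact .inr h
      rcases b₂.2 with h | ⟨d, hd⟩
      · exact .inr h
      exact .inl ⟨c, d, b₁.1 ▸ hc, b₂.1 ▸ hd⟩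
    · have b₁ := bar_eq_bar hv hu e₁
      have b₂ := bar_eq_bar hw hne e₂
      refine ⟨.inr ⟨b₁.1, b₂.1⟩, hp, hq, hpq, hab, key ?_⟩
      rcases b₁.2 with h | ⟨c, hc⟩
      · exact .inr h
      rcases b₂.2 with h | ⟨d, hd⟩
      · exact .inr h
      exact .inl ⟨d, c, b₂.1 ▸ hd, b₁.1 ▸ hc⟩
  | root h cs c d hh hcd | compose h cs c d hh hcd =>
    simp only [Set.mem_singleton_iff, Sym2.eq_iff] at hdel
    rcases hdel with ⟨e₁, e₂⟩ | ⟨e₁, e₂⟩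
    · exact absurd e₁ (bar_ne_str_nonassoc hg hh hv)
    · exact absurd e₂ (bar_ne_str_nonassoc hg hh hw)
  | arg h a b c d e hh hcd =>
    simp only [Set.mem_singleton_iff, Sym2.eq_iff] at hdel
    rcases hdel with ⟨e₁, e₂⟩ | ⟨e₁, e₂⟩
    · exact absurd e₁ (bar_ne_str_nonassoc hg hh hv)
    · exact absurd e₂ (bar_ne_str_nonassoc hg hh hw)
  | delete s =>
    simp only [Set.mem_singleton_iff, Sym2.eq_iff] at hdel
    refine .inl ((bar_inj (g := g) hv hw).mp ?_)
    rcases hdel with ⟨e₁, e₂⟩ | ⟨e₁, e₂⟩ <;> rw [e₁, e₂]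

/-- Such a configuration enables a simplification that deletes a persisting equation. By fairness
its result must be that equation again, which forces `p = q` and contradicts `p ≻ q`. -/
theorem not_reducible {g : F} (hg : g ∈ sig.assoc) {a p q b w : List (Cst C₀)}
    (h₁ : WordRule S g (a ++ p ++ b) w) (h₂ : WordRule S g p q)
    (hab : a ++ b = [] → LenLexGt w q) : False := by
  obtain ⟨hv, hw, hgt₁, h₁⟩ := h₁
  obtain ⟨hp, hq, hgt₂, h₂⟩ := h₂
  suffices hτ : IsInference sig
      { prem := {s(bar g (a ++ p ++ b), bar g w), s(bar g p, bar g q)}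
        del := {s(bar g (a ++ p ++ b), bar g w)}
        add := {s(bar g (a ++ q ++ b), bar g w)} } by
    have := (H.applied_of_persisting hτ (Set.toFinite _) (by
      rintro e (rfl | rfl)
      · exact h₁
      · exact h₂)).2 _ (Set.mem_insert _ _) rfl
    simp only [Set.mem_singleton_iff, Sym2.congr_left] at this
    rw [bar_inj hv (by simp [hq]), List.append_left_inj, List.append_right_inj] at this
    subst this
    exact hgt₂.irrefl
  -- A left-hand side that is a single constant is applied by COLLAPSE, a longer one by SIMPLIFY.
  rcases exists_singleton_or_two_le hp with ⟨c, rfl⟩ | hp'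
  · obtain ⟨d, rfl, hcd⟩ := hgt₂.eq_singleton hq
    refine .collapse _ _ _ (.const c) d ?_ ((gt_bar_iff hg hv hw).mpr hgt₁) (.const hcd)
      (by simp) fun he => ?_
    · rcases exists_singleton_or_two_le hv with ⟨e, he⟩ | hv'
      · obtain ⟨rfl, hc, rfl⟩ := singleton_of_append hp he
        exact .root
      · rw [bar_of_two_le hv', bar_of_two_le (by simpa using hv')]
        simp only [str, List.map_append, List.map_cons, List.append_assoc,
          List.singleton_append]
        exact .arg _ _ _ .root
    · rw [bar_eq_const hv] at he
      obtain ⟨rfl, _, rfl⟩ := singleton_of_append hp he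
      rw [← bar_singleton g d, gt_bar_iff hg hw hq]
      exact hab rfl
  · rw [bar_of_two_le (v := a ++ p ++ b) (by simp; omega), bar_of_two_le hp']
    refine .simplify g a p b q _ hg hp' hq ?_ fun he => ?_
    · rw [← bar_of_two_le hp', gt_bar_iff hg hp hq]
      exact hgt₂
    · rw [gt_bar_iff hg hw hq]
      exact hab he

/-- The persisting rules are left-reduced. -/
theorem reduced {g : F} (hg : g ∈ sig.assoc) {a p q b w : List (Cst C₀)}
    (h₁ : WordRule S g (a ++ p ++ b) w) (h₂ : WordRule S g p q) : a = [] ∧ b = [] ∧ w = q := by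
  by_cases hab : a ++ b = []
  · have := List.append_eq_nil_iff.mp hab
    obtain ⟨rfl, rfl⟩ := this
    refine ⟨rfl, rfl, ?_⟩
    -- With equal left-hand sides, the side condition lets the rule with the smaller right-hand side
    -- simplify the other one, so neither right-hand side can be larger.
    rcases LenLexGt.total w q with h | h | h
    · exact (H.not_reducible hg h₁ h₂ fun _ => h).elim
    · exact h
    · simp only [List.nil_append, List.append_nil] at h₁
      exact (H.not_reducible hg (a := []) (b := []) (by simpa using h₂) h₁ fun _ => h).elim
  · exact (H.not_reducible hg h₁ h₂ fun h => absurd h hab).elim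

/-- Fairness applies DEDUCE to the two persisting premises. The conclusion is only known to occur at
some stage; it may be simplified later. -/
theorem overlap {g : F} (hg : g ∈ sig.assoc) {u₁ u₂ u₃ v w : List (Cst C₀)} (hu₁ : u₁ ≠ [])
    (hu₂ : u₂ ≠ []) (hu₃ : u₃ ≠ []) (h₁ : WordRule S g (u₁ ++ u₂) v)
    (h₂ : WordRule S g (u₂ ++ u₃) w) : ∃ i, s(bar g (u₁ ++ w), bar g (v ++ u₃)) ∈ S i := by
  have len {x y : List (Cst C₀)} (hx : x ≠ []) (hy : y ≠ []) : 2 ≤ (x ++ y).length := by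
    have := List.length_pos_iff.mpr hx
    have := List.length_pos_iff.mpr hy
    simp; omega
  obtain ⟨hn₁, hv, hgt₁, h₁⟩ := h₁
  obtain ⟨hn₂, hw, hgt₂, h₂⟩ := h₂
  rw [← gt_bar_iff hg hn₁ hv, bar_of_two_le (len hu₁ hu₂)] at hgt₁
  rw [← gt_bar_iff hg hn₂ hw, bar_of_two_le (len hu₂ hu₃)] at hgt₂
  rw [bar_of_two_le (len hu₁ hu₂)] at h₁
  rw [bar_of_two_le (len hu₂ hu₃)] at h₂
  rw [bar_of_two_le (len hu₁ hw), bar_of_two_le (len hv hu₃)]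
  obtain ⟨i, hi⟩ := (H.applied_of_persisting
    (.deduce g u₁ u₂ u₃ v w hg hu₁ hu₂ hu₃ hv hw hgt₁ hgt₂) (Set.toFinite _) (by
      rintro e (rfl | rfl)
      · exact h₁
      · exact h₂)).1
  exact ⟨i, hi rfl⟩

end Completion

end Derivation

end CCM

namespace CCM

open Relation

/-! ### Confluence of rewriting on argument words -/

section Strings

variable {F C₀ : Type u}

/-- Digits of letters, given digits of constants. -/
def digit (δ : Cst C₀ → ℕ) : Term F (Cst C₀) → ℕ
  | .const c => δ c
  | .app _ _ => 1

/-- The word of letters for a word of constants. -/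
abbrev letters (v : List (Cst C₀)) : List (Term F (Cst C₀)) := v.map .const

variable [LinearOrder C₀]

/-- A numbering of the constants that reflects the precedence on `C`. -/
structure IsIndex (C : Set (Cst C₀)) (δ : Cst C₀ → ℕ) (B : ℕ) : Prop where
  pos : ∀ c, 1 ≤ δ c
  lt : ∀ c, δ c < B
  mono : ∀ c ∈ C, ∀ d ∈ C, CstGt c d → δ d < δ c

variable {sig : Signature F} {f : F} {one : C₀} {C : Set (Cst C₀)}
  {S : ℕ → Set (Eqn F (Cst C₀))} {δ : Cst C₀ → ℕ} {B : ℕ}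

namespace IsIndex

variable (hδ : IsIndex C δ B)
include hδ

theorem digit_lt (t : Term F (Cst C₀)) : digit δ t < B := by
  cases t with
  | const c => exact hδ.lt c
  | app g ts => exact lt_of_le_of_lt (hδ.pos (new 0)) (hδ.lt (new 0))

theorem digit_pos (t : Term F (Cst C₀)) : 1 ≤ digit δ t := by
  cases t with
  | const c => exact hδ.pos c
  | app g ts => exact le_rfl

theorem val_lt_of_gt {v w : List (Cst C₀)} (hv : ∀ c ∈ v, c ∈ C) (hw : ∀ c ∈ w, c ∈ C)
    (h : LenLexGt v w) : wordVal δ B w < wordVal δ B v :=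
  wordVal_lt_of_shortlex hδ.lt hδ.pos (fun a ha b hb hab => hδ.mono b (hv b hb) a (hw a ha) hab) h

theorem context {x y : List (Term F (Cst C₀))} (h : wordVal (digit δ) B x < wordVal (digit δ) B y)
    (a b : List (Term F (Cst C₀))) :
    wordVal (digit δ) B (a ++ x ++ b) < wordVal (digit δ) B (a ++ y ++ b) :=
  wordVal_context hδ.digit_lt hδ.digit_pos h a b

end IsIndex

omit [LinearOrder C₀] in
theorem val_letters (v : List (Cst C₀)) :
    wordVal (digit (F := F) δ) B (letters v) = wordVal δ B v := by
  rw [letters, wordVal_map]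
  rfl

/-- One rewrite step with a persisting rule on words of letters. -/
def RuleStep (S : ℕ → Set (Eqn F (Cst C₀))) (g : F) (x y : List (Term F (Cst C₀))) : Prop :=
  ∃ a v w b, WordRule S g v w ∧ x = a ++ letters v ++ b ∧ y = a ++ letters w ++ b

/-- Deletion of a letter `1` from a word with several letters. -/
def UnitStep (one : C₀) (x y : List (Term F (Cst C₀))) : Prop :=
  ∃ a b, a ++ b ≠ [] ∧ x = a ++ [.const (.inl one)] ++ b ∧ y = a ++ b

/-- One rewrite step on words of arguments of `g`. -/
def WordStep (S : ℕ → Set (Eqn F (Cst C₀))) (f : F) (one : C₀) (g : F)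
    (x y : List (Term F (Cst C₀))) : Prop :=
  RuleStep S g x y ∨ g = f ∧ UnitStep one x y

theorem RuleStep.context {g : F} {x y : List (Term F (Cst C₀))} (h : RuleStep S g x y)
    (a b : List (Term F (Cst C₀))) : RuleStep S g (a ++ x ++ b) (a ++ y ++ b) := by
  obtain ⟨a', v, w, b', hr, rfl, rfl⟩ := h
  exact ⟨a ++ a', v, w, b' ++ b, hr, by simp, by simp⟩

theorem WordRule.step {g : F} {v w : List (Cst C₀)} (h : WordRule S g v w)
    (a b : List (Term F (Cst C₀))) :
    WordStep S f one g (a ++ letters v ++ b) (a ++ letters w ++ b) :=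
  .inl ⟨a, v, w, b, h, rfl, rfl⟩

theorem WordStep.ne_nil {g : F} {x y : List (Term F (Cst C₀))} (h : WordStep S f one g x y) :
    x ≠ [] ∧ y ≠ [] := by
  rcases h with ⟨a, v, w, b, hr, rfl, rfl⟩ | ⟨-, a, b, hab, rfl, rfl⟩
  · simp [hr.1, hr.2.1]
  · simpa using hab

namespace Completion

variable (H : Completion sig f one C S) (hδ : IsIndex C δ B)
include H

theorem mem_of_wordRule {g : F} (hg : g ∈ sig.assoc) {v w : List (Cst C₀)}
    (h : WordRule S g v w) : (∀ c ∈ v, c ∈ C) ∧ ∀ c ∈ w, c ∈ C :=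
  (flat_word_iff hg h.1 h.2.1).mp (H.flat_of_persisting h.2.2.2)

include hδ

theorem val_of_ruleStep {g : F} (hg : g ∈ sig.assoc) {x y : List (Term F (Cst C₀))}
    (h : RuleStep S g x y) : wordVal (digit δ) B y < wordVal (digit δ) B x := by
  obtain ⟨a, v, w, b, hr, rfl, rfl⟩ := h
  refine hδ.context ?_ a b
  rw [val_letters, val_letters]
  exact hδ.val_lt_of_gt (H.mem_of_wordRule hg hr).1 (H.mem_of_wordRule hg hr).2 hr.2.2.1

theorem val_of_wordStep {g : F} (hg : g ∈ sig.assoc) {x y : List (Term F (Cst C₀))}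
    (h : WordStep S f one g x y) : wordVal (digit δ) B y < wordVal (digit δ) B x := by
  rcases h with h | ⟨-, a, b, -, rfl, rfl⟩
  · exact H.val_of_ruleStep hδ hg h
  · exact wordVal_lt_of_length_lt hδ.digit_lt hδ.digit_pos (by simp)

omit H in
-- The sum of powers of two encodes the multiset order on the two sides of an equation. When `a p b
-- ≈ u` is replaced using `p ≈ q`, both `p ≈ q` and `a q b ≈ u` must be smaller. In a nonempty
-- context `p` is shorter than `a p b`, so 2^p + 2^q < 2·2^p ≤ 2^(apb), writing words for their
-- values. In the empty context the side condition of the rule gives `q` below `u`.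
theorem size_lt {a p q b u : List (Cst C₀)}
    (hpq : wordVal δ B q < wordVal δ B p) (hab : a ++ b = [] → wordVal δ B q < wordVal δ B u) :
    2 ^ wordVal δ B p + 2 ^ wordVal δ B q < 2 ^ wordVal δ B (a ++ p ++ b) + 2 ^ wordVal δ B u ∧
    2 ^ wordVal δ B (a ++ q ++ b) + 2 ^ wordVal δ B u <
      2 ^ wordVal δ B (a ++ p ++ b) + 2 ^ wordVal δ B u := by
  have h2 : 2 ^ wordVal δ B (a ++ q ++ b) < 2 ^ wordVal δ B (a ++ p ++ b) :=
    Nat.pow_lt_pow_right (by norm_num) (wordVal_context hδ.lt hδ.pos hpq a b)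
  refine ⟨?_, by omega⟩
  by_cases h : a ++ b = []
  · obtain ⟨rfl, rfl⟩ := List.append_eq_nil_iff.mp h
    have := Nat.pow_lt_pow_right (a := 2) (by norm_num) (hab rfl)
    simp only [List.nil_append, List.append_nil]
    omega
  · have h3 : wordVal δ B p < wordVal δ B (a ++ p ++ b) := by
      refine wordVal_lt_of_length_lt hδ.lt hδ.pos ?_
      have := List.length_pos_iff.mpr h
      simp at this ⊢
      omega
    have h4 : 2 ^ (wordVal δ B p + 1) ≤ 2 ^ wordVal δ B (a ++ p ++ b) :=
      Nat.pow_le_pow_right (by norm_num) h3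
    have h5 : 2 ^ wordVal δ B q < 2 ^ wordVal δ B p := Nat.pow_lt_pow_right (by norm_num) hpq
    rw [pow_succ] at h4
    have h6 := Nat.zero_le (2 ^ wordVal δ B u)
    omega

/-- Equations between words that occur in the derivation can be joined in all contexts of value
below `M`, if the words of value below `M` are confluent. -/
theorem join_of_mem {g : F} (hg : g ∈ sig.assoc) {M : ℕ}
    (hM : ∀ x, wordVal (digit δ) B x < M → Confl (WordStep S f one g) x) {i : ℕ}
    {v w : List (Cst C₀)} (hv : v ≠ []) (hw : w ≠ []) (h : s(bar g v, bar g w) ∈ S i)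
    (a b : List (Term F (Cst C₀))) (hav : wordVal (digit δ) B (a ++ letters v ++ b) < M)
    (haw : wordVal (digit δ) B (a ++ letters w ++ b) < M) :
    Join (ReflTransGen (WordStep S f one g)) (a ++ letters v ++ b) (a ++ letters w ++ b) := by
  induction hn : 2 ^ wordVal δ B v + 2 ^ wordVal δ B w using Nat.strong_induction_on
    generalizing i v w a b with
  | _ n ih =>
    subst hn
    rcases H.word_cases hg hv hw h with h | rfl |
      ⟨j, a', p, q, b', u, huv, hp, hq, hpq, hab, h₁, h₂⟩
    · rcases LenLexGt.total v w with hgt | rfl | hgt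
      · exact join_of_step (WordRule.step ⟨hv, hw, hgt, h⟩ a b)
      · exact join_refl _
      · rw [Sym2.eq_swap] at h
        exact join_symm (join_of_step (WordRule.step ⟨hw, hv, hgt, h⟩ a b))
    · exact join_refl _
    have hu : u ≠ [] := by rcases huv with ⟨-, rfl⟩ | ⟨rfl, -⟩ <;> assumption
    have f₁ := (flat_word_iff hg hp hq).mp (H.flat _ _ h₁)
    have f₂ := (flat_word_iff hg (by simp [hq]) hu).mp (H.flat _ _ h₂)
    have hlt := hδ.val_lt_of_gt f₁.1 f₁.2 hpq
    have hsize := size_lt (a := a') (b := b') (u := u) hδ hlt fun h =>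
      hδ.val_lt_of_gt f₂.2 f₁.2 (hab h)
    have key : 2 ^ wordVal δ B v + 2 ^ wordVal δ B w =
        2 ^ wordVal δ B (a' ++ p ++ b') + 2 ^ wordVal δ B u →
        wordVal (digit δ) B (a ++ letters (a' ++ p ++ b') ++ b) < M →
        wordVal (digit δ) B (a ++ letters u ++ b) < M →
        Join (ReflTransGen (WordStep S f one g)) (a ++ letters (a' ++ p ++ b') ++ b)
          (a ++ letters u ++ b) := by
      intro he hp' hu'
      have hlt' : wordVal (digit (F := F) δ) B (letters (a' ++ q ++ b')) <
          wordVal (digit (F := F) δ) B (letters (a' ++ p ++ b')) := by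
        rw [val_letters, val_letters]
        exact wordVal_context hδ.lt hδ.pos hlt _ _
      have hq' := (hδ.context hlt' a b).trans hp'
      -- The join passes through `a' q b'`, whose value in context is below `M`, so confluence holds
      -- there. The first half uses `p ≈ q` in the enlarged context, the second half the simplified
      -- equation; both are smaller.
      refine (hM _ hq').join_trans ?_ (ih _ (he ▸ hsize.2) (by simp [hq]) hu h₂ a b hq' hu' rfl)
      have := ih _ (he ▸ hsize.1) hp hq h₁ (a ++ letters a') (letters b' ++ b)
        (by simpa using hp') (by simpa using hq') rfl
      simpa using this
    rcases huv with ⟨rfl, rfl⟩ | ⟨rfl, rfl⟩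
    · exact key rfl hav haw
    · exact join_symm (key (add_comm _ _) haw hav)

omit hδ [LinearOrder C₀] H in
theorem letters_eq_append {v : List (Cst C₀)} {x y : List (Term F (Cst C₀))}
    (h : letters v = x ++ y) : ∃ v₁ v₂, v = v₁ ++ v₂ ∧ x = letters v₁ ∧ y = letters v₂ := by
  obtain ⟨v₁, v₂, h', rfl, rfl⟩ := List.map_eq_append_iff.mp h
  exact ⟨v₁, v₂, h', rfl, rfl⟩

/-- Peaks between persisting rules can be joined. -/
theorem rule_peak {g : F} (hg : g ∈ sig.assoc) {M : ℕ}
    (hM : ∀ x, wordVal (digit δ) B x < M → Confl (WordStep S f one g) x)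
    {x y z : List (Term F (Cst C₀))} (hx : wordVal (digit δ) B x ≤ M) (hy : RuleStep S g x y)
    (hz : RuleStep S g x z) : Join (ReflTransGen (WordStep S f one g)) y z := by
  have hyx := H.val_of_ruleStep hδ hg hy
  have hzx := H.val_of_ruleStep hδ hg hz
  obtain ⟨a₁, v₁, w₁, b₁, hr₁, rfl, rfl⟩ := hy
  obtain ⟨a₂, v₂, w₂, b₂, hr₂, he, rfl⟩ := hz
  wlog hle : a₁.length ≤ a₂.length generalizing a₁ v₁ w₁ b₁ a₂ v₂ w₂ b₂
  · exact join_symm (this a₂ v₂ w₂ b₂ hr₂ (he ▸ hx) (he ▸ hzx) a₁ v₁ w₁ b₁ hr₁ he.symm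
      (he ▸ hyx) (by omega))
  rcases block_cases_of_le he hle with ⟨k, rfl, rfl⟩ | ⟨p, k, q, hp, hk, hq, e₁, e₂, rfl, rfl⟩ |
    ⟨p, q, e₁, rfl, rfl⟩ | ⟨q, e₁, rfl, rfl⟩
  · refine ⟨a₁ ++ letters w₁ ++ k ++ letters w₂ ++ b₂, ?_, ?_⟩
    · exact .single (.inl ⟨a₁ ++ letters w₁ ++ k, v₂, w₂, b₂, hr₂, by simp, by simp⟩)
    · exact .single (.inl ⟨a₁, v₁, w₁, k ++ letters w₂ ++ b₂, hr₁, by simp, by simp⟩)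
  · obtain ⟨p, k, rfl, rfl, rfl⟩ := letters_eq_append e₁
    obtain ⟨k', q, rfl, hk', rfl⟩ := letters_eq_append e₂
    obtain rfl := map_const_injective hk'
    simp only [ne_eq, List.map_eq_nil_iff] at hp hk hq
    -- A proper overlap: both reducts lie strictly below the peak, so the deduced equation joins
    -- them.
    obtain ⟨i, hi⟩ := H.overlap hg hp hk hq hr₁ hr₂
    refine join_symm ?_
    have := H.join_of_mem hδ hg hM (by simp [hp]) (by simp [hq]) hi a₁ b₂
      (lt_of_lt_of_le (by simpa using hzx) hx) (lt_of_lt_of_le (by simpa using hyx) hx)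
    simpa using this
  · obtain ⟨p', q', rfl, h', rfl⟩ := letters_eq_append e₁
    obtain ⟨p, v₂', rfl, rfl, h''⟩ := letters_eq_append h'.symm
    obtain rfl := map_const_injective h''
    -- Containment of one left-hand side in another forces the two rules to coincide, so the peak is
    -- trivial.
    obtain ⟨rfl, rfl, rfl⟩ := H.reduced hg hr₁ hr₂
    simpa using join_refl _
  · obtain ⟨v', q', rfl, h', rfl⟩ := letters_eq_append e₁
    obtain rfl := map_const_injective h'
    obtain ⟨-, rfl, rfl⟩ := H.reduced hg (a := []) (by simpa using hr₂) hr₁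
    simpa using join_refl _

/-- If `v ≈ w` occurs in the derivation and `w` is smaller in some context, then all results of
rule applications to `v` in this context can be joined with `w` in this context. -/
theorem join_of_mem_of_ruleStep {g : F} (hg : g ∈ sig.assoc) {M : ℕ}
    (hM : ∀ x, wordVal (digit δ) B x < M → Confl (WordStep S f one g) x) {i : ℕ}
    {v w : List (Cst C₀)} (hv : v ≠ []) (hw : w ≠ []) (h : s(bar g v, bar g w) ∈ S i)
    (a b : List (Term F (Cst C₀))) {x y : List (Term F (Cst C₀))}
    (hx : x = a ++ letters v ++ b) (hxM : wordVal (digit δ) B x ≤ M) (hxy : RuleStep S g x y)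
    (haw : wordVal (digit δ) B (a ++ letters w ++ b) < M) :
    Join (ReflTransGen (WordStep S f one g)) y (a ++ letters w ++ b) := by
  induction hn : 2 ^ wordVal δ B v + 2 ^ wordVal δ B w using Nat.strong_induction_on
    generalizing i v w a b with
  | _ n ih =>
    subst hn
    have hyM := (H.val_of_ruleStep hδ hg hxy).trans_le hxM
    rcases H.word_cases hg hv hw h with h | rfl |
      ⟨j, a', p, q, b', u, huv, hp, hq, hpq, hab, h₁, h₂⟩
    · rcases LenLexGt.total v w with hgt | rfl | hgt
      -- The word `x` may have value exactly `M`, where confluence is not yet available. This is why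
      -- `join_of_mem` does not apply and a peak of rules is used.
      · exact H.rule_peak hδ hg hM hxM hxy ⟨a, v, w, b, ⟨hv, hw, hgt, h⟩, hx, rfl⟩
      · exact join_symm (hx ▸ join_of_step (.inl hxy))
      · rw [Sym2.eq_swap] at h
        refine ⟨y, .refl, ReflTransGen.head (WordRule.step ⟨hw, hv, hgt, h⟩ a b) ?_⟩
        exact .single (hx ▸ .inl hxy)
    · exact join_symm (hx ▸ join_of_step (.inl hxy))
    have hu : u ≠ [] := by rcases huv with ⟨-, rfl⟩ | ⟨rfl, -⟩ <;> assumption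
    have f₁ := (flat_word_iff hg hp hq).mp (H.flat _ _ h₁)
    have f₂ := (flat_word_iff hg (by simp [hq]) hu).mp (H.flat _ _ h₂)
    have hlt := hδ.val_lt_of_gt f₁.1 f₁.2 hpq
    have hsize := size_lt (a := a') (b := b') (u := u) hδ hlt fun h =>
      hδ.val_lt_of_gt f₂.2 f₁.2 (hab h)
    have hlt' : wordVal (digit (F := F) δ) B (letters (a' ++ q ++ b')) <
        wordVal (digit (F := F) δ) B (letters (a' ++ p ++ b')) := by
      rw [val_letters, val_letters]
      exact wordVal_context hδ.lt hδ.pos hlt _ _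
    have hlt' := hδ.context hlt' a b
    rcases huv with ⟨rfl, rfl⟩ | ⟨rfl, rfl⟩
    · have hq' := hlt'.trans_le (hx ▸ hxM)
      have h₃ := ih _ hsize.1 hp hq h₁ (a ++ letters a') (letters b' ++ b) (by simpa using hx)
        (by simpa using hq') rfl
      refine (hM _ hq').join_trans (by simpa using h₃) ?_
      exact H.join_of_mem hδ hg hM (by simp [hq]) hu h₂ a b hq' haw
    -- The simplified side is the one below `M`. The induction reaches `a' q b'` from `y`, and `a' q
    -- b'` is then joined with `a' p b'` entirely below `M`.
    · have hq' := hlt'.trans haw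
      rw [Sym2.eq_swap] at h₂
      have h₃ := ih _ (by omega) hu (by simp [hq]) h₂ a b hx hq' rfl
      refine (hM _ hq').join_trans h₃ ?_
      have h₄ := H.join_of_mem hδ hg hM hp hq h₁ (a ++ letters a') (letters b' ++ b)
        (by simpa using haw) (by simpa using hq')
      refine join_symm ?_
      convert h₄ using 1 <;> simp

omit hδ [LinearOrder C₀] H in
/-- The position of a letter `c` relative to a block `v`. -/
theorem letter_cases {L : Type*} {a₁ v b₁ a₂ b₂ : List L} {c : L}
    (h : a₁ ++ v ++ b₁ = a₂ ++ [c] ++ b₂) :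
    (∃ k, a₁ = a₂ ++ [c] ++ k ∧ b₂ = k ++ v ++ b₁) ∨
    (∃ p q, v = p ++ [c] ++ q ∧ a₂ = a₁ ++ p ∧ b₂ = q ++ b₁) ∨
    (∃ k, b₁ = k ++ [c] ++ b₂ ∧ a₂ = a₁ ++ v ++ k) := by
  rw [List.append_assoc, List.append_assoc, List.append_eq_append_iff] at h
  rcases h with ⟨p, rfl, h⟩ | ⟨k, rfl, h⟩
  · rw [List.append_eq_append_iff] at h
    rcases h with ⟨k, rfl, h⟩ | ⟨k, rfl, h⟩
    · exact .inr (.inr ⟨k, by simp [h], by simp⟩)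
    · rcases k with _ | ⟨d, k⟩
      · exact .inr (.inr ⟨[], by simpa using h.symm, by simp⟩)
      · simp only [List.cons_append, List.nil_append, List.cons.injEq] at h
        obtain ⟨rfl, rfl⟩ := h
        exact .inr (.inl ⟨p, k, by simp, rfl, rfl⟩)
  · rcases k with _ | ⟨d, k⟩
    · simp only [List.nil_append] at h
      rcases v with _ | ⟨d, v⟩
      · exact .inr (.inr ⟨[], by simpa using h.symm, by simp⟩)
      · simp only [List.cons_append, List.nil_append, List.cons.injEq] at h
        obtain ⟨rfl, rfl⟩ := h
        exact .inr (.inl ⟨[], v, by simp, by simp, rfl⟩)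
    · simp only [List.cons_append, List.nil_append, List.cons.injEq] at h
      obtain ⟨rfl, rfl⟩ := h
      exact .inl ⟨k, by simp, by simp⟩

omit hδ in
theorem unit_mem {c : Cst C₀} (hc : c ∈ C) :
    s(bar f [c, .inl one], bar f [c]) ∈ S 0 ∧ s(bar f [.inl one, c], bar f [c]) ∈ S 0 :=
  ⟨H.units ⟨c, hc, .inl rfl⟩, H.units ⟨c, hc, .inr rfl⟩⟩

/-- Disjoint steps commute. If the deleted `1` lies in the left-hand side of the rule, it has a
neighbour `c` there, and the deletion amounts to using `c1 ≈ c` or `1c ≈ c`. These equations occur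
at stage 0 because `c ∈ C`, so the reduct under the rule can be joined with the result of deletion.
-/
theorem rule_unit_peak {M : ℕ}
    (hM : ∀ x, wordVal (digit δ) B x < M → Confl (WordStep S f one f) x)
    {x y z : List (Term F (Cst C₀))} (hx : wordVal (digit δ) B x ≤ M) (hy : RuleStep S f x y)
    (hz : UnitStep one x z) : Join (ReflTransGen (WordStep S f one f)) y z := by
  have hzx := H.val_of_wordStep hδ H.assoc (.inr ⟨rfl, hz⟩)
  have hy' := hy
  obtain ⟨a₁, v₁, w₁, b₁, hr₁, rfl, rfl⟩ := hy'
  obtain ⟨a₂, b₂, hne, he, rfl⟩ := hz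
  rcases letter_cases he with ⟨k, rfl, rfl⟩ | ⟨p, q, e₁, rfl, rfl⟩ | ⟨k, rfl, rfl⟩
  · refine ⟨a₂ ++ k ++ letters w₁ ++ b₁, .single
      (.inr ⟨rfl, a₂, k ++ letters w₁ ++ b₁, ?_, ?_, ?_⟩),
      .single (.inl ⟨a₂ ++ k, v₁, w₁, b₁, hr₁, ?_, ?_⟩)⟩ <;> simp [hr₁.2.1]
  · obtain ⟨p, q, rfl, h', rfl⟩ := letters_eq_append e₁
    obtain ⟨p, i, rfl, rfl, h''⟩ := letters_eq_append h'.symm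
    obtain rfl : i = [.inl one] := map_const_injective h''.symm
    have hC := (H.mem_of_wordRule H.assoc hr₁).1
    rcases p.eq_nil_or_concat' with rfl | ⟨p, c, rfl⟩
    · rcases q with _ | ⟨c, q⟩
      -- The left-hand side would be `1` alone, but `1` is minimal and rewrites to nothing smaller.
      · obtain ⟨d, rfl, hd⟩ := hr₁.2.2.1.eq_singleton hr₁.2.1
        rcases d with d | d
        · exact absurd hd (not_lt.mpr (H.minimal d))
        · exact hd.elim
      · refine (H.join_of_mem_of_ruleStep hδ H.assoc hM (by simp) (by simp)
          (H.unit_mem (hC c (by simp))).2 a₁ (letters q ++ b₁) (by simp) hx hy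
          (lt_of_lt_of_le (by simpa using hzx) hx)).imp ?_
        simp
    · refine (H.join_of_mem_of_ruleStep hδ H.assoc hM (by simp) (by simp)
        (H.unit_mem (hC c (by simp))).1 (a₁ ++ letters p) (letters q ++ b₁) (by simp) hx hy
        (lt_of_lt_of_le (by simpa using hzx) hx)).imp ?_
      simp
  · refine ⟨a₁ ++ letters w₁ ++ k ++ b₂, .single
      (.inr ⟨rfl, a₁ ++ letters w₁ ++ k, b₂, ?_, ?_, ?_⟩),
      .single (.inl ⟨a₁, v₁, w₁, k ++ b₂, hr₁, ?_, ?_⟩)⟩ <;> simp [hr₁.2.1]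

omit hδ H in
theorem unit_unit_peak {x y z : List (Term F (Cst C₀))} (hy : UnitStep one x y)
    (hz : UnitStep one x z) : Join (ReflTransGen (WordStep S f one f)) y z := by
  obtain ⟨a₁, b₁, hne₁, rfl, rfl⟩ := hy
  obtain ⟨a₂, b₂, hne₂, he, rfl⟩ := hz
  rcases letter_cases he with ⟨k, rfl, rfl⟩ | ⟨p, q, e₁, rfl, rfl⟩ | ⟨k, rfl, rfl⟩
  · by_cases h : a₂ ++ k ++ b₁ = []
    · simp only [List.append_eq_nil_iff] at h
      obtain ⟨⟨rfl, rfl⟩, rfl⟩ := h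
      simpa using join_refl _
    · refine ⟨a₂ ++ k ++ b₁, .single
      (.inr ⟨rfl, a₂, k ++ b₁, ?_, ?_, ?_⟩),
        .single (.inr ⟨rfl, a₂ ++ k, b₁, h, ?_, ?_⟩)⟩ <;> simp_all
  · obtain ⟨rfl, rfl⟩ : p = [] ∧ q = [] := by
      have := congrArg List.length e₁
      simp at this
      exact ⟨List.length_eq_zero_iff.mp (by omega), List.length_eq_zero_iff.mp (by omega)⟩
    simpa using join_refl _
  · by_cases h : a₁ ++ k ++ b₂ = []
    · simp only [List.append_eq_nil_iff] at h
      obtain ⟨⟨rfl, rfl⟩, rfl⟩ := h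
      simpa using join_refl _
    · refine ⟨a₁ ++ k ++ b₂, .single (.inr ⟨rfl, a₁ ++ k, b₂, h, ?_, ?_⟩),
        .single (.inr ⟨rfl, a₁, k ++ b₂, ?_, ?_, ?_⟩)⟩ <;> simp_all

/-- Rewriting of words of arguments is confluent. -/
theorem confl {g : F} (hg : g ∈ sig.assoc) (x : List (Term F (Cst C₀))) :
    Confl (WordStep S f one g) x := by
  refine confl_of_local (wordVal (digit δ) B) (fun _ _ => H.val_of_wordStep hδ hg) ?_ x
  intro x hx y z hy hz
  rcases hy with hy | ⟨rfl, hy⟩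
  · rcases hz with hz | ⟨rfl, hz⟩
    · exact H.rule_peak hδ hg hx le_rfl hy hz
    · exact H.rule_unit_peak hδ hx le_rfl hy hz
  · rcases hz with hz | ⟨-, hz⟩
    · exact join_symm (H.rule_unit_peak hδ hx le_rfl hz hy)
    · exact unit_unit_peak hy hz

/-- Equations between words that occur in the derivation can be joined in all contexts. -/
theorem join_of_mem' {g : F} (hg : g ∈ sig.assoc) {i : ℕ} {v w : List (Cst C₀)} (hv : v ≠ [])
    (hw : w ≠ []) (h : s(bar g v, bar g w) ∈ S i) :
    Join (ReflTransGen (WordStep S f one g)) (letters v) (letters w) := by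
  -- Confluence now holds everywhere, so any bound above the two words will do.
  have := H.join_of_mem hδ hg (M := max (wordVal (digit (F := F) δ) B (letters v))
    (wordVal (digit (F := F) δ) B (letters w)) + 1) (fun x _ => H.confl hδ hg x) hv hw h [] []
    (by simp) (by simp)
  simpa using this

end Completion

end Strings

end CCM

namespace CCM

open Relation

/-! ### The algebra of values -/

section Values

variable {F C₀ : Type u} [LinearOrder C₀]

open Classical in
/-- The word of arguments of `g` for a term, which is a letter unless it is headed by `g`. -/
noncomputable def wordOf {K : Type u} (g : F) : Term F K → List (Term F K)
  | .app g' ts => if g' = g then ts else [.app g' ts]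
  | .const c => [.const c]

/-- The term for a nonempty word of arguments of `g`. -/
def joinWord {K : Type u} (g : F) : List (Term F K) → Term F K
  | [t] => t
  | ts => .app g ts

theorem joinWord_of_two_le {K : Type u} {g : F} {x : List (Term F K)} (h : 2 ≤ x.length) :
    joinWord g x = .app g x := by
  match x, h with
  | _ :: _ :: _, _ => rfl

/-- Words to which no rewrite step applies. -/
def Irr (S : ℕ → Set (Eqn F (Cst C₀))) (f : F) (one : C₀) (g : F)
    (x : List (Term F (Cst C₀))) : Prop :=
  ∀ y, ¬ WordStep S f one g x y

open Classical in
/-- The normal form of a word of arguments of `g`. -/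
noncomputable def nfWord (S : ℕ → Set (Eqn F (Cst C₀))) (f : F) (one : C₀) (g : F)
    (x : List (Term F (Cst C₀))) : List (Term F (Cst C₀)) :=
  if h : ∃ y, ReflTransGen (WordStep S f one g) x y ∧ Irr S f one g y then h.choose else x

/-- The normal form of a constant. -/
noncomputable def hat (S : ℕ → Set (Eqn F (Cst C₀))) (f : F) (one : C₀) (c : Cst C₀) :
    Term F (Cst C₀) :=
  joinWord f (nfWord S f one f [.const c])

/-- Values: flat terms in normal form. -/
inductive Val (sig : Signature F) (S : ℕ → Set (Eqn F (Cst C₀))) (f : F) (one : C₀) :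
    Term F (Cst C₀) → Prop
  | const (c : Cst C₀) : Irr S f one f [.const c] → Val sig S f one (.const c)
  | app (h : F) (vs : List (Term F (Cst C₀))) : h ∉ sig.assoc → (∀ v ∈ vs, Val sig S f one v) →
      (∀ d, s(.app h vs, .const d) ∉ persisting S) → Val sig S f one (.app h vs)
  | word (g : F) (ws : List (Term F (Cst C₀))) : g ∈ sig.assoc → 2 ≤ ws.length →
      (∀ w ∈ ws, Val sig S f one w) → (∀ w ∈ ws, ∀ ss, w ≠ .app g ss) → Irr S f one g ws →
      Val sig S f one (.app g ws)

open Classical in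
/-- The operation of the symbol `g` on values. -/
noncomputable def valOp (sig : Signature F) (S : ℕ → Set (Eqn F (Cst C₀))) (f : F) (one : C₀)
    (g : F) (vs : List (Term F (Cst C₀))) : Term F (Cst C₀) :=
  if g ∈ sig.assoc then
    -- No symbol takes an empty argument list; this default only keeps the operation total on
    -- values.
    if vs = [] then .const (.inl one)
    else joinWord g (nfWord S f one g (vs.flatMap (wordOf g)))
  else if h : ∃ d, s(.app g vs, .const d) ∈ persisting S then hat S f one h.choose
  else .app g vs

variable {sig : Signature F} {f : F} {one : C₀} {C : Set (Cst C₀)}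
  {S : ℕ → Set (Eqn F (Cst C₀))}

/-- The letters that occur when words of arguments of `g` are rewritten. -/
def Letter (sig : Signature F) (S : ℕ → Set (Eqn F (Cst C₀))) (f : F) (one : C₀) (g : F)
    (w : Term F (Cst C₀)) : Prop :=
  (∃ c, w = .const c) ∨ Val sig S f one w ∧ ∀ ss, w ≠ .app g ss

theorem Letter.ne_app {g : F} {w : Term F (Cst C₀)} (h : Letter sig S f one g w)
    (ss : List (Term F (Cst C₀))) : w ≠ .app g ss := by
  rcases h with ⟨c, rfl⟩ | h
  · simp
  · exact h.2 ss

theorem wordOf_of_letter {g : F} {w : Term F (Cst C₀)} (h : Letter sig S f one g w) :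
    wordOf g w = [w] := by
  cases w with
  | const c => rfl
  | app g' ts =>
    rw [wordOf, if_neg]
    rintro rfl
    exact h.ne_app ts rfl

theorem wordOf_joinWord {g : F} {x : List (Term F (Cst C₀))}
    (h : ∀ w ∈ x, Letter sig S f one g w) (hx : x ≠ []) : wordOf g (joinWord g x) = x := by
  rcases exists_singleton_or_two_le hx with ⟨w, rfl⟩ | h2
  · exact wordOf_of_letter (h w (by simp))
  · rw [joinWord_of_two_le h2, wordOf, if_pos rfl]

theorem WordStep.context {g : F} {x y : List (Term F (Cst C₀))} (h : WordStep S f one g x y)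
    (a b : List (Term F (Cst C₀))) : WordStep S f one g (a ++ x ++ b) (a ++ y ++ b) := by
  rcases h with h | ⟨rfl, a', b', hne, rfl, rfl⟩
  · exact .inl (h.context a b)
  · refine .inr ⟨rfl, a ++ a', b' ++ b, ?_, by simp, by simp⟩
    simp only [ne_eq, List.append_eq_nil_iff] at hne ⊢
    tauto

theorem context_star {g : F} {x y : List (Term F (Cst C₀))}
    (h : ReflTransGen (WordStep S f one g) x y) (a b : List (Term F (Cst C₀))) :
    ReflTransGen (WordStep S f one g) (a ++ x ++ b) (a ++ y ++ b) := by
  induction h with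
  | refl => exact .refl
  | tail _ h ih => exact ih.tail (h.context a b)

theorem star_ne_nil {g : F} {x y : List (Term F (Cst C₀))}
    (h : ReflTransGen (WordStep S f one g) x y) (hx : x ≠ []) : y ≠ [] := by
  induction h with
  | refl => exact hx
  | tail _ h _ => exact h.ne_nil.2

theorem WordStep.letter {g : F} {x y : List (Term F (Cst C₀))} (h : WordStep S f one g x y)
    (hx : ∀ w ∈ x, Letter sig S f one g w) : ∀ w ∈ y, Letter sig S f one g w := by
  rcases h with ⟨a, v, w, b, hr, rfl, rfl⟩ | ⟨rfl, a, b, hne, rfl, rfl⟩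
  · intro t ht
    simp only [List.mem_append] at ht
    rcases ht with (ht | ht) | ht
    · exact hx t (by simp [ht])
    · obtain ⟨c, -, rfl⟩ := List.mem_map.mp ht
      exact .inl ⟨c, rfl⟩
    · exact hx t (by simp [ht])
  · intro t ht
    simp only [List.mem_append] at ht
    rcases ht with ht | ht
    · exact hx t (by simp [ht])
    · exact hx t (by simp [ht])

theorem star_letter {g : F} {x y : List (Term F (Cst C₀))}
    (h : ReflTransGen (WordStep S f one g) x y)
    (hx : ∀ w ∈ x, Letter sig S f one g w) : ∀ w ∈ y, Letter sig S f one g w := by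
  induction h with
  | refl => exact hx
  | tail _ h ih => exact h.letter ih

/-- The equation between two constants does not mention the symbol. This makes the normal form of a
constant the same for every associative symbol, although `hat` is computed with `f`. -/
theorem wordRule_singleton {g g' : F} {c d : Cst C₀} (h : WordRule S g [c] [d]) :
    WordRule S g' [c] [d] := by
  simpa [WordRule] using h

/-- Deletion of `1` needs a nonempty rest, so a one-letter word can only change by a rule between
constants. -/
theorem wordStep_singleton {g : F} {t : Term F (Cst C₀)} {y : List (Term F (Cst C₀))}
    (h : WordStep S f one g [t] y) :
    ∃ c d, t = .const c ∧ y = [.const d] ∧ WordRule S g [c] [d] := by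
  rcases h with ⟨a, v, w, b, hr, he, rfl⟩ | ⟨-, a, b, hne, he, -⟩
  · have h1 := congrArg List.length he
    have h2 := List.length_pos_iff.mpr hr.1
    simp only [List.length_append, List.length_map, List.length_cons, List.length_nil] at h1
    obtain rfl : a = [] := List.length_eq_zero_iff.mp (by omega)
    obtain rfl : b = [] := List.length_eq_zero_iff.mp (by omega)
    obtain ⟨c, rfl⟩ : ∃ c, v = [c] := List.length_eq_one_iff.mp (by simp at h1; omega)
    obtain ⟨d, rfl, _⟩ := hr.2.2.1.eq_singleton hr.2.1
    exact ⟨c, d, by simpa using he, by simp, hr⟩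
  · have h1 := congrArg List.length he
    have h2 := List.length_pos_iff.mpr hne
    simp at h1 h2
    omega

theorem wordStep_const {g g' : F} {c : Cst C₀} {y : List (Term F (Cst C₀))}
    (h : WordStep S f one g [.const c] y) : WordStep S f one g' [.const c] y := by
  obtain ⟨c', d, hc, rfl, hr⟩ := wordStep_singleton h
  obtain rfl := Term.const.inj hc
  simpa using (wordRule_singleton (g' := g') hr).step (f := f) (one := one) [] []

theorem irr_const {g g' : F} {c : Cst C₀} (h : Irr S f one g [.const c]) :
    Irr S f one g' [.const c] := fun y hy => h y (wordStep_const hy)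

theorem star_const {g g' : F} {c : Cst C₀} {y : List (Term F (Cst C₀))}
    (h : ReflTransGen (WordStep S f one g) [.const c] y) :
    ReflTransGen (WordStep S f one g') [.const c] y ∧ ∃ d, y = [.const d] := by
  induction h with
  | refl => exact ⟨.refl, c, rfl⟩
  | tail _ h ih =>
    obtain ⟨ih, d, rfl⟩ := ih
    obtain ⟨_, e, _, he, _⟩ := wordStep_singleton h
    exact ⟨ih.tail (wordStep_const h), e, he⟩

theorem Irr.of_context {g : F} {a x b : List (Term F (Cst C₀))}
    (h : Irr S f one g (a ++ x ++ b)) : Irr S f one g x := fun _ hy => h _ (hy.context a b)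

/-- Irreducibility passes to factors, so a constant in an irreducible word is itself irreducible and
hence a value. The other letters are values by assumption. -/
theorem val_joinWord {g : F} (hg : g ∈ sig.assoc) {x : List (Term F (Cst C₀))}
    (hx : ∀ w ∈ x, Letter sig S f one g w) (hirr : Irr S f one g x) (hne : x ≠ []) :
    Val sig S f one (joinWord g x) := by
  have hval : ∀ w ∈ x, Val sig S f one w := by
    intro w hw
    rcases hx w hw with ⟨c, rfl⟩ | h
    · obtain ⟨a, b, rfl⟩ := List.append_of_mem hw
      refine .const c (irr_const (g := g) (Irr.of_context (a := a) (b := b) ?_))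
      simpa using hirr
    · exact h.1
  rcases exists_singleton_or_two_le hne with ⟨w, rfl⟩ | h2
  · exact hval w (by simp)
  · rw [joinWord_of_two_le h2]
    exact .word g x hg h2 hval (fun w hw => (hx w hw).ne_app) hirr

/-- Every value, whatever its head, is recovered from an irreducible nonempty word of arguments of
`g`. A value not headed by `g` gives a one-letter word, and a non-constant letter admits no step on
its own. -/
theorem Val.wordOf {g : F} (hg : g ∈ sig.assoc) {v : Term F (Cst C₀)} (hv : Val sig S f one v) :
    wordOf g v ≠ [] ∧ (∀ w ∈ wordOf g v, Letter sig S f one g w) ∧ Irr S f one g (wordOf g v) ∧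
      joinWord g (wordOf g v) = v := by
  have key : (∀ ss, v ≠ .app g ss) → (∀ c, v ≠ .const c) → [v] ≠ [] ∧
      (∀ w ∈ [v], Letter sig S f one g w) ∧ Irr S f one g [v] ∧ joinWord g [v] = v := by
    refine fun h₁ h₂ => ⟨by simp, ?_, ?_, rfl⟩
    · simp only [List.mem_singleton, forall_eq]
      exact .inr ⟨hv, h₁⟩
    · intro y hy
      obtain ⟨c, _, hc, _⟩ := wordStep_singleton hy
      exact h₂ c hc
  cases hv with
  | const c hc =>
    refine ⟨by simp [CCM.wordOf], ?_, irr_const hc, rfl⟩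
    simp only [CCM.wordOf, List.mem_singleton, forall_eq]
    exact .inl ⟨c, rfl⟩
  | app h vs hh hvs hd =>
    have hne : h ≠ g := by rintro rfl; exact hh hg
    rw [CCM.wordOf, if_neg hne]
    exact key (by simp [hne]) (by simp)
  | word g' ws hg' h2 hws hne hirr =>
    by_cases h : g' = g
    · subst h
      rw [CCM.wordOf, if_pos rfl]
      exact ⟨by rintro rfl; simp at h2, fun w hw => .inr ⟨hws w hw, hne w hw⟩, hirr,
        joinWord_of_two_le h2⟩
    · rw [CCM.wordOf, if_neg h]
      exact key (by simp [h]) (by simp)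

namespace Completion

variable (H : Completion sig f one C S)
include H

theorem exists_isIndex : ∃ δ B, IsIndex C δ B := by
  obtain ⟨δ, B, h₁, h₂, h₃⟩ := exists_index H.finite
  exact ⟨δ, B, h₁, h₂, h₃⟩

section Word

variable {g : F} (hg : g ∈ sig.assoc)
include hg

theorem nfWord_spec (x : List (Term F (Cst C₀))) :
    ReflTransGen (WordStep S f one g) x (nfWord S f one g x) ∧
      Irr S f one g (nfWord S f one g x) := by
  obtain ⟨δ, B, hδ⟩ := H.exists_isIndex
  have h := exists_irreducible (wordVal (digit δ) B) (fun _ _ => H.val_of_wordStep hδ hg) x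
  have h : ∃ y, ReflTransGen (WordStep S f one g) x y ∧ Irr S f one g y := h
  rw [nfWord, dif_pos h]
  exact h.choose_spec

/-- Confluence makes the chosen normal form independent of the choice, hence an invariant of
joinability. -/
theorem nfWord_eq_of_join {x y : List (Term F (Cst C₀))}
    (h : Join (ReflTransGen (WordStep S f one g)) x y) :
    nfWord S f one g x = nfWord S f one g y := by
  obtain ⟨δ, B, hδ⟩ := H.exists_isIndex
  have hx := H.nfWord_spec hg x
  have hy := H.nfWord_spec hg y
  obtain ⟨z, h₁, h₂⟩ := (H.confl hδ hg y).join_trans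
    ((H.confl hδ hg x).join_trans (join_symm ⟨_, hx.1, .refl⟩) h) ⟨_, hy.1, .refl⟩
  rw [← reflTransGen_irreducible hx.2 h₁, reflTransGen_irreducible hy.2 h₂]

theorem nfWord_eq_of_star {x y : List (Term F (Cst C₀))}
    (h : ReflTransGen (WordStep S f one g) x y) :
    nfWord S f one g x = nfWord S f one g y :=
  H.nfWord_eq_of_join hg ⟨y, h, .refl⟩

theorem nfWord_of_irr {x : List (Term F (Cst C₀))} (h : Irr S f one g x) :
    nfWord S f one g x = x :=
  reflTransGen_irreducible h (H.nfWord_spec hg x).1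

theorem nfWord_context (a x b : List (Term F (Cst C₀))) :
    nfWord S f one g (a ++ nfWord S f one g x ++ b) = nfWord S f one g (a ++ x ++ b) :=
  (H.nfWord_eq_of_star hg (context_star (H.nfWord_spec hg x).1 a b)).symm

theorem val_nfWord {x : List (Term F (Cst C₀))} (hx : ∀ w ∈ x, Letter sig S f one g w)
    (hne : x ≠ []) : Val sig S f one (joinWord g (nfWord S f one g x)) := by
  have h := H.nfWord_spec hg x
  exact val_joinWord hg (star_letter h.1 hx) h.2 (star_ne_nil h.1 hne)

omit H in
theorem flatMap_letter {vs : List (Term F (Cst C₀))} (hvs : ∀ v ∈ vs, Val sig S f one v) :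
    ∀ w ∈ vs.flatMap (wordOf g), Letter sig S f one g w := by
  intro w hw
  obtain ⟨v, hv, hw⟩ := List.mem_flatMap.mp hw
  exact ((hvs v hv).wordOf hg).2.1 w hw

omit H in
theorem flatMap_ne_nil {vs : List (Term F (Cst C₀))} (hvs : ∀ v ∈ vs, Val sig S f one v)
    (hne : vs ≠ []) : vs.flatMap (wordOf g) ≠ [] := by
  obtain ⟨v, hv⟩ := List.exists_mem_of_ne_nil vs hne
  obtain ⟨w, hw⟩ := List.exists_mem_of_ne_nil _ ((hvs v hv).wordOf hg).1
  exact List.ne_nil_of_mem (List.mem_flatMap.mpr ⟨v, hv, hw⟩)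

theorem nfWord_const (c : Cst C₀) : nfWord S f one g [.const c] = nfWord S f one f [.const c] := by
  have h := H.nfWord_spec H.assoc [.const c]
  have h' := star_const (g' := g) h.1
  obtain ⟨d, hd⟩ := h'.2
  rw [H.nfWord_eq_of_star hg h'.1, H.nfWord_of_irr hg]
  rw [hd] at h ⊢
  exact irr_const h.2

end Word

theorem hat_spec (c : Cst C₀) : ∃ d, hat S f one c = .const d ∧ Irr S f one f [.const d] ∧
    ∀ g ∈ sig.assoc, nfWord S f one g [.const c] = [.const d] := by
  have h := H.nfWord_spec H.assoc [.const c]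
  obtain ⟨d, hd⟩ := (star_const (g' := f) h.1).2
  refine ⟨d, by simp [hat, hd, joinWord], hd ▸ h.2, fun g hg => ?_⟩
  rw [H.nfWord_const hg, hd]

theorem val_hat (c : Cst C₀) : Val sig S f one (hat S f one c) := by
  obtain ⟨d, hd, h, -⟩ := H.hat_spec c
  rw [hd]
  exact .const d h

theorem hat_of_irr {c : Cst C₀} (h : Irr S f one f [.const c]) : hat S f one c = .const c := by
  rw [hat, H.nfWord_of_irr H.assoc h, joinWord]

theorem irr_one : Irr S f one f [.const (.inl one)] := by
  intro y hy
  obtain ⟨c, d, hc, rfl, hr⟩ := wordStep_singleton hy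
  obtain rfl := Term.const.inj hc
  have := hr.2.2.1
  rw [lenLexGt_singleton] at this
  rcases d with d | d
  · exact absurd this (not_lt.mpr (H.minimal d))
  · exact this

theorem hat_one : hat S f one (.inl one) = .const (.inl one) := H.hat_of_irr H.irr_one

theorem val_valOp (g : F) {vs : List (Term F (Cst C₀))} (hvs : ∀ v ∈ vs, Val sig S f one v) :
    Val sig S f one (valOp sig S f one g vs) := by
  rw [valOp]
  split_ifs with hg hne hd
  · exact .const _ H.irr_one
  · exact H.val_nfWord hg (flatMap_letter hg hvs) (flatMap_ne_nil hg hvs hne)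
  · exact H.val_hat _
  · exact .app g vs hg hvs fun d h => hd ⟨d, h⟩

omit H in
theorem valOp_assoc {g : F} (hg : g ∈ sig.assoc) {vs : List (Term F (Cst C₀))} (hne : vs ≠ []) :
    valOp sig S f one g vs = joinWord g (nfWord S f one g (vs.flatMap (wordOf g))) := by
  rw [valOp, if_pos hg, if_neg hne]

/-- The algebra of values. -/
noncomputable def valueAlg : Alg F (Cst C₀) where
  carrier := {v : Term F (Cst C₀) // Val sig S f one v}
  cst c := ⟨hat S f one c, H.val_hat c⟩
  op g vs := ⟨valOp sig S f one g (vs.map (·.1)), H.val_valOp g (by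
    simp only [List.mem_map]
    rintro _ ⟨v, -, rfl⟩
    exact v.2)⟩

/-- The value given by an element of the algebra of values. -/
noncomputable def term (a : H.valueAlg.carrier) : Term F (Cst C₀) := a.1

theorem term_injective : Function.Injective H.term := fun _ _ h => Subtype.ext h

theorem val_term (a : H.valueAlg.carrier) : Val sig S f one (H.term a) := a.2

theorem term_cst (c : Cst C₀) : H.term (H.valueAlg.cst c) = hat S f one c := rfl

theorem term_op (g : F) (as : List H.valueAlg.carrier) :
    H.term (H.valueAlg.op g as) = valOp sig S f one g (as.map H.term) := rfl

/-- The value of a term. -/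
noncomputable def value (t : Term F (Cst C₀)) : Term F (Cst C₀) := H.term (H.valueAlg.eval t)

theorem val_value (t : Term F (Cst C₀)) : Val sig S f one (H.value t) := H.val_term _

theorem value_const (c : Cst C₀) : H.value (.const c) = hat S f one c := by
  rw [value, Alg.eval_const, term_cst]

theorem value_app (g : F) (ts : List (Term F (Cst C₀))) :
    H.value (.app g ts) = valOp sig S f one g (ts.map H.value) := by
  rw [value, Alg.eval_app, term_op, List.map_map]
  rfl

/-- Associativity holds because normalizing a factor before its context does not change the normal
form of the whole word. For the unit laws, the operation puts a letter `1` next to an irreducible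
nonempty word, and one deletion returns that word. -/
theorem valueAlg_modelsMonoid : H.valueAlg.ModelsMonoid sig f (.inl one) := by
  have hval (vs : List H.valueAlg.carrier) : ∀ v ∈ vs.map H.term, Val sig S f one v := by
    simp only [List.mem_map]
    rintro _ ⟨v, -, rfl⟩
    exact H.val_term v
  have key (a : H.valueAlg.carrier) {x : List (Term F (Cst C₀))}
      (h : WordStep S f one f x (wordOf f (H.term a))) :
      joinWord f (nfWord S f one f x) = H.term a := by
    obtain ⟨-, -, hirr, hj⟩ := (H.val_term a).wordOf H.assoc
    rw [H.nfWord_eq_of_star H.assoc (.single h), H.nfWord_of_irr H.assoc hirr, hj]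
  refine ⟨fun g hg xs ys zs hy _ => H.term_injective ?_, fun a => H.term_injective ?_,
    fun a => H.term_injective ?_⟩
  · have hne' : ys ≠ [] := by rintro rfl; simp at hy
    have hne : ys.map H.term ≠ [] := by simpa using hne'
    have hl := flatMap_letter hg (hval ys)
    have hn := flatMap_ne_nil hg (hval ys) hne
    have h := H.nfWord_spec hg ((ys.map H.term).flatMap (wordOf g))
    simp only [term_op, List.map_append, List.map_cons]
    rw [valOp_assoc hg hne, valOp_assoc hg (by simp), valOp_assoc hg (by simp [hne'])]
    simp only [List.flatMap_append, List.flatMap_cons]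
    rw [wordOf_joinWord (star_letter h.1 hl) (star_ne_nil h.1 hn), ← List.append_assoc,
      H.nfWord_context hg]
  · rw [term_op, List.map_cons, List.map_singleton, term_cst, H.hat_one,
      valOp_assoc H.assoc (by simp)]
    refine key a (.inr ⟨rfl, wordOf f (H.term a), [], ?_, by simp [wordOf], by simp⟩)
    simpa using ((H.val_term a).wordOf H.assoc).1
  · rw [term_op, List.map_cons, List.map_singleton, term_cst, H.hat_one,
      valOp_assoc H.assoc (by simp)]
    refine key a (.inr ⟨rfl, [], wordOf f (H.term a), ?_, by simp [wordOf], by simp⟩)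
    simpa using ((H.val_term a).wordOf H.assoc).1

theorem letters_star {g : F} (hg : g ∈ sig.assoc) (v : List (Cst C₀))
    (a : List (Term F (Cst C₀))) :
    ReflTransGen (WordStep S f one g) (a ++ letters v) (a ++ v.map (hat S f one)) := by
  induction v generalizing a with
  | nil => exact .refl
  | cons c v ih =>
    obtain ⟨d, hd, -, hnf⟩ := H.hat_spec c
    have h := (H.nfWord_spec hg [.const c]).1
    rw [hnf g hg, ← hd] at h
    have h₁ := context_star h a (letters v)
    have h₂ := ih (a ++ [hat S f one c])
    simp only [List.append_assoc, List.singleton_append] at h₁ h₂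
    exact h₁.trans h₂

/-- Evaluation first replaces each constant by its normal form. These replacements are themselves
word steps, so the final normal form is that of the original word. -/
theorem value_bar {g : F} (hg : g ∈ sig.assoc) {v : List (Cst C₀)} (hv : v ≠ []) :
    H.value (bar g v) = joinWord g (nfWord S f one g (letters v)) := by
  rcases exists_singleton_or_two_le hv with ⟨c, rfl⟩ | h2
  · obtain ⟨d, hd, -, hnf⟩ := H.hat_spec c
    rw [bar_singleton, H.value_const, hd]
    simp [hnf g hg, joinWord]
  · have hf : ((letters v).map H.value).flatMap (wordOf g) = v.map (hat S f one) := by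
      rw [List.map_map, List.flatMap_map]
      have : ∀ c, wordOf g ((H.value ∘ Term.const) c) = [hat S f one c] := fun c => by
        obtain ⟨d, hd, -⟩ := H.hat_spec c
        simp [H.value_const, hd, wordOf]
      simp only [this, List.map_eq_flatMap]
    rw [bar_of_two_le h2, str, H.value_app, valOp_assoc hg (by simpa using hv), hf,
      H.nfWord_eq_of_star hg (x := letters v) (by simpa using H.letters_star hg v [])]

/-- Both words are joinable even if the equation does not persist, so their normal forms agree. -/
theorem value_eq_of_word {g : F} (hg : g ∈ sig.assoc) {v w : List (Cst C₀)} (hv : v ≠ [])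
    (hw : w ≠ []) {i : ℕ} (h : s(bar g v, bar g w) ∈ S i) :
    H.value (bar g v) = H.value (bar g w) := by
  obtain ⟨δ, B, hδ⟩ := H.exists_isIndex
  rw [H.value_bar hg hv, H.value_bar hg hw,
    H.nfWord_eq_of_join hg (H.join_of_mem' hδ hg hv hw h)]

theorem value_eq_of_const {c d : Cst C₀} {i : ℕ} (h : s(.const c, .const d) ∈ S i) :
    H.value (.const c) = H.value (.const d) :=
  H.value_eq_of_word H.assoc (v := [c]) (w := [d]) (by simp) (by simp) h

/-- D-flat rules are left-reduced. -/
theorem irr_of_dflat {h : F} {cs : List (Cst C₀)} {e : Cst C₀}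
    (he : s(str h cs, .const e) ∈ persisting S) : ∀ c ∈ cs, Irr S f one f [.const c] := by
  intro c hc y hy
  obtain ⟨a, b, rfl⟩ := List.append_of_mem hc
  obtain ⟨c', d, hc', rfl, -, -, hgt, hr⟩ := wordStep_singleton hy
  obtain rfl := Term.const.inj hc'
  rw [lenLexGt_singleton] at hgt
  have hτ : IsInference sig
      { prem := {s(str h (a ++ c :: b), .const e), s(.const c, .const d)}
        del := {s(str h (a ++ c :: b), .const e)}
        add := {s(str h (a ++ d :: b), .const e)} } := by
    refine .collapse _ _ _ _ _ ?_ (.app_const ..) (.const hgt) (by simp) (by simp [str])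
    simp only [str, List.map_append, List.map_cons]
    exact .arg _ _ _ .root
  have := (H.applied_of_persisting hτ (Set.toFinite _) (by
    rintro _ (rfl | rfl)
    · exact he
    · exact hr)).2 _ (Set.mem_insert _ _) rfl
  simp only [Set.mem_singleton_iff, Sym2.congr_left, str_inj, true_and,
    List.append_cancel_left_eq, List.cons.injEq, and_true] at this
  subst this
  exact CstGt.irrefl _ hgt

/-- D-flat rules with the same left hand side coincide. -/
theorem dflat_unique {h : F} (hh : h ∉ sig.assoc) {cs : List (Cst C₀)} {c d : Cst C₀}
    (hc : s(str h cs, .const c) ∈ persisting S) (hd : s(str h cs, .const d) ∈ persisting S) :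
    c = d := by
  by_contra hne
  wlog hgt : CstGt c d generalizing c d
  · exact this hd hc (Ne.symm hne) (((CstGt.total c d).resolve_left hgt).resolve_left hne)
  have hτ : IsInference sig
      { prem := {s(str h cs, .const c), s(str h cs, .const d)}
        del := {s(str h cs, .const c)}
        add := {s(.const d, .const c)} } := by
    refine .collapse _ _ _ _ _ .root (.app_const ..) (.app_const ..) ?_ fun _ => .const hgt
    rintro g hg ts he
    simp only [str, Term.app.injEq] at he
    exact hh (he.1 ▸ hg)
  have := (H.applied_of_persisting hτ (Set.toFinite _) (by
    rintro _ (rfl | rfl)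
    · exact hc
    · exact hd)).2 _ (Set.mem_insert _ _) rfl
  simp [str] at this

/-- The induction measure is the size of the argument word plus that of the constant. A persisting
equation is the one the operation itself uses. A deleted one was replaced through a smaller D-flat
equation together with an equation between constants, which is already known to hold. -/
theorem value_eq_of_dflat {h : F} (hh : h ∉ sig.assoc) {cs : List (Cst C₀)} {c : Cst C₀} {i : ℕ}
    (he : s(str h cs, .const c) ∈ S i) : H.value (str h cs) = H.value (.const c) := by
  obtain ⟨δ, B, hδ⟩ := H.exists_isIndex
  induction hn : wordVal δ B cs + δ c using Nat.strong_induction_on generalizing i cs c with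
  | _ n ih =>
    subst hn
    have hC := (flat_dflat_iff hh).mp (H.flat i _ he)
    rcases H.persisting_or_deleted he with hp | ⟨j, τ, hτ, hprem, hadd, hdel⟩
    -- The arguments of a persisting left-hand side are in normal form, so evaluation leaves them
    -- unchanged. Uniqueness of the right-hand side identifies the constant chosen by the operation
    -- with `c`.
    · have hirr := H.irr_of_dflat hp
      have hm : (letters cs).map H.value = letters cs := by
        simp only [List.map_map]
        refine List.map_congr_left fun c hc => ?_
        simp [H.value_const, H.hat_of_irr (hirr c hc)]
      have hex : ∃ d, s(.app h (letters cs), .const d) ∈ persisting S := ⟨c, hp⟩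
      rw [str, H.value_app, hm, valOp, if_neg hh, dif_pos hex,
        H.dflat_unique hh hp hex.choose_spec, H.value_const]
    cases hτ with
    | deduce => exact absurd hdel (Set.notMem_empty _)
    | word g a p q b w hg hp hq hw hpq hab =>
      simp only [Set.mem_singleton_iff, Sym2.eq_iff] at hdel
      rcases hdel with ⟨e, -⟩ | ⟨e, -⟩
      · exact absurd e.symm (bar_ne_str_nonassoc hg hh (by simp [hp]))
      · exact absurd e.symm (bar_ne_str_nonassoc hg hh hw)
    | root h' cs' c' d hh' hcd =>
      simp only [Set.mem_singleton_iff, Sym2.eq_iff, str_inj, Term.const.injEq] at hdel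
      rcases hdel with ⟨⟨rfl, rfl⟩, rfl⟩ | ⟨e, -⟩
      · have h₁ : s(str h cs, .const d) ∈ S j := hprem (Set.mem_insert_of_mem _ rfl)
        have h₂ : s(.const d, .const c) ∈ S (j + 1) := hadd rfl
        have := hδ.mono c hC.2.2 d ((flat_dflat_iff hh).mp (H.flat _ _ h₁)).2.2 hcd
        rw [ih _ (by omega) h₁ rfl, H.value_eq_of_const h₂]
      · simp [str] at e
    | arg h' a b c' d e hh' hcd =>
      simp only [Set.mem_singleton_iff, Sym2.eq_iff, str_inj, Term.const.injEq] at hdel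
      rcases hdel with ⟨⟨rfl, rfl⟩, rfl⟩ | ⟨e, -⟩
      · have h₁ : s(.const c', .const d) ∈ S j := hprem (Set.mem_insert_of_mem _ rfl)
        have h₂ : s(str h (a ++ [d] ++ b), .const c) ∈ S (j + 1) := hadd rfl
        have hd := ((flat_const_iff H.assoc).mp (H.flat _ _ h₁))
        have h₃ : wordVal δ B (a ++ [d] ++ b) < wordVal δ B (a ++ [c'] ++ b) :=
          wordVal_context hδ.lt hδ.pos (by simpa [wordVal] using hδ.mono c' hd.1 d hd.2 hcd) a b
        rw [← ih _ (by omega) h₂ rfl]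
        simp [str, H.value_app, H.value_eq_of_const h₁]
      · simp [str] at e
    | compose h' cs' c' d hh' hcd =>
      simp only [Set.mem_singleton_iff, Sym2.eq_iff, str_inj, Term.const.injEq] at hdel
      rcases hdel with ⟨⟨rfl, rfl⟩, rfl⟩ | ⟨e, -⟩
      · have h₁ : s(.const c, .const d) ∈ S j := hprem (Set.mem_insert_of_mem _ rfl)
        have h₂ : s(str h cs, .const d) ∈ S (j + 1) := hadd rfl
        have := hδ.mono c hC.2.2 d ((flat_const_iff H.assoc).mp (H.flat _ _ h₁)).2 hcd
        rw [ih _ (by omega) h₂ rfl, H.value_eq_of_const h₁]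
      · simp [str] at e
    | delete s =>
      simp only [Set.mem_singleton_iff, Sym2.eq_iff] at hdel
      rcases hdel with ⟨rfl, e⟩ | ⟨rfl, e⟩ <;> simp [str] at e

/-- The algebra of values is a model of all equations that occur in the derivation. -/
theorem valueAlg_modelsEqns (i : ℕ) : H.valueAlg.ModelsEqns (S i) := by
  intro s t h
  refine H.term_injective ?_
  change H.value s = H.value t
  rcases (H.flat i _ h).cases with ⟨g, hg, v, w, hv, hw, rfl, rfl⟩ | ⟨k, hk, cs, c, rfl, rfl⟩ |
    ⟨k, hk, cs, c, rfl, rfl⟩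
  · exact H.value_eq_of_word hg hv hw h
  · exact H.value_eq_of_dflat hk h
  · exact (H.value_eq_of_dflat hk (Sym2.eq_swap ▸ h)).symm

end Completion

end Values

end CCM

namespace CCM

open Relation

/-! ### Rewriting modulo associativity -/

section RewriteModA

variable {F K : Type u} {sig : Signature F} {C : Set K} {R : Term F K → Term F K → Prop}

theorem AEq.rewrite {s s' t : Term F K} (h : AEq sig C s s') (h' : RewriteModA sig C R s' t) :
    RewriteModA sig C R s t := by
  obtain ⟨u, v, l, r, h₁, h₂⟩ := h'
  exact ⟨u, v, l, r, h.trans h₁, h₂⟩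

theorem RewriteModA.aEq {s t t' : Term F K} (h : RewriteModA sig C R s t)
    (h' : AEq sig C t t') : RewriteModA sig C R s t' := by
  obtain ⟨u, v, l, r, h₁, h₂, h₃, h₄⟩ := h
  exact ⟨u, v, l, r, h₁, h₂, h₃, h₄.trans h'⟩

theorem RewriteModA.ground {s t : Term F K} (h : RewriteModA sig C R s t) :
    Ground sig C s ∧ Ground sig C t := by
  obtain ⟨_, _, _, _, h₁, _, _, h₄⟩ := h
  exact ⟨h₁.ground.1, h₄.ground.2⟩

theorem RewriteModA.context {g : F} {xs zs : List (Term F K)} {s t : Term F K}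
    (h : RewriteModA sig C R s t) (hs : Ground sig C (.app g (xs ++ s :: zs))) :
    RewriteModA sig C R (.app g (xs ++ s :: zs)) (.app g (xs ++ t :: zs)) := by
  obtain ⟨u, v, l, r, h₁, h₂, h₃, h₄⟩ := h
  refine ⟨_, _, l, r, h₁.congr_arg hs, h₂, .arg g xs zs h₃, ?_⟩
  exact h₄.congr_arg (hs.replace_arg h₄.ground.1)

/-- Rewriting modulo associativity, in any number of steps. -/
def Reduces (sig : Signature F) (C : Set K) (R : Term F K → Term F K → Prop)
    (s t : Term F K) : Prop :=
  AEq sig C s t ∨ TransGen (RewriteModA sig C R) s t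

theorem AEq.transGen {s s' t : Term F K} (h : AEq sig C s s')
    (h' : TransGen (RewriteModA sig C R) s' t) : TransGen (RewriteModA sig C R) s t := by
  obtain ⟨u, h₁, h₂⟩ := TransGen.head'_iff.mp h'
  exact TransGen.head'_iff.mpr ⟨u, h.rewrite h₁, h₂⟩

theorem transGen_aEq {s t t' : Term F K} (h : TransGen (RewriteModA sig C R) s t)
    (h' : AEq sig C t t') : TransGen (RewriteModA sig C R) s t' := by
  obtain ⟨u, h₁, h₂⟩ := TransGen.tail'_iff.mp h
  exact TransGen.tail'_iff.mpr ⟨u, h₁, h₂.aEq h'⟩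

theorem Reduces.trans {s t r : Term F K} (h₁ : Reduces sig C R s t) (h₂ : Reduces sig C R t r) :
    Reduces sig C R s r := by
  rcases h₁ with h₁ | h₁ <;> rcases h₂ with h₂ | h₂
  · exact .inl (CongClosure.trans h₁ h₂)
  · exact .inr (h₁.transGen h₂)
  · exact .inr (transGen_aEq h₁ h₂)
  · exact .inr (h₁.trans h₂)

theorem Reduces.refl {s : Term F K} (hs : Ground sig C s) : Reduces sig C R s s :=
  .inl (.refl hs)

theorem RewriteModA.reduces {s t : Term F K} (h : RewriteModA sig C R s t) :
    Reduces sig C R s t := .inr (.single h)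

theorem transGen_ground {s t : Term F K} (h : TransGen (RewriteModA sig C R) s t) :
    Ground sig C t := by
  obtain ⟨u, _, h₂⟩ := TransGen.tail'_iff.mp h
  exact h₂.ground.2

theorem Reduces.ground {s t : Term F K} (h : Reduces sig C R s t) : Ground sig C t := by
  rcases h with h | h
  · exact h.ground.2
  · exact transGen_ground h

theorem Reduces.context {g : F} {xs zs : List (Term F K)} {s t : Term F K}
    (h : Reduces sig C R s t) (hs : Ground sig C (.app g (xs ++ s :: zs))) :
    Reduces sig C R (.app g (xs ++ s :: zs)) (.app g (xs ++ t :: zs)) := by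
  rcases h with h | h
  · exact .inl (h.congr_arg hs)
  · induction h with
    | single h => exact (h.context hs).reduces
    | tail h₁ h₂ ih => exact ih.trans (h₂.context (hs.replace_arg (transGen_ground h₁))).reduces

theorem Reduces.map {g : F} {φ : Term F K → Term F K} {ts : List (Term F K)}
    (h : ∀ t ∈ ts, Reduces sig C R t (φ t)) (xs : List (Term F K))
    (hs : Ground sig C (.app g (xs ++ ts))) :
    Reduces sig C R (.app g (xs ++ ts)) (.app g (xs ++ ts.map φ)) := by
  induction ts generalizing xs with
  | nil => exact .refl hs
  | cons t ts ih =>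
    have ht := h t (by simp)
    have h₁ := ht.context hs
    have h₂ := ih (fun t ht => h t (by simp [ht])) (xs ++ [φ t])
      (by simpa using hs.replace_arg ht.ground)
    simp only [List.append_assoc, List.singleton_append] at h₂
    exact h₁.trans h₂

theorem Reduces.of_irreducible {s t : Term F K} (h : Reduces sig C R s t)
    (hs : ∀ v, ¬ RewriteModA sig C R s v) : AEq sig C s t := by
  rcases h with h | h
  · exact h
  · obtain ⟨u, h₁, _⟩ := TransGen.head'_iff.mp h
    exact absurd h₁ (hs u)

theorem IsNormalFormOf.ground {s u : Term F K} (h : IsNormalFormOf sig C R s u)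
    (hs : Ground sig C s) : Ground sig C u := by
  rcases reflTransGen_iff_eq_or_transGen.mp h.1 with rfl | h'
  · exact hs
  · exact transGen_ground h'

end RewriteModA

/-! ### Argument words and associativity -/

section Words

variable {F K : Type u} {sig : Signature F} {C : Set K} {R : Term F K → Term F K → Prop}
  {g : F} (hg : g ∈ sig.assoc)

include hg

theorem ground_joinWord {x : List (Term F K)} (hx : x ≠ []) :
    Ground sig C (joinWord g x) ↔ ∀ w ∈ x, Ground sig C w := by
  rcases exists_singleton_or_two_le hx with ⟨c, rfl⟩ | h2
  · simp [joinWord]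
  · rw [joinWord_of_two_le h2, Ground.app_iff, sig.validArity_assoc hg]
    simp [h2]

theorem aEq_joinWord {a ys b : List (Term F K)} (hy : ys ≠ [])
    (h : ∀ w ∈ a ++ ys ++ b, Ground sig C w) :
    AEq sig C (joinWord g (a ++ joinWord g ys :: b)) (joinWord g (a ++ ys ++ b)) := by
  have hgr : Ground sig C (joinWord g (a ++ ys ++ b)) :=
    (ground_joinWord hg (by simp [hy])).mpr h
  rcases exists_singleton_or_two_le hy with ⟨y, rfl⟩ | h2
  · simp only [List.append_assoc, List.singleton_append] at hgr
    rw [List.append_assoc, List.singleton_append]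
    exact .refl hgr
  · by_cases hab : a ++ b = []
    · obtain ⟨rfl, rfl⟩ := List.append_eq_nil_iff.mp hab
      simp only [List.nil_append, List.append_nil] at hgr ⊢
      exact .refl hgr
    · have hl := List.length_pos_iff.mpr hab
      simp only [List.length_append] at hl
      rw [joinWord_of_two_le (x := a ++ ys ++ b) (by simp; omega),
        joinWord_of_two_le (x := a ++ _ :: b) (by simp; omega), joinWord_of_two_le h2]
      refine .base (.mk g a ys b hg ?_)
      rw [Ground.app_iff, sig.validArity_assoc hg]
      refine ⟨by simp; omega, fun t ht => ?_⟩
      simp only [List.mem_append, List.mem_cons] at ht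
      rcases ht with ht | rfl | ht
      · exact h t (by simp [ht])
      · rw [Ground.app_iff, sig.validArity_assoc hg]
        exact ⟨h2, fun t ht => h t (by simp [ht])⟩
      · exact h t (by simp [ht])

omit hg in
theorem replaceOne_joinWord (g : F) (a b : List (Term F K)) (l r : Term F K) :
    ReplaceOne l r (joinWord g (a ++ l :: b)) (joinWord g (a ++ r :: b)) := by
  by_cases hab : a ++ b = []
  · obtain ⟨rfl, rfl⟩ := List.append_eq_nil_iff.mp hab
    exact .root
  · have hl := List.length_pos_iff.mpr hab
    simp only [List.length_append] at hl
    rw [joinWord_of_two_le (by simp; omega), joinWord_of_two_le (by simp; omega)]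
    exact .arg g a b .root

/-- Associativity allows a factor to be grouped into a subterm, replaced there, and flattened back,
so one word step is one R/A-step. -/
theorem rewriteModA_block {a ys zs b : List (Term F K)} (hy : ys ≠ []) (hz : zs ≠ [])
    (hR : R (joinWord g ys) (joinWord g zs)) (h₁ : ∀ w ∈ a ++ ys ++ b, Ground sig C w)
    (h₂ : ∀ w ∈ a ++ zs ++ b, Ground sig C w) :
    RewriteModA sig C R (joinWord g (a ++ ys ++ b)) (joinWord g (a ++ zs ++ b)) :=
  ⟨_, _, _, _, (aEq_joinWord hg hy h₁).symm, hR, replaceOne_joinWord g a b _ _,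
    aEq_joinWord hg hz h₂⟩

theorem wordOf_ground {v : Term F K} (hv : Ground sig C v) :
    wordOf g v ≠ [] ∧ joinWord g (wordOf g v) = v := by
  cases v with
  | const c => exact ⟨by simp [wordOf], rfl⟩
  | app g' ts =>
    by_cases h : g' = g
    · subst h
      rw [Ground.app_iff, sig.validArity_assoc hg] at hv
      rw [wordOf, if_pos rfl]
      exact ⟨by rintro rfl; simp at hv, joinWord_of_two_le hv.1⟩
    · rw [wordOf, if_neg h]
      exact ⟨by simp, rfl⟩

/-- The nested arguments are flattened one at a time; `xs` accumulates the part already flattened.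
-/
theorem aEq_flatMap (vs xs : List (Term F K)) (hne : xs ++ vs ≠ [])
    (h : ∀ w ∈ xs ++ vs, Ground sig C w) :
    AEq sig C (joinWord g (xs ++ vs)) (joinWord g (xs ++ vs.flatMap (wordOf g))) ∧
      ∀ w ∈ xs ++ vs.flatMap (wordOf g), Ground sig C w := by
  induction vs generalizing xs with
  | nil =>
    refine ⟨.refl ((ground_joinWord hg (by simpa using hne)).mpr ?_), by simpa using h⟩
    simpa using h
  | cons v vs ih =>
    obtain ⟨hn, hj⟩ := wordOf_ground hg (h v (by simp))
    have hv : ∀ w ∈ wordOf g v, Ground sig C w := by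
      have := h v (by simp)
      rwa [← hj, ground_joinWord hg hn] at this
    have h' : ∀ w ∈ xs ++ wordOf g v ++ vs, Ground sig C w := by
      intro w hw
      simp only [List.mem_append] at hw
      rcases hw with (hw | hw) | hw
      · exact h w (by simp [hw])
      · exact hv w hw
      · exact h w (by simp [hw])
    have h₁ := aEq_joinWord hg (a := xs) (b := vs) hn h'
    have h₂ := ih (xs ++ wordOf g v) (by simp [hn]) h'
    rw [hj] at h₁
    rw [List.flatMap_cons, ← List.append_assoc]
    exact ⟨h₁.trans h₂.1, h₂.2⟩

end Words

/-! ### Termination of rewriting modulo associativity -/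

section Measure

variable {F C₀ : Type u}

open Classical in
/-- The number of constants and non-associative symbols of a term, and its word of constants. -/
noncomputable def sizeAlg (sig : Signature F) : Alg F (Cst C₀) where
  carrier := ULift.{u} ℕ × List (Cst C₀)
  cst c := (⟨1⟩, [c])
  op g as := (⟨(as.map fun a => a.1.down).sum + if g ∈ sig.assoc then 0 else 1⟩,
    (as.map Prod.snd).flatten)

/-- The number of constants and non-associative symbols of a term. -/
noncomputable def weight (sig : Signature F) (t : Term F (Cst C₀)) : ℕ :=
  ((sizeAlg sig).eval t).1.down

/-- The constants of a term, from left to right. -/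
noncomputable def leaves (sig : Signature F) (t : Term F (Cst C₀)) : List (Cst C₀) :=
  ((sizeAlg sig).eval t).2

variable {sig : Signature F}

open Classical in
theorem weight_app (g : F) (ts : List (Term F (Cst C₀))) :
    weight sig (.app g ts) = (ts.map (weight sig)).sum + if g ∈ sig.assoc then 0 else 1 := by
  rw [weight, Alg.eval_app]
  simp only [sizeAlg, List.map_map]
  rfl

theorem leaves_app (g : F) (ts : List (Term F (Cst C₀))) :
    leaves sig (.app g ts) = (ts.map (leaves sig)).flatten := by
  rw [leaves, Alg.eval_app]
  simp only [sizeAlg, List.map_map]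
  rfl

theorem weight_const (c : Cst C₀) : weight sig (.const c) = 1 := by
  rw [weight, Alg.eval_const]; rfl

theorem leaves_const (c : Cst C₀) : leaves sig (.const c) = [c] := by
  rw [leaves, Alg.eval_const]; rfl

/-- Flattening changes only the number and grouping of associative symbols, which the weight does
not count. Weight and leaves are defined as an evaluation, so checking instances of the axioms is
enough. -/
theorem size_eq_of_aEq {C : Set (Cst C₀)} {s t : Term F (Cst C₀)} (h : AEq sig C s t) :
    weight sig s = weight sig t ∧ leaves sig s = leaves sig t := by
  have : (sizeAlg sig).eval s = (sizeAlg sig).eval t := by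
    refine Alg.eval_eq_of_congClosure ?_ h
    rintro _ _ ⟨g, xs, ys, zs, hg, _⟩
    refine Prod.ext (ULift.ext _ _ ?_) ?_
    · change weight sig _ = weight sig _
      simp [weight_app, hg]
    · change leaves sig _ = leaves sig _
      simp [leaves_app]
  simp [weight, leaves, this]

theorem weight_bar {g : F} (hg : g ∈ sig.assoc) {v : List (Cst C₀)} (hv : v ≠ []) :
    weight sig (bar g v) = v.length := by
  rcases exists_singleton_or_two_le hv with ⟨c, rfl⟩ | h2
  · simp [weight_const]
  · rw [bar_of_two_le h2, str, weight_app]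
    simp [hg, Function.comp_def, weight_const]

theorem leaves_bar {g : F} {v : List (Cst C₀)} (hv : v ≠ []) :
    leaves sig (bar g v) = v := by
  rcases exists_singleton_or_two_le hv with ⟨c, rfl⟩ | h2
  · simp [leaves_const]
  · rw [bar_of_two_le h2, str, leaves_app]
    simp [Function.comp_def, leaves_const, ← List.flatMap_def]

/-- The measure of terms that proves termination of rewriting modulo associativity. -/
noncomputable def termMeasure (sig : Signature F) (δ : Cst C₀ → ℕ) (B : ℕ)
    (t : Term F (Cst C₀)) : ℕ ×ₗ ℕ :=
  toLex (weight sig t, wordVal δ B (leaves sig t))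

variable [LinearOrder C₀] {f : F} {one : C₀} {C : Set (Cst C₀)} {δ : Cst C₀ → ℕ} {B : ℕ}

omit [LinearOrder C₀] in
theorem termMeasure_lt {s t : Term F (Cst C₀)} : termMeasure sig δ B s < termMeasure sig δ B t ↔
    weight sig s < weight sig t ∨ weight sig s = weight sig t ∧
      wordVal δ B (leaves sig s) < wordVal δ B (leaves sig t) := by
  rw [termMeasure, termMeasure, Prod.Lex.toLex_lt_toLex]

/-- Weights add up over a context. When they are equal, the leaves of the subterm form a factor of
all leaves, and the value of words is monotone in contexts. -/
theorem IsIndex.termMeasure_replaceOne (hδ : IsIndex C δ B) {l r s t : Term F (Cst C₀)}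
    (h : ReplaceOne l r s t) (hlr : termMeasure sig δ B r < termMeasure sig δ B l) :
    termMeasure sig δ B t < termMeasure sig δ B s := by
  induction h with
  | root => exact hlr
  | arg g xs zs _ ih =>
    rw [termMeasure_lt] at ih ⊢
    simp only [weight_app, leaves_app, List.map_append, List.map_cons, List.sum_append,
      List.sum_cons, List.flatten_append, List.flatten_cons]
    rcases ih with ih | ⟨ih₁, ih₂⟩
    · left; omega
    · refine .inr ⟨by omega, ?_⟩
      rw [← List.append_assoc, ← List.append_assoc]
      exact wordVal_context hδ.lt hδ.pos ih₂ _ _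

end Measure

/-- The rules of the completed system. -/
abbrev limitRules {F C₀ : Type u} [LinearOrder C₀] (sig : Signature F) (f : F) (one : C₀)
    (C : Set (Cst C₀)) (S : ℕ → Set (Eqn F (Cst C₀))) :
    Term F (Cst C₀) → Term F (Cst C₀) → Prop :=
  completedRules sig f one C (persisting S)

/-! ### Normal forms of the completed system and values -/

namespace Completion

variable {F C₀ : Type u} [LinearOrder C₀] {sig : Signature F} {f : F} {one : C₀}
  {C : Set (Cst C₀)} {S : ℕ → Set (Eqn F (Cst C₀))} (H : Completion sig f one C S)
include H

/-- For word rules the weight is the length, so the length-lexicographic order gives either less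
weight or a smaller value. A D-flat rule loses the non-associative symbol, and having at least one
argument it drops to weight one. A unit rule loses the constant `1`. -/
theorem termMeasure_rule {δ : Cst C₀ → ℕ} {B : ℕ} (hδ : IsIndex C δ B) {l r : Term F (Cst C₀)}
    (h : completedRules sig f one C (persisting S) l r) :
    termMeasure sig δ B r < termMeasure sig δ B l := by
  rw [termMeasure_lt]
  rcases h with ⟨h, hgt⟩ | ⟨_, _⟩ | ⟨_, _⟩
  · have hfl := H.flat_of_persisting h
    rcases hfl.cases with ⟨g, hg, v, w, hv, hw, rfl, rfl⟩ | ⟨k, hk, cs, c, rfl, rfl⟩ |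
      ⟨k, hk, cs, c, rfl, rfl⟩
    · rw [gt_bar_iff hg hv hw] at hgt
      rw [weight_bar hg hv, weight_bar hg hw, leaves_bar hv, leaves_bar hw]
      have hC := (flat_word_iff hg hv hw).mp hfl
      have := hδ.val_lt_of_gt hC.1 hC.2 hgt
      rcases hgt.length_le.lt_or_eq with h | h
      · exact .inl h
      · exact .inr ⟨h, this⟩
    · have := ((flat_dflat_iff hk).mp hfl).1
      have := sig.arity_pos k
      left
      rw [weight_const, str, weight_app]
      simp [hk, Function.comp_def, weight_const]
      omega
    · exact absurd hgt not_gt_const_str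
  · left; simp [weight_app, weight_const, H.assoc]
  · left; simp [weight_app, weight_const, H.assoc]

theorem termMeasure_rewrite {δ : Cst C₀ → ℕ} {B : ℕ} (hδ : IsIndex C δ B)
    {s t : Term F (Cst C₀)}
    (h : RewriteModA sig C (limitRules sig f one C S) s t) :
    termMeasure sig δ B t < termMeasure sig δ B s := by
  obtain ⟨u, v, l, r, h₁, h₂, h₃, h₄⟩ := h
  have := hδ.termMeasure_replaceOne h₃ (H.termMeasure_rule hδ h₂)
  have e₁ := size_eq_of_aEq h₁
  have e₂ := size_eq_of_aEq h₄
  rw [termMeasure_lt] at this ⊢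
  rwa [e₁.1, e₁.2, ← e₂.1, ← e₂.2]

theorem exists_normalForm (s : Term F (Cst C₀)) :
    ∃ u, IsNormalFormOf sig C (limitRules sig f one C S) s u := by
  obtain ⟨δ, B, hδ⟩ := H.exists_isIndex
  exact exists_irreducible (termMeasure sig δ B) (fun _ _ => H.termMeasure_rewrite hδ) s

omit [LinearOrder C₀] H in
theorem joinWord_letters (g : F) (v : List (Cst C₀)) : joinWord g (letters v) = bar g v := by
  match v with
  | [] => rfl
  | [_] => rfl
  | _ :: _ :: _ => rfl

/-- A deleted `1` has a neighbouring letter `t`; the factor `1 t` or `t 1` is the left-hand side of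
a unit rule with right-hand side `t`. -/
theorem rewrite_of_wordStep {g : F} (hg : g ∈ sig.assoc) {x y : List (Term F (Cst C₀))}
    (h : WordStep S f one g x y) (hx : ∀ w ∈ x, Ground sig C w) :
    RewriteModA sig C (limitRules sig f one C S) (joinWord g x) (joinWord g y) ∧
      ∀ w ∈ y, Ground sig C w := by
  rcases h with ⟨a, v, w, b, hr, rfl, rfl⟩ | ⟨rfl, a, b, hne, rfl, rfl⟩
  · have hy : ∀ t ∈ a ++ letters w ++ b, Ground sig C t := by
      intro t ht
      simp only [List.mem_append] at ht
      rcases ht with (ht | ht) | ht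
      · exact hx t (by simp [ht])
      · obtain ⟨c, hc, rfl⟩ := List.mem_map.mp ht
        exact .const c ((H.mem_of_wordRule hg hr).2 c hc)
      · exact hx t (by simp [ht])
    refine ⟨rewriteModA_block hg (by simpa using hr.1) (by simpa using hr.2.1) ?_ hx hy, hy⟩
    rw [joinWord_letters, joinWord_letters]
    exact .inl ⟨hr.2.2.2, (gt_bar_iff hg hr.1 hr.2.1).mpr hr.2.2.1⟩
  · have hy : ∀ t ∈ a ++ b, Ground sig C t := by
      intro t ht
      simp only [List.mem_append] at ht
      rcases ht with ht | ht
      · exact hx t (by simp [ht])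
      · exact hx t (by simp [ht])
    refine ⟨?_, hy⟩
    rcases a.eq_nil_or_concat' with rfl | ⟨a, t, rfl⟩
    · obtain ⟨t, b, rfl⟩ := List.exists_cons_of_ne_nil (by simpa using hne)
      have := rewriteModA_block (R := limitRules sig g one C S) (C := C) (a := [])
        (ys := [.const (.inl one), t]) (zs := [t]) (b := b) H.assoc
        (by simp) (by simp) (.inr (.left t (hy t (by simp)))) (by simpa using hx)
        (by simpa using hy)
      simpa using this
    · have := rewriteModA_block (R := limitRules sig g one C S) (C := C) (a := a)
        (ys := [t, .const (.inl one)]) (zs := [t]) (b := b) H.assoc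
        (by simp) (by simp) (.inr (.right t (hy t (by simp)))) (by simpa using hx)
        (by simpa using hy)
      simpa using this

theorem reduces_of_star {g : F} (hg : g ∈ sig.assoc) {x y : List (Term F (Cst C₀))}
    (h : ReflTransGen (WordStep S f one g) x y) (hx : ∀ w ∈ x, Ground sig C w) (hne : x ≠ []) :
    Reduces sig C (limitRules sig f one C S) (joinWord g x) (joinWord g y) ∧
      ∀ w ∈ y, Ground sig C w := by
  induction h with
  | refl => exact ⟨.refl ((ground_joinWord hg hne).mpr hx), hx⟩
  | tail _ h ih =>
    have := H.rewrite_of_wordStep hg h ih.2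
    exact ⟨ih.1.trans this.1.reduces, this.2⟩

theorem reduces_hat {c : Cst C₀} (hc : c ∈ C) :
    Reduces sig C (limitRules sig f one C S) (.const c) (hat S f one c) :=
  (H.reduces_of_star H.assoc (H.nfWord_spec H.assoc [.const c]).1
    (by simpa [Ground.const_iff] using hc) (by simp)).1

/-- Terms can be rewritten to their values. -/
theorem reduces_value {s : Term F (Cst C₀)} (hs : Ground sig C s) :
    Reduces sig C (limitRules sig f one C S) s (H.value s) := by
  induction hs with
  | const c hc =>
    rw [H.value_const]
    exact H.reduces_hat hc
  | app g ts hv hts ih =>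
    have h₁ : Reduces sig C (limitRules sig f one C S) (.app g ts) (.app g (ts.map H.value)) := by
      simpa using Reduces.map ih [] (.app g ts hv hts)
    refine h₁.trans ?_
    have hgr := h₁.ground
    rw [Ground.app_iff] at hgr
    have hval : ∀ v ∈ ts.map H.value, Val sig S f one v := by
      simp only [List.mem_map]
      rintro _ ⟨t, -, rfl⟩
      exact H.val_value t
    rw [H.value_app]
    by_cases hg : g ∈ sig.assoc
    · rw [sig.validArity_assoc hg] at hgr
      have hne : ts.map H.value ≠ [] := by
        intro h
        simp [h] at hgr
      rw [valOp_assoc hg hne, ← joinWord_of_two_le hgr.1]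
      have h₂ := aEq_flatMap hg (ts.map H.value) [] (by simpa using hne) hgr.2
      exact Reduces.trans (.inl h₂.1) (H.reduces_of_star hg (H.nfWord_spec hg _).1 h₂.2
        (flatMap_ne_nil hg hval hne)).1
    · rw [valOp, if_neg hg]
      split_ifs with hd
      · have hp := hd.choose_spec
        have hd' : hd.choose ∈ C :=
          Ground.const_iff.mp ((H.flat_of_persisting hp).ground _ (by simp))
        refine Reduces.trans (RewriteModA.reduces ?_) (H.reduces_hat hd')
        exact ⟨_, _, _, _, .refl h₁.ground, .inl ⟨hp, .app_const ..⟩, .root,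
          .refl (.const _ hd')⟩
      · exact .refl h₁.ground

theorem valueAlg_rule {l r : Term F (Cst C₀)} (h : limitRules sig f one C S l r) :
    H.valueAlg.eval l = H.valueAlg.eval r := by
  rcases h with ⟨h, -⟩ | h
  · obtain ⟨i, hi⟩ := exists_of_persisting h
    exact H.valueAlg_modelsEqns i _ _ hi
  · exact Alg.eval_eq_of_uInst H.valueAlg_modelsMonoid h

/-- Rewriting is sound in the algebra of values, so `s` and `u` have the same value. As `u` reduces
to its value but is irreducible, no step is involved and only A-equality remains. -/
theorem aEq_value {s u : Term F (Cst C₀)} (hs : Ground sig C s)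
    (h : IsNormalFormOf sig C (limitRules sig f one C S) s u) :
    AEq sig C u (H.value s) := by
  have : H.value s = H.value u := congrArg H.term
    (Alg.eval_eq_of_reflTransGen H.valueAlg_modelsMonoid (fun _ _ => H.valueAlg_rule) h.1)
  rw [this]
  exact (H.reduces_value (h.ground hs)).of_irreducible h.2

theorem normalForm_unique {s u v : Term F (Cst C₀)} (hs : Ground sig C s)
    (hu : IsNormalFormOf sig C (limitRules sig f one C S) s u)
    (hv : IsNormalFormOf sig C (limitRules sig f one C S) s v) : AEq sig C u v :=
  (H.aEq_value hs hu).trans (H.aEq_value hs hv).symm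

theorem sameNormalForm_iff {s t : Term F (Cst C₀)} (hs : Ground sig C s) (ht : Ground sig C t) :
    SameNormalForm sig C (limitRules sig f one C S) s t ↔ H.value s = H.value t := by
  constructor
  · rintro ⟨u, v, hu, hv, huv⟩
    refine congrArg H.term ?_
    have key {s u} (h : IsNormalFormOf sig C (limitRules sig f one C S) s u) :
        H.valueAlg.eval s = H.valueAlg.eval u :=
      Alg.eval_eq_of_reflTransGen H.valueAlg_modelsMonoid (fun _ _ => H.valueAlg_rule) h.1
    rw [key hu, key hv]
    exact Alg.eval_eq_of_aEq H.valueAlg_modelsMonoid huv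
  · intro h
    obtain ⟨u, hu⟩ := H.exists_normalForm s
    obtain ⟨v, hv⟩ := H.exists_normalForm t
    exact ⟨u, v, hu, hv, (H.aEq_value hs hu).trans (h ▸ (H.aEq_value ht hv).symm)⟩

end Completion

end CCM

namespace CCM

open Relation

/-! ### Reinterpretation of constants -/

section WithCst

variable {F K : Type u} {sig : Signature F} {f : F} {one : K}

/-- The algebra `𝒜` with another interpretation of the constants. -/
def Alg.withCst (𝒜 : Alg F K) (κ : K → 𝒜.carrier) : Alg F K where
  carrier := 𝒜.carrier
  cst := κ
  op := 𝒜.op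

theorem Alg.ModelsMonoid.withCst {𝒜 : Alg F K} (h : 𝒜.ModelsMonoid sig f one)
    {κ : K → 𝒜.carrier} (hκ : κ one = 𝒜.cst one) : (𝒜.withCst κ).ModelsMonoid sig f one := by
  refine ⟨h.1, fun a => ?_, fun a => ?_⟩
  · change 𝒜.op f [a, κ one] = a
    rw [hκ]
    exact h.2.1 a
  · change 𝒜.op f [κ one, a] = a
    rw [hκ]
    exact h.2.2 a

theorem Alg.withCst_eval_congr {𝒜 : Alg F K} {C : Set K} {κ κ' : K → 𝒜.carrier}
    (h : ∀ c ∈ C, κ c = κ' c) {t : Term F K} (ht : Ground sig C t) :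
    (𝒜.withCst κ).eval t = (𝒜.withCst κ').eval t := by
  induction ht with
  | const c hc => rw [Alg.eval_const, Alg.eval_const]; exact h c hc
  | app g ts _ _ ih =>
    rw [Alg.eval_app, Alg.eval_app]
    exact congrArg (𝒜.op g) (List.map_congr_left ih)

theorem Alg.eval_eq_of_reduces {𝒜 : Alg F K} {C : Set K} (h𝒜 : 𝒜.ModelsMonoid sig f one)
    {R : Term F K → Term F K → Prop} (hR : ∀ l r, R l r → 𝒜.eval l = 𝒜.eval r)
    {s t : Term F K} (h : Reduces sig C R s t) : 𝒜.eval s = 𝒜.eval t := by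
  rcases h with h | h
  · exact Alg.eval_eq_of_aEq h𝒜 h
  · exact Alg.eval_eq_of_reflTransGen h𝒜 hR h.to_reflTransGen

theorem Alg.ModelsEqns.of_eq {𝒜 : Alg F K} {p q s t : Term F K} (h : 𝒜.eval p = 𝒜.eval q)
    (he : s(s, t) = s(p, q)) : 𝒜.eval s = 𝒜.eval t := by
  rw [Sym2.eq_iff] at he
  rcases he with ⟨rfl, rfl⟩ | ⟨rfl, rfl⟩
  · exact h
  · exact h.symm

end WithCst

/-! ### Existence of flat forms and flat unit normal forms -/

section Flattening

variable {F C₀ : Type u} {sig : Signature F} {C : Set (Cst C₀)}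

/-- Phase I collects whatever flat forms exist; existence is needed so that no equation of `E` gets
lost. Arguments are flattened recursively and those headed by the same associative symbol are merged
into their parent. -/
theorem exists_assocFlat {s : Term F (Cst C₀)} (hs : Ground sig C s) :
    ∃ t, AEq sig C s t ∧ AssocFlat sig t := by
  induction hs with
  | const c hc => exact ⟨_, .refl (.const c hc), .const c⟩
  | app g ts hv hts ih =>
    choose! φ hφ using ih
    have h₁ : AEq sig C (.app g ts) (.app g (ts.map φ)) := by
      refine CongClosure.congr_forall₂ hv ?_
      rw [List.forall₂_map_right_iff, List.forall₂_same]
      exact fun t ht => (hφ t ht).1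
    by_cases hg : g ∈ sig.assoc
    · have hgr := h₁.ground.2
      rw [Ground.app_iff, sig.validArity_assoc hg] at hgr
      have hne : ts.map φ ≠ [] := by intro h; simp [h] at hgr
      have h₂ := aEq_flatMap hg (ts.map φ) [] (by simpa using hne) hgr.2
      simp only [List.nil_append] at h₂
      have hlen : 2 ≤ ((ts.map φ).flatMap (wordOf g)).length := by
        refine hgr.1.trans ?_
        rw [List.length_flatMap]
        refine (List.length_le_sum_of_one_le _ ?_).trans' (by simp)
        simp only [List.mem_map]
        rintro _ ⟨v, hv, rfl⟩
        exact List.length_pos_iff.mpr (wordOf_ground hg (hgr.2 v (by simpa using hv))).1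
      rw [joinWord_of_two_le hgr.1, joinWord_of_two_le hlen] at h₂
      have key : ∀ w ∈ (ts.map φ).flatMap (wordOf g), AssocFlat sig w ∧ ∀ ss, w ≠ .app g ss := by
        intro w hw
        obtain ⟨v, hv, hw⟩ := List.mem_flatMap.mp hw
        obtain ⟨t, ht, rfl⟩ := List.mem_map.mp hv
        have hfl := (hφ t ht).2
        cases hc : φ t with
        | const c =>
          rw [hc, wordOf, List.mem_singleton] at hw
          subst hw
          exact ⟨.const c, by simp⟩
        | app g' ss =>
          rw [hc] at hfl hw
          by_cases h : g' = g
          · subst h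
            rw [wordOf, if_pos rfl] at hw
            cases hfl with
            | app _ _ h₁ h₂ => exact ⟨h₁ w hw, h₂ hg w hw⟩
          · rw [wordOf, if_neg h, List.mem_singleton] at hw
            subst hw
            exact ⟨hfl, by simp [h]⟩
      exact ⟨_, h₁.trans h₂.1, .app _ _ (fun t ht => (key t ht).1) fun _ t ht => (key t ht).2⟩
    · refine ⟨_, h₁, .app _ _ ?_ fun h => absurd h hg⟩
      simp only [List.mem_map]
      rintro _ ⟨t, ht, rfl⟩
      exact (hφ t ht).2

theorem weight_replaceOne {l r s t : Term F (Cst C₀)} (h : ReplaceOne l r s t)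
    (hlr : weight sig r < weight sig l) : weight sig t < weight sig s := by
  induction h with
  | root => exact hlr
  | arg g xs zs _ ih =>
    simp only [weight_app, List.map_append, List.map_cons, List.sum_append, List.sum_cons]
    omega

theorem exists_flat_normalForm {f : F} (hf : f ∈ sig.assoc) {one : Cst C₀}
    {s : Term F (Cst C₀)} (hs : Ground sig C s) (hfl : AssocFlat sig s) :
    ∃ u, IsNormalFormOf sig C (UInst sig f one C) s u ∧ AssocFlat sig u := by
  obtain ⟨u, hu, hirr⟩ := exists_irreducible (r := RewriteModA sig C (UInst sig f one C))
    (weight sig) (by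
      rintro x y ⟨_, _, _, _, h₁, h₂, h₃, h₄⟩
      rw [(size_eq_of_aEq h₁).1, ← (size_eq_of_aEq h₄).1]
      refine weight_replaceOne h₃ ?_
      rcases h₂ with ⟨_, _⟩ | ⟨_, _⟩ <;> simp [weight_app, weight_const, hf]) s
  -- With no step, `s` is already flat. Otherwise the last step may end in any A-equal term, so a
  -- flat one can be chosen.
  rcases reflTransGen_iff_eq_or_transGen.mp hu with rfl | h
  · exact ⟨u, ⟨hu, hirr⟩, hfl⟩
  · obtain ⟨v, hv, hvfl⟩ := exists_assocFlat (transGen_ground h)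
    exact ⟨v, ⟨(transGen_aEq h hv).to_reflTransGen, fun w hw => hirr w (hv.rewrite hw)⟩, hvfl⟩

end Flattening

/-! ### Phase I preserves models -/

section PhaseI

variable {F C₀ : Type u} {sig : Signature F} {f : F} {one : C₀} {E : Set (Eqn F (Cst C₀))}

theorem baseConsts_subset (D : Set ℕ) : baseConsts C₀ ⊆ allConsts C₀ D := Set.subset_union_left

theorem allConsts_mono {D D' : Set ℕ} (h : D ⊆ D') : allConsts C₀ D ⊆ allConsts C₀ D' :=
  Set.union_subset_union_right _ (Set.image_mono h)

theorem new_mem_allConsts {D : Set ℕ} {i : ℕ} :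
    (new i : Cst C₀) ∈ allConsts C₀ D ↔ i ∈ D := by
  constructor
  · rintro (⟨_, h⟩ | ⟨j, hj, h⟩)
    · simp [new] at h
    · simp only [new, Sum.inr.injEq, ULift.up.injEq] at h
      exact h ▸ hj
  · exact fun h => .inr ⟨i, h, rfl⟩

/-- The invariant of Phase I. -/
structure PhaseInvariant (sig : Signature F) (f : F) (one : C₀) (E : Set (Eqn F (Cst C₀)))
    (S : Set (Eqn F (Cst C₀))) (D : Set ℕ) : Prop where
  finite : D.Finite
  ground : ∀ e ∈ S, ∀ t ∈ e, Ground sig (allConsts C₀ D) t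
  extend : ∀ 𝒜 : Alg F (Cst C₀), 𝒜.ModelsMonoid sig f (.inl one) → 𝒜.ModelsEqns E →
    ∃ κ : Cst C₀ → 𝒜.carrier, (∀ c, κ (.inl c) = 𝒜.cst (.inl c)) ∧ (𝒜.withCst κ).ModelsEqns S
  complete : ∀ 𝒜 : Alg F (Cst C₀), 𝒜.ModelsMonoid sig f (.inl one) → 𝒜.ModelsEqns S →
    𝒜.ModelsEqns E

/-- Passing to flat forms and unit normal forms does not change values in models of the monoid
axioms. Conversely, each equation of `E` has a normalized version in the set, unless that version is
trivial. -/
theorem phaseInvariant_init (hf : f ∈ sig.assoc)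
    (hE : ∀ e ∈ E, ∀ t ∈ e, Ground sig (baseConsts C₀) t) :
    PhaseInvariant sig f one E (phaseI₂ sig f one (phaseI₁ sig E)) ∅ := by
  have hnf {𝒜 : Alg F (Cst C₀)} (h𝒜 : 𝒜.ModelsMonoid sig f (.inl one)) {s u : Term F (Cst C₀)}
      (h : IsNormalFormOf sig (baseConsts C₀) (UInst sig f (.inl one) (baseConsts C₀)) s u) :
      𝒜.eval s = 𝒜.eval u :=
    Alg.eval_eq_of_reflTransGen h𝒜 (fun _ _ => Alg.eval_eq_of_uInst h𝒜) h.1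
  refine ⟨Set.finite_empty, ?_, fun 𝒜 h𝒜 h => ⟨𝒜.cst, fun _ => rfl, ?_⟩, fun 𝒜 h𝒜 h => ?_⟩
  · rintro e ⟨s, t, s', t', ⟨s₀, t₀, s₁, t₁, -, hs, -, ht, -, he⟩, hs', -, ht', -, -, rfl⟩ u hu
    refine Ground.mono (baseConsts_subset _) ?_
    rw [Sym2.eq_iff] at he
    obtain ⟨gs, gt⟩ : Ground sig (baseConsts C₀) s ∧ Ground sig (baseConsts C₀) t := by
      rcases he with ⟨rfl, rfl⟩ | ⟨rfl, rfl⟩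
      · exact ⟨hs.ground.2, ht.ground.2⟩
      · exact ⟨ht.ground.2, hs.ground.2⟩
    rw [Sym2.mem_iff] at hu
    rcases hu with rfl | rfl
    · exact hs'.ground gs
    · exact ht'.ground gt
  · rintro a b ⟨s, t, s', t', ⟨s₀, t₀, s₁, t₁, h₀, hs, -, ht, -, he⟩, hs', -, ht', -, -, he'⟩
    refine Alg.ModelsEqns.of_eq ?_ he'
    change 𝒜.eval s' = 𝒜.eval t'
    rw [← hnf h𝒜 hs', ← hnf h𝒜 ht']
    refine Alg.ModelsEqns.of_eq ?_ he
    rw [← Alg.eval_eq_of_aEq h𝒜 hs, ← Alg.eval_eq_of_aEq h𝒜 ht]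
    exact h s₀ t₀ h₀
  · intro s t hst
    obtain ⟨s₁, hs₁, fs₁⟩ := exists_assocFlat (hE _ hst s (by simp))
    obtain ⟨t₁, ht₁, ft₁⟩ := exists_assocFlat (hE _ hst t (by simp))
    obtain ⟨s₂, hs₂, fs₂⟩ := exists_flat_normalForm hf (one := .inl one) hs₁.ground.2 fs₁
    obtain ⟨t₂, ht₂, ft₂⟩ := exists_flat_normalForm hf (one := .inl one) ht₁.ground.2 ft₁
    rw [Alg.eval_eq_of_aEq h𝒜 hs₁, Alg.eval_eq_of_aEq h𝒜 ht₁, hnf h𝒜 hs₂, hnf h𝒜 ht₂]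
    by_cases hne : s₂ = t₂
    · rw [hne]
    · exact h _ _ ⟨s₁, t₁, s₂, t₂, ⟨s, t, s₁, t₁, hst, hs₁, fs₁, ht₁, ft₁, rfl⟩, hs₂, fs₂, ht₂, ft₂,
        hne, rfl⟩

/-- Naming a subterm is conservative: a model extends by letting the fresh constant denote that
subterm, and the defining equation allows the replacement to be undone. -/
theorem PhaseInvariant.step {S S' : Set (Eqn F (Cst C₀))} {D D' : Set ℕ}
    (h : PhaseInvariant sig f one E S D) (hstep : FlattenStep sig (S, D) (S', D')) :
    PhaseInvariant sig f one E S' D' := by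
  cases hstep with
  | fresh _ _ p p' q g cs i hpq hA hi hrep =>
    have hp := h.ground _ hpq p (by simp)
    have hq := h.ground _ hpq q (by simp)
    have hl := hrep.ground_source hp
    have hsub := allConsts_mono (C₀ := C₀) (Set.subset_insert i D)
    have hnew : (new i : Cst C₀) ∈ allConsts C₀ (insert i D) := by simp [new_mem_allConsts]
    refine ⟨h.finite.insert i, ?_, fun 𝒜 h𝒜 hE => ?_, fun 𝒜 h𝒜 hS => h.complete 𝒜 h𝒜 ?_⟩
    · rintro e (he | rfl | rfl) t ht
      · exact (h.ground e he.1 t ht).mono hsub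
      · rw [Sym2.mem_iff] at ht
        rcases ht with rfl | rfl
        · exact hrep.ground (hp.mono hsub) (.const _ hnew)
        · exact hq.mono hsub
      · rw [Sym2.mem_iff] at ht
        rcases ht with rfl | rfl
        · exact hl.mono hsub
        · exact .const _ hnew
    · obtain ⟨κ, hκ, hS⟩ := h.extend 𝒜 h𝒜 hE
      classical
      -- The index `i` is fresh, so the change does not affect the terms over the constants used so
      -- far.
      let κ' := Function.update κ (new i) ((𝒜.withCst κ).eval (str g cs))
      have hagree : ∀ c ∈ allConsts C₀ D, κ c = κ' c := by
        intro c hc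
        refine (Function.update_of_ne ?_ _ _).symm
        rintro rfl
        exact hi (new_mem_allConsts.mp hc)
      have hnew' : (𝒜.withCst κ').eval (str g cs) = (𝒜.withCst κ').eval (.const (new i)) := by
        rw [← Alg.withCst_eval_congr hagree hl, Alg.eval_const]
        exact (Function.update_self (new i) _ κ).symm
      refine ⟨κ', fun c => ?_, ?_⟩
      · rw [← hκ c]
        exact (hagree _ (.inl ⟨c, rfl⟩)).symm
      · rintro a b (hab | hab | hab)
        · rw [← Alg.withCst_eval_congr hagree (h.ground _ hab.1 a (by simp)),
            ← Alg.withCst_eval_congr hagree (h.ground _ hab.1 b (by simp))]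
          exact hS a b hab.1
        · refine Alg.ModelsEqns.of_eq ?_ hab
          rw [← Alg.eval_eq_of_replaceOne hrep hnew', ← Alg.withCst_eval_congr hagree hp,
            ← Alg.withCst_eval_congr hagree hq]
          exact hS p q hpq
        · exact Alg.ModelsEqns.of_eq hnew' hab
    · intro a b hab
      by_cases he : s(a, b) = s(p, q)
      · refine Alg.ModelsEqns.of_eq ?_ he
        rw [Alg.eval_eq_of_replaceOne hrep (hS _ _ (.inr (.inr rfl)))]
        exact hS _ _ (.inr (.inl rfl))
      · exact hS a b (.inl ⟨hab, he⟩)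
  | reuse _ _ p p' q g cs c hpq hA hc hne hrep =>
    have hp := h.ground _ hpq p (by simp)
    have hq := h.ground _ hpq q (by simp)
    refine ⟨h.finite, ?_, fun 𝒜 h𝒜 hE => ?_, fun 𝒜 h𝒜 hS => h.complete 𝒜 h𝒜 ?_⟩
    · rintro e (he | rfl) t ht
      · exact h.ground e he.1 t ht
      · rw [Sym2.mem_iff] at ht
        rcases ht with rfl | rfl
        · exact hrep.ground hp (h.ground _ hc _ (by simp))
        · exact hq
    · obtain ⟨κ, hκ, hS⟩ := h.extend 𝒜 h𝒜 hE
      refine ⟨κ, hκ, ?_⟩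
      rintro a b (hab | hab)
      · exact hS a b hab.1
      · refine Alg.ModelsEqns.of_eq ?_ hab
        rw [← Alg.eval_eq_of_replaceOne hrep (hS _ _ hc)]
        exact hS p q hpq
    · intro a b hab
      by_cases he : s(a, b) = s(p, q)
      · refine Alg.ModelsEqns.of_eq ?_ he
        -- The reused defining equation differs from the one being replaced, so it is still present
        -- and can undo the replacement.
        rw [Alg.eval_eq_of_replaceOne hrep (hS _ _ (.inl ⟨hc, hne⟩))]
        exact hS _ _ (.inr rfl)
      · exact hS a b (.inl ⟨hab, he⟩)

theorem PhaseI.invariant (hf : f ∈ sig.assoc)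
    (hE : ∀ e ∈ E, ∀ t ∈ e, Ground sig (baseConsts C₀) t) {E' : Set (Eqn F (Cst C₀))}
    {D : Set ℕ} (h : PhaseI sig f one E E' D) : PhaseInvariant sig f one E E' D := by
  have key : ∀ x : Set (Eqn F (Cst C₀)) × Set ℕ,
      ReflTransGen (FlattenStep sig) (phaseI₂ sig f one (phaseI₁ sig E), ∅) x →
      PhaseInvariant sig f one E x.1 x.2 := by
    intro x hx
    induction hx with
    | refl => exact phaseInvariant_init hf hE
    | tail _ hstep ih => exact ih.step hstep
  exact key _ h.1

theorem flat_of_isFlatEqn (hf : f ∈ sig.assoc) {C : Set (Cst C₀)} {e : Eqn F (Cst C₀)}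
    (he : IsFlatEqn sig e) (hgr : ∀ t ∈ e, Ground sig C t) : Flat sig C e := by
  have word {g : F} (hg : g ∈ sig.assoc) {v w : List (Cst C₀)} (hv : v ≠ []) (hw : w ≠ [])
      (he : e = s(bar g v, bar g w)) : Flat sig C e := by
    subst he
    exact .word g v w hg hv hw ((ground_bar hg hv).mp (hgr _ (by simp)))
      ((ground_bar hg hw).mp (hgr _ (by simp)))
  have ne {v : List (Cst C₀)} (h : 2 ≤ v.length) : v ≠ [] := by rintro rfl; simp at h
  rcases he with ⟨c, d, rfl⟩ | ⟨g, cs, c, hv, rfl⟩ | ⟨g, hg, cs, ds, hcs, hds, rfl⟩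
  · exact word hf (v := [c]) (w := [d]) (by simp) (by simp) rfl
  · by_cases hg : g ∈ sig.assoc
    · rw [sig.validArity_assoc hg] at hv
      exact word hg (v := cs) (w := [c]) (ne hv) (by simp) (by rw [bar_of_two_le hv]; rfl)
    · rw [sig.validArity_nonassoc hg] at hv
      have h₁ := hgr (str g cs) (by simp)
      rw [str, Ground.app_iff] at h₁
      refine .dflat g cs c hg hv (fun c hc => Ground.const_iff.mp (h₁.2 (.const c) ?_))
        (Ground.const_iff.mp (hgr _ (by simp)))
      exact List.mem_map_of_mem hc
  · exact word hg (ne hcs) (ne hds) (by rw [bar_of_two_le hcs, bar_of_two_le hds])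

end PhaseI

/-! ### Soundness of the inferences and congruence closure in terms of values -/

section Soundness

variable {F C₀ : Type u} [LinearOrder C₀] {sig : Signature F} {f : F} {one : C₀}
  {C : Set (Cst C₀)} {S : ℕ → Set (Eqn F (Cst C₀))}

/-- Replacing a factor by an equal one is valid in a model by associativity. In DEDUCE both sides of
the conclusion equal the value of `u₁u₂u₃`. -/
theorem FlatInference.sound {𝒜 : Alg F (Cst C₀)} (h𝒜 : 𝒜.ModelsMonoid sig f (.inl one))
    {τ : Inference F C₀} (hτ : FlatInference sig τ) (h : 𝒜.ModelsEqns τ.prem) :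
    𝒜.ModelsEqns τ.add := by
  have snd {e e' : Eqn F (Cst C₀)} : e' ∈ ({e, e'} : Set _) := Set.mem_insert_of_mem _ rfl
  intro a b hab
  cases hτ with
  | deduce g u₁ u₂ u₃ v w hg h₁ h₂ h₃ hv hw =>
    have p₁ := h _ _ (Set.mem_insert _ _)
    have p₂ := h _ _ snd
    refine Alg.ModelsEqns.of_eq ?_ hab
    rw [Alg.eval_bar, Alg.eval_bar] at p₁ p₂ ⊢
    have q₁ := Alg.bop_congr h𝒜 hg [] (u₃.map 𝒜.cst) (by simp [h₁]) (by simp [hv]) p₁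
    have q₂ := Alg.bop_congr h𝒜 hg (u₁.map 𝒜.cst) [] (by simp [h₂]) (by simp [hw]) p₂
    simp only [List.map_append, List.nil_append, List.append_nil, List.append_assoc] at q₁ q₂ ⊢
    rw [← q₂, q₁]
  | word g x p q y w hg hp hq hw hpq hxy =>
    have p₁ := h _ _ (Set.mem_insert _ _)
    have p₂ := h _ _ snd
    refine Alg.ModelsEqns.of_eq ?_ hab
    rw [Alg.eval_bar, Alg.eval_bar] at p₁ p₂ ⊢
    have q₂ := Alg.bop_congr h𝒜 hg (x.map 𝒜.cst) (y.map 𝒜.cst) (by simp [hp]) (by simp [hq]) p₂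
    simp only [List.map_append] at p₁ ⊢
    rw [← q₂, p₁]
  | root k cs c d hk hcd =>
    exact Alg.ModelsEqns.of_eq ((h _ _ snd).symm.trans (h _ _ (Set.mem_insert _ _))) hab
  | arg k x y c d e hk hcd =>
    have p₁ := h _ _ (Set.mem_insert _ _)
    have p₂ := h _ _ snd
    refine Alg.ModelsEqns.of_eq ?_ hab
    rw [← p₁, Alg.eval_str, Alg.eval_str]
    simp only [Alg.eval_const] at p₂
    simp [p₂]
  | compose k cs c d hk hcd =>
    exact Alg.ModelsEqns.of_eq ((h _ _ (Set.mem_insert _ _)).trans (h _ _ snd)) hab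
  | delete s => exact absurd hab (Set.notMem_empty _)

theorem Completion.modelsEqns (H : Completion sig f one C S) {𝒜 : Alg F (Cst C₀)}
    (h𝒜 : 𝒜.ModelsMonoid sig f (.inl one)) (h₀ : 𝒜.ModelsEqns (S 0)) (i : ℕ) :
    𝒜.ModelsEqns (S i) := by
  induction i with
  | zero => exact h₀
  | succ i ih =>
    rcases H.exists_of_step i with h | ⟨τ, hτ, hprem, h⟩
    · rwa [h]
    · rw [h]
      rintro a b (hab | hab)
      · exact ih a b hab.1
      · exact hτ.sound h𝒜 (fun a b h => ih a b (hprem h)) a b hab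

omit [LinearOrder C₀] in
theorem modelsEqns_unitEqns {𝒜 : Alg F (Cst C₀)} (h𝒜 : 𝒜.ModelsMonoid sig f (.inl one)) :
    𝒜.ModelsEqns (unitEqns f one C) := by
  rintro s t ⟨c, -, h | h⟩
  · refine Alg.ModelsEqns.of_eq ?_ h
    simpa [Alg.eval_str] using h𝒜.2.1 _
  · refine Alg.ModelsEqns.of_eq ?_ h
    simpa [Alg.eval_str] using h𝒜.2.2 _

theorem Completion.of_phaseI [Finite C₀] (hf : f ∈ sig.assoc) (hone : ∀ c : C₀, one ≤ c)
    {E : Set (Eqn F (Cst C₀))} {E' : Set (Eqn F (Cst C₀))} {D : Set ℕ}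
    (hI : PhaseInvariant sig f one E E' D) (hfl : ∀ e ∈ E', IsFlatEqn sig e)
    (hS0 : S 0 = E' ∪ unitEqns f one (allConsts C₀ D))
    (hder : IsDerivation sig S) (hfair : IsFair sig S) :
    Completion sig f one (allConsts C₀ D) S where
  assoc := hf
  minimal := hone
  finite := (Set.finite_range _).union (hI.finite.image _)
  flat_zero := by
    have h1 : (.inl one : Cst C₀) ∈ allConsts C₀ D := .inl ⟨one, rfl⟩
    rw [hS0]
    rintro e (he | ⟨c, hc, rfl | rfl⟩)
    · exact flat_of_isFlatEqn hf (hfl e he) (hI.ground e he)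
    · exact .word f [c, .inl one] [c] hf (by simp) (by simp) (by simp [hc, h1]) (by simp [hc])
    · exact .word f [.inl one, c] [c] hf (by simp) (by simp) (by simp [hc, h1]) (by simp [hc])
  units := hS0 ▸ Set.subset_union_right
  derivation := hder
  fair := hfair

/-- Congruence closure of `E` is characterized by values. -/
theorem Completion.ccMonoid_iff {D : Set ℕ} (H : Completion sig f one (allConsts C₀ D) S)
    {E : Set (Eqn F (Cst C₀))} (hE : ∀ e ∈ E, ∀ t ∈ e, Ground sig (baseConsts C₀) t)
    {E' : Set (Eqn F (Cst C₀))} (hI : PhaseInvariant sig f one E E' D)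
    (hS0 : S 0 = E' ∪ unitEqns f one (allConsts C₀ D)) {s t : Term F (Cst C₀)}
    (hs : Ground sig (baseConsts C₀) s) (ht : Ground sig (baseConsts C₀) t) :
    CCMonoid sig f (.inl one) (baseConsts C₀) E s t ↔ H.value s = H.value t := by
  constructor
  · intro h
    refine congrArg H.term (h.entails _ (hI.complete _ H.valueAlg_modelsMonoid ?_)
      H.valueAlg_modelsMonoid)
    intro a b hab
    exact H.valueAlg_modelsEqns 0 a b (hS0 ▸ .inl hab)
  · intro h
    -- By Birkhoff's theorem it suffices to treat an arbitrary model of `E`. Reinterpreting the new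
    -- constants makes all stages true in it, and rewriting then equates each term with its value.
    -- Terms over the original constants do not notice the reinterpretation.
    rw [← entailsMonoid_iff H.assoc (C := baseConsts C₀) (Set.mem_range_self one) hE hs ht]
    intro 𝒜 hE𝒜 h𝒜
    obtain ⟨κ, hκ, hE'⟩ := hI.extend 𝒜 h𝒜 hE𝒜
    have h𝒜' := h𝒜.withCst (hκ one)
    have hS : ∀ i, (𝒜.withCst κ).ModelsEqns (S i) := by
      refine H.modelsEqns h𝒜' ?_
      rw [hS0]
      rintro a b (hab | hab)
      · exact hE' a b hab
      · exact modelsEqns_unitEqns h𝒜' a b hab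
    have key {u : Term F (Cst C₀)} (hu : Ground sig (baseConsts C₀) u) :
        𝒜.eval u = (𝒜.withCst κ).eval (H.value u) := by
      have h₁ : (𝒜.withCst 𝒜.cst).eval u = (𝒜.withCst κ).eval u := by
        refine Alg.withCst_eval_congr ?_ hu
        rintro _ ⟨c, rfl⟩
        exact (hκ c).symm
      refine h₁.trans (Alg.eval_eq_of_reduces h𝒜' ?_
        (H.reduces_value (hu.mono (baseConsts_subset D))))
      rintro l r (⟨hlr, -⟩ | hlr)
      · obtain ⟨i, hi⟩ := exists_of_persisting hlr
        exact hS i l r hi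
      · exact Alg.eval_eq_of_uInst h𝒜' hlr
    rw [key hs, key ht, h]

end Soundness

end CCM

namespace CCM

/-! ### Computable word rewriting and a stack machine for values -/

section Rewriting

open Encodable

/-- This makes every finite table primitive recursive. The induction is on the set of exceptions,
removing one at a time. -/
theorem primrec_of_finite_ne {g h : ℕ → ℕ} (hg : Primrec g) (hh : {n | h n ≠ g n}.Finite) :
    Primrec h := by
  obtain ⟨s, hs⟩ := hh.exists_finset_coe
  induction s using Finset.induction_on generalizing h with
  | empty =>
    have : h = g := by
      funext n
      by_contra hn
      have : n ∈ ((∅ : Finset ℕ) : Set ℕ) := by rw [hs]; exact hn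
      simp at this
    rwa [this]
  | insert a s ha ih =>
    have h1 : {n | Function.update h a (g a) n ≠ g n} = (s : Set ℕ) := by
      ext n
      have hn : n ∈ ((insert a s : Finset ℕ) : Set ℕ) ↔ h n ≠ g n := by rw [hs]; rfl
      simp only [Finset.coe_insert, Set.mem_insert_iff, Finset.mem_coe] at hn
      by_cases hna : n = a
      · subst hna
        simp [ha]
      · simp [hna, ← hn]
    have h2 := ih (h1 ▸ s.finite_toSet) h1.symm
    have h3 : h = fun n => if n = a then h a else Function.update h a (g a) n := by
      funext n
      split_ifs with hn
      · rw [hn]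
      · rw [Function.update_of_ne hn]
    rw [h3]
    exact Primrec.ite (Primrec.eq.comp .id (.const a)) (.const _) h2

/-- Results of applying one of the rules to a word, for the rules listed for the symbol `k`. -/
def successors (rules : List (ℕ × List ℕ × List ℕ)) (k : ℕ) (x : List ℕ) : List (List ℕ) :=
  (List.range (x.length + 1)).flatMap fun i => rules.flatMap fun r =>
    -- Excluding an empty result lets deletion of `1` be listed as an ordinary rule with empty
    -- right-hand side, as a lone `1` is then never deleted.
    if r.1 = k ∧ (x.drop i).take r.2.1.length = r.2.1 ∧
      x.take i ++ r.2.2 ++ x.drop (i + r.2.1.length) ≠ []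
    then [x.take i ++ r.2.2 ++ x.drop (i + r.2.1.length)] else []

theorem mem_successors {rules : List (ℕ × List ℕ × List ℕ)} {k : ℕ} {x y : List ℕ} :
    y ∈ successors rules k x ↔
      ∃ a v w b, (k, v, w) ∈ rules ∧ x = a ++ v ++ b ∧ y = a ++ w ++ b ∧ y ≠ [] := by
  constructor
  · intro h
    simp only [successors, List.mem_flatMap, List.mem_range] at h
    obtain ⟨i, -, ⟨k', v, w⟩, hr, h⟩ := h
    split_ifs at h with hc
    · obtain ⟨rfl, hv, hne⟩ := hc
      rw [List.mem_singleton] at h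
      subst h
      refine ⟨x.take i, v, w, x.drop (i + v.length), hr, ?_, rfl, hne⟩
      dsimp only at hv
      conv_lhs => rw [← List.take_append_drop i x, ← List.take_append_drop v.length (x.drop i), hv]
      rw [List.drop_drop, List.append_assoc]
    · simp at h
  · rintro ⟨a, v, w, b, hr, rfl, rfl, hne⟩
    simp only [successors, List.mem_flatMap, List.mem_range]
    refine ⟨a.length, by simp, _, hr, ?_⟩
    have e : (a ++ v ++ b).drop (a.length + v.length) = b := by
      rw [← List.length_append, List.drop_left]
    have e' : (a ++ v ++ b).take a.length = a := by simp
    rw [if_pos]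
    · simp only [e, e', List.mem_singleton]
    · refine ⟨rfl, ?_, ?_⟩
      · simp
      · simp only [e, e']
        exact hne

/-- One rewrite step, if there is one. -/
def stepFun (rules : List (ℕ × List ℕ × List ℕ)) (k : ℕ) (x : List ℕ) : List ℕ :=
  (successors rules k x).head?.getD x

theorem stepFun_spec (rules : List (ℕ × List ℕ × List ℕ)) (k : ℕ) (x : List ℕ) :
    stepFun rules k x ∈ successors rules k x ∨
      successors rules k x = [] ∧ stepFun rules k x = x := by
  rw [stepFun]
  cases h : successors rules k x with
  | nil => simp
  | cons y l => simp

/-- The normal form of a word, computed by sufficiently many rewrite steps. -/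
def nfFun (rules : List (ℕ × List ℕ × List ℕ)) (B k : ℕ) (x : List ℕ) : List ℕ :=
  (stepFun rules k)^[B ^ x.length] x

/-- The content of a number of a term. -/
def content (n : ℕ) : ℕ ⊕ ℕ × List ℕ :=
  ((decode n : Option (ℕ ⊕ ℕ × List ℕ))).getD (.inl 0)

theorem content_encode (a : ℕ ⊕ ℕ × List ℕ) : content (encode a) = a := by
  simp [content]

/-- `wordOf` for numbers of terms. -/
def wordOfFun (k n : ℕ) : List ℕ :=
  Sum.elim (fun _ => [n]) (fun p => if p.1 = k then p.2 else [n]) (content n)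

/-- `joinWord` for numbers of terms. -/
def joinFun (k : ℕ) (x : List ℕ) : ℕ :=
  if x.length = 1 then x.headI else encode (Sum.inr (k, x) : ℕ ⊕ ℕ × List ℕ)

/-- Finite data from which values of terms can be computed. -/
structure ValueData where
  rules : List (ℕ × List ℕ × List ℕ)
  base : ℕ
  kind : ℕ → ℕ
  -- The entry 0 marks a number that denotes no constant; otherwise it is the number of the value
  -- plus one.
  cst : ℕ → ℕ
  red : ℕ → ℕ
  primrec_kind : Primrec kind
  primrec_cst : Primrec cst
  primrec_red : Primrec red

namespace ValueData

variable (V : ValueData)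

/-- The operations on numbers of values. -/
def op (k : ℕ) (xs : List ℕ) : ℕ :=
  if V.kind k = 1 then joinFun k (nfFun V.rules V.base k (xs.flatMap (wordOfFun k)))
  else V.red (encode (Sum.inr (k, xs) : ℕ ⊕ ℕ × List ℕ))

/-- Whether the symbol `k` may be applied to `n` arguments. -/
def Valid (k n : ℕ) : Prop := V.kind k = 1 ∧ 2 ≤ n ∨ V.kind k = n + 1 ∧ 1 ≤ n

instance (k n : ℕ) : Decidable (V.Valid k n) := by unfold Valid; infer_instance

/-- Processing of one letter of a word in prefix notation, which is read backwards. -/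
def push (l : ℕ ⊕ ℕ × ℕ) (s : List ℕ) : Option (List ℕ) :=
  Sum.elim (fun k => if V.cst k = 0 then none else some ((V.cst k - 1) :: s))
    (fun p => if V.Valid p.1 p.2 ∧ p.2 ≤ s.length then
      some (V.op p.1 (s.take p.2) :: s.drop p.2) else none) l

/-- The numbers of the values of a sequence of terms, from its word in prefix notation. -/
def run (w : List (ℕ ⊕ ℕ × ℕ)) : Option (List ℕ) :=
  w.foldr (fun l st => st.bind (V.push l)) (some [])

end ValueData

section Primrec

open Primrec

theorem primrec_successors (rules : List (ℕ × List ℕ × List ℕ)) :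
    Primrec₂ (successors rules) := by
  have hx : Primrec fun p : (ℕ × List ℕ) × ℕ => p.1.2 := snd.comp fst
  have A : Primrec fun q : ((ℕ × List ℕ) × ℕ) × (ℕ × List ℕ × List ℕ) =>
      q.1.1.2.take q.1.2 ++ q.2.2.2 ++ q.1.1.2.drop (q.1.2 + q.2.2.1.length) := by
    have h1 : Primrec fun q : ((ℕ × List ℕ) × ℕ) × (ℕ × List ℕ × List ℕ) => q.1.1.2 :=
      hx.comp fst
    have h2 : Primrec fun q : ((ℕ × List ℕ) × ℕ) × (ℕ × List ℕ × List ℕ) => q.1.2 :=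
      snd.comp fst
    have h3 : Primrec fun q : ((ℕ × List ℕ) × ℕ) × (ℕ × List ℕ × List ℕ) => q.2.2.1.length :=
      list_length.comp (fst.comp (snd.comp snd))
    exact list_append.comp (list_append.comp (list_take.comp h2 h1) (snd.comp (snd.comp snd)))
      (list_drop.comp (nat_add.comp h2 h3) h1)
  have Bk : PrimrecPred fun q : ((ℕ × List ℕ) × ℕ) × (ℕ × List ℕ × List ℕ) =>
      q.2.1 = q.1.1.1 := Primrec.eq.comp (fst.comp snd) (fst.comp (fst.comp fst))
  have Bv : PrimrecPred fun q : ((ℕ × List ℕ) × ℕ) × (ℕ × List ℕ × List ℕ) =>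
      (q.1.1.2.drop q.1.2).take q.2.2.1.length = q.2.2.1 :=
    Primrec.eq.comp (list_take.comp (list_length.comp (fst.comp (snd.comp snd)))
      (list_drop.comp (snd.comp fst) (hx.comp fst))) (fst.comp (snd.comp snd))
  have Bn : PrimrecPred fun q : ((ℕ × List ℕ) × ℕ) × (ℕ × List ℕ × List ℕ) =>
      q.1.1.2.take q.1.2 ++ q.2.2.2 ++ q.1.1.2.drop (q.1.2 + q.2.2.1.length) ≠ [] :=
    (Primrec.eq.comp A (.const [])).not
  have hr : Primrec fun p : (ℕ × List ℕ) × ℕ => rules.flatMap fun r =>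
      if r.1 = p.1.1 ∧ (p.1.2.drop p.2).take r.2.1.length = r.2.1 ∧
        p.1.2.take p.2 ++ r.2.2 ++ p.1.2.drop (p.2 + r.2.1.length) ≠ []
      then [p.1.2.take p.2 ++ r.2.2 ++ p.1.2.drop (p.2 + r.2.1.length)] else [] :=
    list_flatMap (.const rules) (Primrec.to₂
      (Primrec.ite (Bk.and (Bv.and Bn)) (list_cons.comp A (.const [])) (.const [])))
  exact list_flatMap (list_range.comp (succ.comp (list_length.comp snd))) hr.to₂

theorem primrec_nfFun (rules : List (ℕ × List ℕ × List ℕ)) (B : ℕ) :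
    Primrec₂ (nfFun rules B) := by
  have hs : Primrec₂ (stepFun rules) :=
    option_getD.comp (list_head?.comp (primrec_successors rules)) snd
  have hp : Primrec fun p : ℕ × List ℕ => B ^ p.2.length :=
    (Primrec₂.unpaired'.1 Nat.Primrec.pow).comp (.const B) (list_length.comp snd)
  exact nat_iterate hp snd (hs.comp (fst.comp fst) snd).to₂

theorem primrec_wordOfFun : Primrec₂ wordOfFun := by
  have hc : Primrec content := option_getD.comp Primrec.decode (.const _)
  have hn : Primrec fun p : ℕ × ℕ => [p.2] := list_cons.comp snd (.const [])
  exact (sumCasesOn (hc.comp snd) (hn.comp fst).to₂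
    (ite (Primrec.eq.comp (fst.comp snd) (fst.comp fst)) (snd.comp snd) (hn.comp fst)).to₂).of_eq
      fun p => by rw [wordOfFun]; cases content p.2 <;> rfl

theorem primrec_joinFun : Primrec₂ joinFun :=
  ite (Primrec.eq.comp (list_length.comp snd) (.const 1)) (list_headI.comp snd)
    (Primrec.encode.comp (sumInr.comp .id))

namespace ValueData

variable (V : ValueData)

theorem primrec_op : Primrec₂ V.op :=
  ite (Primrec.eq.comp (V.primrec_kind.comp fst) (.const 1))
    (primrec_joinFun.comp fst ((primrec_nfFun V.rules V.base).comp fst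
      (list_flatMap snd (primrec_wordOfFun.comp (fst.comp fst) snd).to₂)))
    (V.primrec_red.comp (Primrec.encode.comp (sumInr.comp .id)))

theorem primrec_push : Primrec₂ V.push := by
  have h1 : Primrec₂ fun (p : (ℕ ⊕ ℕ × ℕ) × List ℕ) (k : ℕ) =>
      if V.cst k = 0 then none else some ((V.cst k - 1) :: p.2) :=
    ite (Primrec.eq.comp (V.primrec_cst.comp snd) (.const 0)) (.const none)
      (option_some.comp (list_cons.comp
        (nat_sub.comp (V.primrec_cst.comp snd) (.const 1)) (snd.comp fst)))
  have hk : Primrec fun q : ((ℕ ⊕ ℕ × ℕ) × List ℕ) × (ℕ × ℕ) => V.kind q.2.1 :=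
    V.primrec_kind.comp (fst.comp snd)
  have hn : Primrec fun q : ((ℕ ⊕ ℕ × ℕ) × List ℕ) × (ℕ × ℕ) => q.2.2 := snd.comp snd
  have hs : Primrec fun q : ((ℕ ⊕ ℕ × ℕ) × List ℕ) × (ℕ × ℕ) => q.1.2 := snd.comp fst
  have hv : PrimrecPred fun q : ((ℕ ⊕ ℕ × ℕ) × List ℕ) × (ℕ × ℕ) => V.Valid q.2.1 q.2.2 :=
    ((Primrec.eq.comp hk (.const 1)).and (nat_le.comp (.const 2) hn)).or
      ((Primrec.eq.comp hk (succ.comp hn)).and (nat_le.comp (.const 1) hn))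
  have h2 : Primrec₂ fun (p : (ℕ ⊕ ℕ × ℕ) × List ℕ) (q : ℕ × ℕ) =>
      if V.Valid q.1 q.2 ∧ q.2 ≤ p.2.length then
        some (V.op q.1 (p.2.take q.2) :: p.2.drop q.2) else none :=
    ite (hv.and (nat_le.comp hn (list_length.comp hs)))
      (option_some.comp (list_cons.comp
        (V.primrec_op.comp (fst.comp snd) (list_take.comp hn hs)) (list_drop.comp hn hs)))
      (.const none)
  exact (sumCasesOn fst h1 h2).of_eq fun p => by rw [push]; cases p.1 <;> rfl

theorem primrec_run : Primrec V.run :=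
  list_foldr .id (.const (some []))
    (option_bind (snd.comp snd) (V.primrec_push.comp (fst.comp (snd.comp fst)) snd).to₂).to₂

end ValueData

end Primrec

end Rewriting

end CCM

namespace CCM

open Relation Encodable

/-! ### Numbers for terms -/

section Numbering

variable {F K : Type u}

/-- A number for a term, given numberings of the symbols. -/
def num (φ : F → ℕ) (κ : K → ℕ) : Term F K → ℕ
  | .const c => encode (Sum.inl (κ c) : ℕ ⊕ ℕ × List ℕ)
  | .app g ts => encode (Sum.inr (φ g, ts.map fun t => num φ κ t) : ℕ ⊕ ℕ × List ℕ)

variable {φ : F → ℕ} {κ : K → ℕ}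

theorem num_const (c : K) : num φ κ (.const c) = encode (Sum.inl (κ c) : ℕ ⊕ ℕ × List ℕ) := by
  rw [num]

theorem num_app (g : F) (ts : List (Term F K)) :
    num φ κ (.app g ts) = encode (Sum.inr (φ g, ts.map (num φ κ)) : ℕ ⊕ ℕ × List ℕ) := by
  rw [num]

/-- Injectivity allows equality of values to be tested on their numbers. -/
theorem num_injective (hφ : Function.Injective φ) (hκ : Function.Injective κ) :
    Function.Injective (num φ κ) := by
  intro s
  -- Terms are nested through lists, so the induction carries a second motive for argument lists.
  refine s.rec (motive_1 := fun s => ∀ t, num φ κ s = num φ κ t → s = t)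
    (motive_2 := fun ss => ∀ ts : List (Term F K), ss.map (num φ κ) = ts.map (num φ κ) → ss = ts)
    ?_ ?_ ?_ ?_
  · intro c t h
    cases t with
    | const d => rw [num_const, num_const, encode_inj] at h; rw [hκ (Sum.inl.inj h)]
    | app g ts => rw [num_const, num_app, encode_inj] at h; cases h
  · intro g ss ih t h
    cases t with
    | const d => rw [num_const, num_app, encode_inj] at h; cases h
    | app g' ts =>
      rw [num_app, num_app, encode_inj] at h
      have h := Prod.ext_iff.mp (Sum.inr.inj h)
      rw [hφ h.1, ih ts h.2]
  · intro ts h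
    cases ts with
    | nil => rfl
    | cons => simp at h
  · intro s ss ih₁ ih₂ ts h
    cases ts with
    | nil => simp at h
    | cons t ts =>
      simp only [List.map_cons, List.cons.injEq] at h
      rw [ih₁ t h.1, ih₂ ts h.2]

theorem wordOfFun_num (hφ : Function.Injective φ) (g : F) (t : Term F K) :
    wordOfFun (φ g) (num φ κ t) = (wordOf g t).map (num φ κ) := by
  cases t with
  | const c => rw [wordOfFun, num_const, content_encode, wordOf]; simp [num_const]
  | app g' ts =>
    by_cases h : g' = g
    · subst h
      rw [wordOfFun, num_app, content_encode, wordOf, if_pos rfl]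
      simp
    · rw [wordOfFun, num_app, content_encode, wordOf, if_neg h]
      simp [hφ.ne h, num_app]

theorem joinFun_num (g : F) {x : List (Term F K)} :
    joinFun (φ g) (x.map (num φ κ)) = num φ κ (joinWord g x) := by
  match x with
  | [] => rw [joinFun, if_neg (by simp), joinWord, num_app]; simp
  | [t] => rw [joinFun, if_pos (by simp), joinWord]; simp
  | s :: t :: l => rw [joinFun, if_neg (by simp), joinWord_of_two_le (by simp), num_app]

end Numbering

/-! ### Correctness of the computation and decidability -/

namespace Completion

variable {F C₀ : Type u} [LinearOrder C₀] {sig : Signature F} {f : F} {one : C₀}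
  {C : Set (Cst C₀)} {S : ℕ → Set (Eqn F (Cst C₀))}
  (H : Completion sig f one C S)
include H

section Rules

variable {φ : F → ℕ} {κ : Cst C₀ → ℕ} (hφ : Function.Injective φ) (hκ : Function.Injective κ)

/-- The rules for words of arguments of `g` are represented by the table. -/
def _root_.CCM.IsRuleTable (S : ℕ → Set (Eqn F (Cst C₀))) (f : F) (one : C₀) (φ : F → ℕ)
    (κ : Cst C₀ → ℕ) (rules : List (ℕ × List ℕ × List ℕ)) : Prop :=
  ∀ k v w, (k, v, w) ∈ rules ↔
    (∃ g v' w', WordRule S g v' w' ∧ φ g = k ∧ (letters v').map (num φ κ) = v ∧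
      (letters w').map (num φ κ) = w) ∨
    k = φ f ∧ v = [num φ κ (.const (.inl one) : Term F (Cst C₀))] ∧ w = []

omit [LinearOrder C₀] H in
theorem finite_pairs {P : Set (Eqn F (Cst C₀))} (hP : P.Finite) :
    {p : Term F (Cst C₀) × Term F (Cst C₀) | s(p.1, p.2) ∈ P}.Finite := by
  have : {p : Term F (Cst C₀) × Term F (Cst C₀) | s(p.1, p.2) ∈ P} ⊆
      ⋃ e ∈ P, {p | s(p.1, p.2) = e} := by
    intro p hp
    simpa using hp
  refine (hP.biUnion fun e _ => ?_).subset this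
  induction e using Sym2.ind with
  | _ a b =>
    refine (Set.toFinite {(a, b), (b, a)}).subset ?_
    rintro ⟨s, t⟩ h
    rcases Sym2.eq_iff.mp h with ⟨rfl, rfl⟩ | ⟨rfl, rfl⟩ <;> simp

omit H in
-- A rule between constants is a rule for every symbol, so finiteness of `F` is needed besides
-- finiteness of the set of persisting equations.
theorem exists_ruleTable [Finite F] (hP : (persisting S).Finite) (φ : F → ℕ) (κ : Cst C₀ → ℕ) :
    ∃ rules, IsRuleTable S f one φ κ rules := by
  have h1 : {p : F × List (Cst C₀) × List (Cst C₀) | WordRule S p.1 p.2.1 p.2.2}.Finite := by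
    have h2 : {p : F × List (Cst C₀) × List (Cst C₀) | WordRule S p.1 p.2.1 p.2.2} ⊆
        ⋃ g : F, Prod.mk g '' {p | WordRule S g p.1 p.2} := by
      rintro ⟨g, p⟩ hp
      exact Set.mem_iUnion.mpr ⟨g, p, hp, rfl⟩
    refine (Set.finite_iUnion fun g => Set.Finite.image _ ?_).subset h2
    refine Set.Finite.of_finite_image (f := fun p => (bar g p.1, bar g p.2))
      ((finite_pairs hP).subset ?_) ?_
    · rintro _ ⟨p, hp, rfl⟩
      exact hp.2.2.2
    · rintro ⟨v, w⟩ hp ⟨v', w'⟩ hp' h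
      simp only [Prod.mk.injEq] at h
      exact Prod.ext ((bar_inj hp.1 hp'.1).mp h.1) ((bar_inj hp.2.1 hp'.2.1).mp h.2)
  refine ⟨(φ f, [num φ κ (.const (.inl one) : Term F (Cst C₀))], []) ::
    h1.toFinset.toList.map fun p => (φ p.1, (letters p.2.1).map (num φ κ),
      (letters p.2.2).map (num φ κ)), fun k v w => ?_⟩
  simp only [List.mem_cons, List.mem_map, Finset.mem_toList, Set.Finite.mem_toFinset,
    Set.mem_ofPred_eq, Prod.mk.injEq, Prod.exists]
  exact or_comm

section

variable {rules : List (ℕ × List ℕ × List ℕ)} (hr : IsRuleTable S f one φ κ rules)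
include hφ hκ hr

omit H in
theorem mem_successors_iff (g : F) (x : List (Term F (Cst C₀))) (hx : x ≠ []) (z : List ℕ) :
    z ∈ successors rules (φ g) (x.map (num φ κ)) ↔
      ∃ y, WordStep S f one g x y ∧ y.map (num φ κ) = z := by
  have hinj : Function.Injective (List.map (num φ κ)) :=
    List.map_injective_iff.mpr (num_injective hφ hκ)
  rw [mem_successors]
  constructor
  · rintro ⟨a, v, w, b, hm, hxe, rfl, hne⟩
    obtain ⟨x', b', rfl, hx', rfl⟩ := List.map_eq_append_iff.mp hxe
    obtain ⟨a', v', rfl, rfl, rfl⟩ := List.map_eq_append_iff.mp hx'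
    rcases (hr _ _ _).mp hm with ⟨g', v₀, w₀, hrule, hg, hv, rfl⟩ | ⟨hg, hv, rfl⟩
    · obtain rfl := hφ hg
      obtain rfl := hinj hv
      exact ⟨a' ++ letters w₀ ++ b', .inl ⟨a', v₀, w₀, b', hrule, rfl, rfl⟩, by simp⟩
    · obtain rfl := hφ hg
      have hv : v' = [.const (.inl one)] := hinj (by simpa using hv)
      subst hv
      exact ⟨a' ++ b', .inr ⟨rfl, a', b', by simpa using hne, rfl, rfl⟩, by simp⟩
  · rintro ⟨y, hy, rfl⟩
    have hne := hy.ne_nil.2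
    rcases hy with ⟨a, v, w, b, hrule, rfl, rfl⟩ | ⟨rfl, a, b, hab, rfl, rfl⟩
    · exact ⟨a.map (num φ κ), _, _, b.map (num φ κ), (hr _ _ _).mpr
        (.inl ⟨g, v, w, hrule, rfl, rfl, rfl⟩), by simp, by simp,
        by simpa using hne⟩
    · exact ⟨a.map (num φ κ), _, _, b.map (num φ κ), (hr _ _ _).mpr (.inr ⟨rfl, rfl, rfl⟩),
        by simp, by simp, by simpa using hab⟩

omit H in
theorem stepFun_num {g : F} {x : List (Term F (Cst C₀))} (hx : x ≠ []) :
    (Irr S f one g x ∧ stepFun rules (φ g) (x.map (num φ κ)) = x.map (num φ κ)) ∨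
      ∃ y, WordStep S f one g x y ∧ stepFun rules (φ g) (x.map (num φ κ)) = y.map (num φ κ) := by
  rcases stepFun_spec rules (φ g) (x.map (num φ κ)) with h | ⟨h, h'⟩
  · obtain ⟨y, hy, he⟩ := (mem_successors_iff hφ hκ hr g x hx _).mp h
    exact .inr ⟨y, hy, he.symm⟩
  · refine .inl ⟨fun y hy => ?_, h'⟩
    have := (mem_successors_iff hφ hκ hr g x hx _).mpr ⟨y, hy, rfl⟩
    rw [h] at this
    simp at this

/-- Each proper step lowers the value of the word, so `m` steps suffice for words of value at most
`m`; an irreducible word is a fixed point. Confluence makes the particular rewriting strategy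
irrelevant. -/
theorem iterate_stepFun {δ : Cst C₀ → ℕ} {B : ℕ} (hδ : IsIndex C δ B) {g : F} (hg : g ∈ sig.assoc)
    (m : ℕ) {x : List (Term F (Cst C₀))} (hx : x ≠ []) (hm : wordVal (digit δ) B x ≤ m) :
    (stepFun rules (φ g))^[m] (x.map (num φ κ)) = (nfWord S f one g x).map (num φ κ) := by
  induction m generalizing x with
  | zero =>
    have : Irr S f one g x := fun y hy => by
      have := H.val_of_wordStep hδ hg hy
      omega
    rw [Function.iterate_zero, id, H.nfWord_of_irr hg this]
  | succ m ih =>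
    rcases stepFun_num hφ hκ hr hx with ⟨hirr, he⟩ | ⟨y, hy, he⟩
    · rw [Function.iterate_fixed he, H.nfWord_of_irr hg hirr]
    · rw [Function.iterate_succ_apply, he, ih hy.ne_nil.2,
        H.nfWord_eq_of_star hg (ReflTransGen.single hy)]
      have := H.val_of_wordStep hδ hg hy
      omega

theorem nfFun_num {δ : Cst C₀ → ℕ} {B : ℕ} (hδ : IsIndex C δ B) {g : F} (hg : g ∈ sig.assoc)
    {x : List (Term F (Cst C₀))} (hx : x ≠ []) :
    nfFun rules B (φ g) (x.map (num φ κ)) = (nfWord S f one g x).map (num φ κ) := by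
  rw [nfFun, List.length_map]
  exact H.iterate_stepFun hφ hκ hr hδ hg _ hx (wordVal_lt hδ.digit_lt x).le

end

end Rules

open Classical in
/-- The numbers that describe the symbols: `0` if there is no symbol with the given number, `1` for
associative symbols, and the arity plus one for the other symbols. -/
noncomputable def _root_.CCM.kindFun (sig : Signature F) (φ : F → ℕ) : ℕ → ℕ :=
  Function.extend φ (fun g => if g ∈ sig.assoc then 1 else sig.arity g + 1) 0

omit [LinearOrder C₀] H in
theorem primrec_extend {α : Type*} [Finite α] (ψ e : α → ℕ) : Primrec (Function.extend ψ e 0) := by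
  refine primrec_of_finite_ne (.const 0) ((Set.finite_range ψ).subset fun n hn => ?_)
  by_contra h
  exact hn (Function.extend_apply' _ _ _ fun ⟨a, ha⟩ => h ⟨a, ha⟩)

open Classical in
/-- Reduction at the root of terms headed by symbols that are not associative. -/
noncomputable def _root_.CCM.rootReduct (sig : Signature F) (S : ℕ → Set (Eqn F (Cst C₀))) (f : F)
    (one : C₀) : Term F (Cst C₀) → Term F (Cst C₀)
  | .const c => .const c
  | .app h vs => if h ∈ sig.assoc then .app h vs else valOp sig S f one h vs

omit H in
-- Root reduction changes a term only if it is a side of a persisting equation, so the function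
-- differs from the identity at finitely many numbers.
theorem primrec_extend_rootReduct (hP : (persisting S).Finite) {ν : Term F (Cst C₀) → ℕ}
    (hν : Function.Injective ν) :
    Primrec (Function.extend ν (fun t => ν (rootReduct sig S f one t)) id) := by
  refine primrec_of_finite_ne .id ((((finite_pairs hP).image Prod.fst).image ν).subset ?_)
  intro n hn
  rw [Set.mem_ofPred_eq] at hn
  by_cases h : ∃ t, ν t = n
  · obtain ⟨t, rfl⟩ := h
    rw [hν.extend_apply] at hn
    refine ⟨t, ?_, rfl⟩
    cases t with
    | const c => exact absurd rfl hn
    | app g vs =>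
      rw [rootReduct] at hn
      split_ifs at hn with hg
      · exact absurd rfl hn
      · rw [valOp, if_neg hg] at hn
        split_ifs at hn with hd
        · exact ⟨(.app g vs, .const hd.choose), hd.choose_spec, rfl⟩
        · exact absurd rfl hn
  · exact absurd (Function.extend_apply' _ _ _ h) hn

variable {φ : F → ℕ} {κ : Cst C₀ → ℕ} {ι : C₀ → ℕ}

/-- Data that describes the algebra of values. -/
structure _root_.CCM.Represents (sig : Signature F) (S : ℕ → Set (Eqn F (Cst C₀))) (f : F)
    (one : C₀) (V : ValueData) (φ : F → ℕ) (κ : Cst C₀ → ℕ) (ι : C₀ → ℕ) : Prop where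
  kind : V.kind = kindFun sig φ
  cst : ∀ n m, V.cst n = m + 1 ↔ ∃ a, ι a = n ∧ num φ κ (hat S f one (.inl a)) = m
  op : ∀ g vs, vs ≠ [] → (∀ v ∈ vs, Val sig S f one v) →
    V.op (φ g) (vs.map (num φ κ)) = num φ κ (valOp sig S f one g vs)

theorem exists_represents [Finite F] [Finite C₀] (hP : (persisting S).Finite)
    (hφ : Function.Injective φ) (hκ : Function.Injective κ) (hι : Function.Injective ι) :
    ∃ V, Represents sig S f one V φ κ ι := by
  classical
  obtain ⟨δ, B, hδ⟩ := H.exists_isIndex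
  obtain ⟨rules, hr⟩ := exists_ruleTable (f := f) (one := one) hP φ κ
  have hν := num_injective hφ hκ
  refine ⟨{ rules := rules
            base := B
            kind := kindFun sig φ
            cst := Function.extend ι (fun a => num φ κ (hat S f one (.inl a)) + 1) 0
            red := Function.extend (num φ κ) (fun t => num φ κ (rootReduct sig S f one t)) id
            primrec_kind := primrec_extend _ _
            primrec_cst := primrec_extend _ _
            primrec_red := primrec_extend_rootReduct hP hν }, rfl, fun n m => ?_, ?_⟩
  · dsimp only
    by_cases h : ∃ a, ι a = n
    · obtain ⟨a, rfl⟩ := h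
      rw [hι.extend_apply]
      simp [hι.eq_iff]
    · rw [Function.extend_apply' _ _ _ h]
      refine ⟨fun h' => by simp at h', fun ⟨a, ha, _⟩ => absurd ⟨a, ha⟩ h⟩
  · intro g vs hne hvs
    rw [ValueData.op]
    dsimp only
    have hk : kindFun sig φ (φ g) = _ := hφ.extend_apply _ _ g
    by_cases hg : g ∈ sig.assoc
    · rw [if_pos hg] at hk
      refine (if_pos hk).trans ?_
      rw [valOp_assoc hg hne]
      have : (vs.map (num φ κ)).flatMap (wordOfFun (φ g)) =
          (vs.flatMap (wordOf g)).map (num φ κ) := by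
        rw [List.flatMap_map, List.map_flatMap]
        simp only [wordOfFun_num hφ]
      rw [this, H.nfFun_num hφ hκ hr hδ hg (flatMap_ne_nil hg hvs hne), joinFun_num]
    · have := sig.arity_pos g
      rw [if_neg hg] at hk
      refine (if_neg (by rw [hk]; omega)).trans ?_
      rw [← num_app, hν.extend_apply, rootReduct, if_neg hg]

omit H in
theorem valid_iff {V : ValueData} (hV : V.kind = kindFun sig φ) (hφ : Function.Injective φ)
    (k n : ℕ) : V.Valid k n ↔ ∃ g, φ g = k ∧ sig.ValidArity g n := by
  rw [ValueData.Valid, hV, kindFun]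
  by_cases h : ∃ g, φ g = k
  · obtain ⟨g, rfl⟩ := h
    rw [hφ.extend_apply]
    have := sig.arity_pos g
    by_cases hg : g ∈ sig.assoc
    · simp only [hφ.eq_iff, exists_eq_left, Signature.ValidArity, hg, if_true]
      simp
    · simp only [hφ.eq_iff, exists_eq_left, Signature.ValidArity, hg, if_false]
      simp
      omega
  · rw [Function.extend_apply' _ _ _ h]
    simp only [Pi.zero_apply]
    constructor
    · omega
    · rintro ⟨g, hg, _⟩
      exact absurd ⟨g, hg⟩ h

omit [LinearOrder C₀] H in
theorem code_const (c : Cst C₀) :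
    code (F := F) φ ι (.const c) = [.inl (Sum.elim ι ULift.down c)] := by
  rw [code]

omit [LinearOrder C₀] H in
theorem code_app (g : F) (ts : List (Term F (Cst C₀))) :
    code φ ι (.app g ts) = .inr (φ g, ts.length) :: (ts.map (code φ ι)).flatten := by
  rw [code]

section Run

variable {V : ValueData} (hV : Represents sig S f one V φ κ ι)
include hV

theorem push_const (a : C₀) (st : List ℕ) :
    V.push (.inl (ι a)) st = some (num φ κ (H.value (.const (.inl a))) :: st) := by
  have := (hV.cst (ι a) _).mpr ⟨a, rfl, rfl⟩
  simp [ValueData.push, this, H.value_const]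

theorem op_values {g : F} {ts : List (Term F (Cst C₀))} (hne : ts ≠ []) :
    V.op (φ g) (ts.map fun t => num φ κ (H.value t)) = num φ κ (H.value (.app g ts)) := by
  rw [H.value_app, ← hV.op g _ (by simpa using hne), List.map_map]
  · rfl
  · intro v hv
    obtain ⟨t, -, rfl⟩ := List.mem_map.mp hv
    exact H.val_value t

variable (hφ : Function.Injective φ)
include hφ

theorem push_app {g : F} {ts : List (Term F (Cst C₀))} (hts : sig.ValidArity g ts.length)
    (st : List ℕ) : V.push (.inr (φ g, ts.length)) ((ts.map fun t => num φ κ (H.value t)) ++ st) =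
      some (num φ κ (H.value (.app g ts)) :: st) := by
  -- Arities are positive, so the default value of operations at the empty list never arises.
  have hne : ts ≠ [] := by
    rintro rfl
    have := sig.arity_pos g
    rcases hts with h | h <;> simp at h
    omega
  have h := (valid_iff hV.kind hφ _ _).mpr ⟨g, rfl, hts⟩
  simp only [ValueData.push, Sum.elim_inr, h, true_and, List.length_append, List.length_map,
    Nat.le_add_right, if_true]
  rw [List.take_left' (by simp), List.drop_left' (by simp), H.op_values hV hne]

/-- Read backwards, the word of a term has its arguments processed before its head symbol, which
then finds their values on top of the stack. -/
theorem run_code {s : Term F (Cst C₀)} (hs : Ground sig (baseConsts C₀) s)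
    (w : List (ℕ ⊕ ℕ × ℕ)) (st : List ℕ) (hw : V.run w = some st) :
    V.run (code φ ι s ++ w) = some (num φ κ (H.value s) :: st) := by
  induction hs generalizing w st with
  | const c hc =>
    obtain ⟨a, rfl⟩ := hc
    rw [code_const]
    have := H.push_const hV a st
    simp only [ValueData.run] at hw
    simpa [ValueData.run, hw] using this
  | app g ts hts _ ih =>
    have key : ∀ ss : List (Term F (Cst C₀)), (∀ t ∈ ss, t ∈ ts) →
        V.run ((ss.map (code φ ι)).flatten ++ w) =
          some ((ss.map fun t => num φ κ (H.value t)) ++ st) := by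
      intro ss hss
      induction ss with
      | nil => simpa using hw
      | cons s ss ih' =>
        simp only [List.map_cons, List.flatten_cons, List.append_assoc, List.cons_append]
        exact ih s (hss s (by simp)) _ _ (ih' fun t ht => hss t (by simp [ht]))
    rw [code_app, List.cons_append, ValueData.run, List.foldr_cons]
    have := key ts fun _ h => h
    rw [ValueData.run] at this
    rw [this, Option.bind_some, H.push_app hV hφ hts]

/-- A successful run certifies that the input is well formed: every letter accepted by the machine
can be read as a constant or as the head of a term built from the topmost ones. -/
theorem run_eq_some {w : List (ℕ ⊕ ℕ × ℕ)} {st : List ℕ} (hw : V.run w = some st) :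
    ∃ ts : List (Term F (Cst C₀)), (∀ t ∈ ts, Ground sig (baseConsts C₀) t) ∧
      w = (ts.map (code φ ι)).flatten ∧ st = ts.map fun t => num φ κ (H.value t) := by
  induction w generalizing st with
  | nil => exact ⟨[], by simp, rfl, by simpa [ValueData.run] using hw.symm⟩
  | cons l w ih =>
    rw [ValueData.run, List.foldr_cons, Option.bind_eq_some_iff] at hw
    obtain ⟨st', hst', hp⟩ := hw
    obtain ⟨ts, hts, rfl, rfl⟩ := ih hst'
    rcases l with k | ⟨k, n⟩
    · simp only [ValueData.push, Sum.elim_inl] at hp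
      split_ifs at hp with hk
      obtain ⟨a, rfl, -⟩ := (hV.cst k (V.cst k - 1)).mp (by omega)
      have := H.push_const hV a (ts.map fun t => num φ κ (H.value t))
      simp only [ValueData.push, Sum.elim_inl, if_neg hk] at this
      rw [this, Option.some.injEq] at hp
      refine ⟨.const (.inl a) :: ts, ?_, by simp [code_const], by simp [← hp]⟩
      simp only [List.mem_cons, forall_eq_or_imp]
      exact ⟨.const _ ⟨a, rfl⟩, hts⟩
    · simp only [ValueData.push, Sum.elim_inr, List.length_map] at hp
      split_ifs at hp with hk
      obtain ⟨g, rfl, hg⟩ := (valid_iff hV.kind hφ _ _).mp hk.1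
      have hlen : (ts.take n).length = n := by simp [hk.2]
      have := H.push_app hV hφ (ts := ts.take n) (g := g) (by rwa [hlen])
        ((ts.drop n).map fun t => num φ κ (H.value t))
      rw [hlen, ← List.map_append, List.take_append_drop] at this
      simp only [ValueData.push, Sum.elim_inr, List.length_map, if_pos hk] at this
      rw [this, Option.some.injEq] at hp
      refine ⟨.app g (ts.take n) :: ts.drop n, ?_, ?_, by simp [← hp]⟩
      · simp only [List.mem_cons, forall_eq_or_imp]
        exact ⟨.app _ _ (by rwa [hlen]) fun t ht => hts t (List.mem_of_mem_take ht),
          fun t ht => hts t (List.mem_of_mem_drop ht)⟩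
      · rw [List.map_cons, List.flatten_cons, code_app, hlen, List.cons_append,
          ← List.flatten_append, ← List.map_append, List.take_append_drop]

/-- A word denotes a single term exactly when the run succeeds with one entry on the stack. That
entry determines the value, because the numbering is injective. -/
theorem exists_code_iff (hκ : Function.Injective κ) (w w' : List (ℕ ⊕ ℕ × ℕ)) :
    (∃ s t, Ground sig (baseConsts C₀) s ∧ Ground sig (baseConsts C₀) t ∧
        code φ ι s = w ∧ code φ ι t = w' ∧ H.value s = H.value t) ↔
      V.run w = V.run w' ∧ (V.run w).map List.length = some 1 := by
  constructor
  · rintro ⟨s, t, hs, ht, rfl, rfl, h⟩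
    have h1 := H.run_code hV hφ hs [] [] rfl
    have h2 := H.run_code hV hφ ht [] [] rfl
    rw [List.append_nil] at h1 h2
    rw [h1, h2, h]
    simp
  · rintro ⟨h, h1⟩
    obtain ⟨st, hst, hl⟩ := Option.map_eq_some_iff.mp h1
    obtain ⟨ss, hss, rfl, rfl⟩ := H.run_eq_some hV hφ hst
    obtain ⟨ts, hts, rfl, he⟩ := H.run_eq_some hV hφ (h ▸ hst)
    have hlen := congrArg List.length he
    simp only [List.length_map] at hl hlen
    obtain ⟨s, rfl⟩ := List.length_eq_one_iff.mp hl
    obtain ⟨t, rfl⟩ := List.length_eq_one_iff.mp (hlen ▸ hl)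
    exact ⟨s, t, hss s (by simp), hts t (by simp), by simp, by simp,
      num_injective hφ hκ (by simpa using he)⟩

end Run

/-- Equality of values of terms over the original constants is decidable if the set of persisting
equations is finite. -/
theorem decidableOnTerms [Finite F] [Finite C₀] (hP : (persisting S).Finite)
    {P : Term F (Cst C₀) → Term F (Cst C₀) → Prop}
    (h : ∀ s t, Ground sig (baseConsts C₀) s → Ground sig (baseConsts C₀) t →
      (P s t ↔ H.value s = H.value t)) : DecidableOnTerms sig P := by
  intro φ ι hφ hι
  -- Values may contain new constants, so the machine uses its own numbering of all constants; the
  -- given numbering `ι` serves only to read the input.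
  obtain ⟨κ, hκ⟩ := exists_injective_nat (Cst C₀)
  obtain ⟨V, hV⟩ := H.exists_represents hP hφ hκ hι
  have h1 : PrimrecPred fun w : List (ℕ ⊕ ℕ × ℕ) × List (ℕ ⊕ ℕ × ℕ) =>
      V.run w.1 = V.run w.2 ∧ (V.run w.1).map List.length = some 1 :=
    (Primrec.eq.comp (V.primrec_run.comp .fst) (V.primrec_run.comp .snd)).and
      (Primrec.eq.comp (Primrec.option_map (V.primrec_run.comp .fst)
        (Primrec.list_length.comp .snd).to₂) (.const _))
  obtain ⟨hd, h2⟩ := h1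
  refine ComputablePred.of_eq ⟨hd, h2.to_comp⟩ fun w => ?_
  rw [← H.exists_code_iff hV hφ hκ]
  refine exists_congr fun s => exists_congr fun t => ?_
  constructor
  · rintro ⟨hs, ht, e₁, e₂, e⟩
    exact ⟨hs, ht, e₁, e₂, (h s t hs ht).mpr e⟩
  · rintro ⟨hs, ht, e₁, e₂, e⟩
    exact ⟨hs, ht, e₁, e₂, (h s t hs ht).mp e⟩

end Completion

end CCM

/-! ### The main theorem -/

theorem lemma4p6 {F C₀ : Type u} [Finite F] [Finite C₀] [LinearOrder C₀]
    (sig : Signature F) (f : F) (hf : f ∈ sig.assoc)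
    (one : C₀) (hone : ∀ c : C₀, one ≤ c)
    (E : Set (Eqn F (Cst C₀))) (hEfin : E.Finite)
    (hE : ∀ e ∈ E, ∀ t ∈ e, Ground sig (baseConsts C₀) t)
    (E' : Set (Eqn F (Cst C₀))) (D : Set ℕ) (hI : PhaseI sig f one E E' D)
    (S : ℕ → Set (Eqn F (Cst C₀)))
    (hS0 : S 0 = E' ∪ unitEqns f one (allConsts C₀ D))
    (hder : IsDerivation sig S) (hfair : IsFair sig S) :
    (∀ s, Ground sig (baseConsts C₀) s →
      (∃ u, IsNormalFormOf sig (allConsts C₀ D)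
        (completedRules sig f one (allConsts C₀ D) (persisting S)) s u) ∧
      ∀ u v, IsNormalFormOf sig (allConsts C₀ D)
          (completedRules sig f one (allConsts C₀ D) (persisting S)) s u →
        IsNormalFormOf sig (allConsts C₀ D)
          (completedRules sig f one (allConsts C₀ D) (persisting S)) s v →
        AEq sig (allConsts C₀ D) u v) ∧
    (∀ s₀ t₀, Ground sig (baseConsts C₀) s₀ → Ground sig (baseConsts C₀) t₀ →
      (CCMonoid sig f (.inl one) (baseConsts C₀) E s₀ t₀ ↔
        SameNormalForm sig (allConsts C₀ D)
          (completedRules sig f one (allConsts C₀ D) (persisting S)) s₀ t₀)) ∧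
    ((persisting S).Finite →
      DecidableOnTerms sig (EntailsMonoid sig f (.inl one) E)) := by
  have hI' := hI.invariant hf hE
  have H := Completion.of_phaseI hf hone hI' hI.2 hS0 hder hfair
  have hmono {s : Term F (Cst C₀)} (hs : Ground sig (baseConsts C₀) s) :
      Ground sig (allConsts C₀ D) s := hs.mono (baseConsts_subset D)
  refine ⟨fun s hs => ⟨H.exists_normalForm s, fun u v => H.normalForm_unique (hmono hs)⟩,
    fun s t hs ht => ?_, fun hfin => H.decidableOnTerms hfin fun s t hs ht => ?_⟩
  · rw [H.ccMonoid_iff hE hI' hS0 hs ht, H.sameNormalForm_iff (hmono hs) (hmono ht)]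
  · rw [← H.ccMonoid_iff hE hI' hS0 hs ht]
    exact entailsMonoid_iff hf (Set.mem_range_self one) hE hs ht
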